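/- \textbf{Setting.} Let $\triangle=\{(s,t)\in\mathbb R^2: s<t\}$, let $\mathcal X$ be a Polish space, $\alpha>0$, and let $\Xi$ be a probability measure on $(0,\infty)\times\mathcal X$ with $\int a\,\Xi(\mathrm da\,\mathrm d\chi)<\infty$. Let $(d_n)_{n\ge1}$ be i.i.d. $\operatorname{Exp}(\alpha)$ and, independently, $((a_n,\chi_n))_{n\ge1}$ i.i.d. with law $\Xi$; put $T_n=d_n+a_n$, $S_n=T_1+\dots+T_n$, and $$\eta=\sum_{n\ge1}\delta_{(S_{n-1}+d_n,\;S_n,\;\chi_n)},$$ a point process on $\triangle\times\mathcal X$ with law $\Gamma^\Xi_\alpha$. We say that $\sum_i\delta_{(s_i,t_i,x_i)}$ is dormant at $u$ if $u\notin[s_i,t_i)$ for all $i$. Let $\theta_u\sum_i\delta_{(s_i,t_i,x_i)}=\sum_i\delta_{(s_i-u,t_i-u,x_i)}$, and let $R_a^b$ (resp. $R_0^\infty$) be the restriction to those $(s,t,x)$ for which $[s,t]$ intersects $[a,b]$ (resp. $[0,\infty)$). For $t>0$ let $\Gamma^\Xi_{\alpha,t}$ be the law of $R_{-t}^t\theta_t\eta$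 conditionally on $\eta$ being dormant at $2t$. Let $E:\mathcal X\to\mathbb R\cup\{-\infty\}$ be measurable, $\mathcal H(\sum_{k=1}^n\delta_{(s_k,t_k,x_k)})=\sum_{k=1}^nE(x_k)$, $e^{\infty}=\infty$, and $$\widehat\Gamma^\Xi_{\alpha,t}(\mathrm d\zeta)=\frac1{\mathbf Z_{2t}}e^{-\mathcal H(\zeta)}\,\Gamma^\Xi_{\alpha,t}(\mathrm d\zeta),\qquad \mathbf Z_{2t}=\int e^{-\mathcal H}\,\mathrm d\Gamma^\Xi_{\alpha,t}.$$ If $\mathbb E[a_1]<\infty$, the stationary law $\Gamma^\Xi_{\alpha,\mathrm{st}}$ is $$\Gamma^\Xi_{\alpha,\mathrm{st}}(B)=\frac1{\mathbb E[T]}\,\mathbb E\Big[\int_0^{T}\mathbf 1_B(\theta_u\bar\eta)\,\mathrm du\Big],$$ where $\bar\eta$ is the two-sided alternating process on $\mathbb R$ with i.i.d. cycles (an $\operatorname{Exp}(\alpha)$ dormant period followed by an independent active period and state with joint law $\Xi$), one of which starts at time $0$, and $T$ is the length of the cycle starting at $0$. Probability measures $\mathcal P_t$ converge to $\mathcal P$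 locally in total variation if $\mathcal P_t\circ(R_a^b)^{-1}\to\mathcal P\circ(R_a^b)^{-1}$ in total variation as $t\to\infty$ for all $a<b$. \textbf{Statement.} Let $\lambda\in\mathbb R$ satisfy $$\mathbb E\big[e^{-\lambda T_1-E(\chi_1)}\big]=1\quad\text{and}\quad\mathbb E\big[T_1e^{-\lambda T_1-E(\chi_1)}\big]<\infty .$$ Then $\alpha+\lambda>0$; $$\widehat\Xi(\mathrm da\,\mathrm d\chi)=\frac{\alpha}{\alpha+\lambda}e^{-\lambda a-E(\chi)}\,\Xi(\mathrm da\,\mathrm d\chi)$$ is a probability measure with $\int a\,\mathrm d\widehat\Xi<\infty$; each $\widehat\Gamma^\Xi_{\alpha,t}$, $t>0$, is a well-defined probability measure; $\Gamma^{\widehat\Xi}_{\alpha+\lambda,\mathrm{st}}$ is a probability measure which is invariant under all translations $\theta_u$, $u\in\mathbb R$, and is the stationary version of $\Gamma^{\widehat\Xi}_{\alpha+\lambda}$ in the sense that, for $\hat\eta\sim\Gamma^{\widehat\Xi}_{\alpha+\lambda}$, the law of $R_0^\infty\theta_t\hat\eta$ converges in total variation to $\Gamma^{\widehat\Xi}_{\alpha+\lambda,\mathrm{st}}\circ(R_0^\infty)^{-1}$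 as $t\to\infty$; and $$\widehat\Gamma^\Xi_{\alpha,t}\longrightarrow\Gamma^{\widehat\Xi}_{\alpha+\lambda,\mathrm{st}}\quad\text{locally in total variation as }t\to\infty .$$ -/

import Mathlib

open MeasureTheory ProbabilityTheory Filter Topology Set
open scoped ENNReal

noncomputable section

namespace MarkedPartition

/-! ### Point processes -/

/-- The space `N(X)` of point measures on `X`: countable sums `∑ᵢ δ_{pᵢ}` of Dirac measures. As a
subtype of `Measure X` it carries the σ-algebra generated by the evaluations `ζ ↦ ζ B`, `B`
measurable. -/
abbrev PointMeasure (X : Type*) [MeasurableSpace X] :=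
  {ζ : Measure X // ∃ (ι : Type) (_ : Countable ι) (p : ι → X),
    ζ = Measure.sum fun i => Measure.dirac (p i)}

/-- The point measure `∑ᵢ δ_{pᵢ}`. -/
def PointMeasure.ofPoints {X : Type*} [MeasurableSpace X] {ι : Type} [Countable ι] (p : ι → X) :
    PointMeasure X :=
  ⟨Measure.sum fun i => Measure.dirac (p i), ι, inferInstance, p, rfl⟩

/-- The half-plane `△` of (nondegenerate, bounded) time intervals `(s, t)`, `s < t`. -/
abbrev Triangle := {p : ℝ × ℝ // p.1 < p.2}

section

variable {𝒳 : Type*} [MeasurableSpace 𝒳]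

/-- Translation of a marked interval by `-u`. -/
def shiftPoint (u : ℝ) (q : Triangle × 𝒳) : Triangle × 𝒳 :=
  (⟨(q.1.1.1 - u, q.1.1.2 - u), sub_lt_sub_right q.1.2 u⟩, q.2)

theorem measurable_shiftPoint (u : ℝ) :
    Measurable (shiftPoint u : Triangle × 𝒳 → Triangle × 𝒳) := by
  unfold shiftPoint
  fun_prop

/-- The translation `θ_u : ∑ δ_{(s, t, x)} ↦ ∑ δ_{(s - u, t - u, x)}`. -/
def shift (u : ℝ) (ζ : PointMeasure (Triangle × 𝒳)) : PointMeasure (Triangle × 𝒳) :=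
  ⟨ζ.1.map (shiftPoint u), by
    obtain ⟨_, ι, hι, p, rfl⟩ := ζ
    refine ⟨ι, hι, fun i => shiftPoint u (p i), ?_⟩
    rw [Measure.map_sum (measurable_shiftPoint u).aemeasurable]
    simp_rw [Measure.map_dirac' (measurable_shiftPoint u)]⟩

/-- The marked intervals `(s, t, x)` such that `[s, t]` intersects `I`. -/
def hitting (𝒳 : Type*) (I : Set ℝ) : Set (Triangle × 𝒳) :=
  {q | (Icc q.1.1.1 q.1.1.2 ∩ I).Nonempty}

/-- The restriction of a point measure to the marked intervals that intersect `I`. The map `R_a^b`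
is `restrictTo (Icc a b)` and `R_0^∞` is `restrictTo (Ici 0)`. -/
def restrictTo [MeasurableSingletonClass 𝒳] (I : Set ℝ) (ζ : PointMeasure (Triangle × 𝒳)) :
    PointMeasure (Triangle × 𝒳) :=
  ⟨ζ.1.restrict (hitting 𝒳 I), by
    classical
    obtain ⟨_, ι, hι, p, rfl⟩ := ζ
    refine ⟨{i // p i ∈ hitting 𝒳 I}, inferInstance, fun i => p i.1, ?_⟩
    rw [Measure.restrict_sum_of_countable]
    simp_rw [restrict_dirac]
    ext B hB
    rw [Measure.sum_apply _ hB, Measure.sum_apply _ hB]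
    rw [show (∑' i : {i // p i ∈ hitting 𝒳 I}, Measure.dirac (p i.1) B) = _ from
      tsum_subtype {i | p i ∈ hitting 𝒳 I} fun i => Measure.dirac (p i) B]
    refine tsum_congr fun i => ?_
    by_cases h : p i ∈ hitting 𝒳 I <;> simp [h, Set.indicator]⟩

/-- The event that the system is dormant at time `u`: no marked interval `[s, t)` contains `u`. -/
def dormantAt (𝒳 : Type*) [MeasurableSpace 𝒳] (u : ℝ) : Set (PointMeasure (Triangle × 𝒳)) :=
  {ζ | ζ.1 {q | q.1.1.1 ≤ u ∧ u < q.1.1.2} = 0}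

/-! ### The alternating process -/

/-- A cycle `(d, a, χ)`: a dormant period of length `d`, followed by an active period of length
`a > 0` in state `χ`. -/
abbrev RenewalCycle (𝒳 : Type*) := ℝ × (Ioi (0 : ℝ) × 𝒳)

/-- The duration `T = d + a` of a cycle. -/
def RenewalCycle.duration (c : RenewalCycle 𝒳) : ℝ := c.1 + (c.2.1 : ℝ)

/-- The active interval of a cycle which starts at time `S`, marked with its state. -/
def RenewalCycle.interval (S : ℝ) (c : RenewalCycle 𝒳) : Triangle × 𝒳 :=
  (⟨(S + c.1, S + c.1 + (c.2.1 : ℝ)), lt_add_of_pos_right _ c.2.1.2⟩, c.2.2)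

/-- The law `Exp(α) ⊗ Ξ` of a cycle. -/
def cycleLaw (α : ℝ) (Ξ : Measure (Ioi (0 : ℝ) × 𝒳)) : Measure (RenewalCycle 𝒳) :=
  (expMeasure α).prod Ξ

/-- The process `η` started dormant at time `0`, as a function of the successive cycles. The
cycles are numbered from `0`. -/
def alternating (c : ℕ → RenewalCycle 𝒳) : PointMeasure (Triangle × 𝒳) :=
  PointMeasure.ofPoints fun n => (c n).interval (∑ k ∈ Finset.range n, (c k).duration)

/-- The law `Γ_α^Ξ` of the alternating process started dormant at time `0`, with i.i.d. cycles of
law `Exp(α) ⊗ Ξ`. -/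
def alternatingLaw (α : ℝ) (Ξ : Measure (Ioi (0 : ℝ) × 𝒳)) :
    Measure (PointMeasure (Triangle × 𝒳)) :=
  (Measure.infinitePi fun _ : ℕ => cycleLaw α Ξ).map alternating

/-! ### The stationary version -/

/-- The starting time of the `n`-th cycle of a two-sided sequence of cycles, the `0`-th of which
starts at time `0`. -/
def startTime (c : ℤ → RenewalCycle 𝒳) : ℤ → ℝ
  | Int.ofNat n => ∑ k ∈ Finset.range n, (c (Int.ofNat k)).duration
  | Int.negSucc n => -∑ k ∈ Finset.range (n + 1), (c (Int.negSucc k)).duration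

/-- The two-sided alternating process with a cycle starting at time `0`. -/
def twoSided (c : ℤ → RenewalCycle 𝒳) : PointMeasure (Triangle × 𝒳) :=
  PointMeasure.ofPoints fun n : ℤ => (c n).interval (startTime c n)

/-- The law `Γ_{α,st}^Ξ` of the stationary alternating process, by Palm inversion:
`B ↦ E[T]⁻¹ * E[∫_0^T 1_B(θ_u η) du]`, where `η` is the two-sided alternating process with i.i.d.
cycles of law `Exp(α) ⊗ Ξ` and `T` is the duration of the cycle that starts at time `0`. -/
def stationaryLaw (α : ℝ) (Ξ : Measure (Ioi (0 : ℝ) × 𝒳)) :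
    Measure (PointMeasure (Triangle × 𝒳)) :=
  (∫⁻ c, ENNReal.ofReal c.duration ∂cycleLaw α Ξ)⁻¹ •
    (((Measure.infinitePi fun _ : ℤ => cycleLaw α Ξ).prod volume).restrict
      {q : (ℤ → RenewalCycle 𝒳) × ℝ | 0 ≤ q.2 ∧ q.2 < (q.1 0).duration}).map
        fun q => shift q.2 (twoSided q.1)

/-- Stationarity: invariance under all translations. -/
def IsStationary (P : Measure (PointMeasure (Triangle × 𝒳))) : Prop :=
  ∀ u : ℝ, P.map (shift u) = P

/-! ### Convergence in total variation -/

/-- The total variation distance `sup_A |μ(A) - ν(A)|`. -/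
def tvDist {X : Type*} [MeasurableSpace X] (μ ν : Measure X) : ℝ≥0∞ :=
  ⨆ (A : Set X) (_ : MeasurableSet A), max (μ A - ν A) (ν A - μ A)

/-- `P_t → Q` locally in total variation as `t → ∞`. -/
def TendstoLocallyTV [MeasurableSingletonClass 𝒳]
    (P : ℝ → Measure (PointMeasure (Triangle × 𝒳)))
    (Q : Measure (PointMeasure (Triangle × 𝒳))) : Prop :=
  ∀ a b : ℝ, a < b → Tendsto
    (fun t => tvDist ((P t).map (restrictTo (Icc a b))) (Q.map (restrictTo (Icc a b))))
    atTop (𝓝 0)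

/-- `P` is a stationary version of the alternating process `η` with law `Γ_α^Ξ`: a stationary
probability measure such that the law of `R_0^∞ θ_t η` converges to the law of `R_0^∞` under `P`
in total variation as `t → ∞`. -/
def IsStationaryVersion [MeasurableSingletonClass 𝒳] (α : ℝ) (Ξ : Measure (Ioi (0 : ℝ) × 𝒳))
    (P : Measure (PointMeasure (Triangle × 𝒳))) : Prop :=
  IsProbabilityMeasure P ∧ IsStationary P ∧
    Tendsto (fun t : ℝ => tvDist
      ((alternatingLaw α Ξ).map fun ζ => restrictTo (Ici 0) (shift t ζ))
      (P.map (restrictTo (Ici 0)))) atTop (𝓝 0)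

/-! ### Gibbs measures -/

/-- The law `Γ_{α,t}^Ξ` of `R_{-t}^t θ_t η` conditionally on `η` being dormant at time `2t`. -/
def referenceLaw [MeasurableSingletonClass 𝒳] (α : ℝ) (Ξ : Measure (Ioi (0 : ℝ) × 𝒳)) (t : ℝ) :
    Measure (PointMeasure (Triangle × 𝒳)) :=
  ((alternatingLaw α Ξ)[|dormantAt 𝒳 (2 * t)]).map fun ζ => restrictTo (Icc (-t) t) (shift t ζ)

/-- The Hamiltonian `H(ζ) = ∫ E(x) ζ(ds dt dx)`, i.e. `H(∑_{k<n} δ_{(s_k, t_k, x_k)}) = ∑_{k<n} E(x_k)`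
for finite point measures, see `hamiltonian_ofPoints`. (The measures `Γ_{α,t}^Ξ` are carried by the
finite point measures.) -/
def hamiltonian (E : 𝒳 → EReal) (ζ : PointMeasure (Triangle × 𝒳)) : EReal :=
  ((∫⁻ q, (E q.2).toENNReal ∂ζ.1 : ℝ≥0∞) : EReal) - ((∫⁻ q, (-E q.2).toENNReal ∂ζ.1 : ℝ≥0∞) : EReal)

/-- The partition function `Z_{2t} = ∫ e^{-H} dΓ_{α,t}^Ξ`. -/
def partitionFunction [MeasurableSingletonClass 𝒳] (α : ℝ) (Ξ : Measure (Ioi (0 : ℝ) × 𝒳))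
    (E : 𝒳 → EReal) (t : ℝ) : ℝ≥0∞ :=
  ∫⁻ ζ, EReal.exp (-hamiltonian E ζ) ∂referenceLaw α Ξ t

/-- The Gibbs measure `Z_{2t}⁻¹ e^{-H} dΓ_{α,t}^Ξ`. -/
def gibbsLaw [MeasurableSingletonClass 𝒳] (α : ℝ) (Ξ : Measure (Ioi (0 : ℝ) × 𝒳))
    (E : 𝒳 → EReal) (t : ℝ) : Measure (PointMeasure (Triangle × 𝒳)) :=
  (partitionFunction α Ξ E t)⁻¹ •
    (referenceLaw α Ξ t).withDensity fun ζ => EReal.exp (-hamiltonian E ζ)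

/-- The tilted law `α / (α + lam) * e^{-lam a - E(χ)} Ξ(da dχ)`. -/
def tiltedLaw (α lam : ℝ) (Ξ : Measure (Ioi (0 : ℝ) × 𝒳)) (E : 𝒳 → EReal) :
    Measure (Ioi (0 : ℝ) × 𝒳) :=
  ENNReal.ofReal (α / (α + lam)) •
    Ξ.withDensity fun y => EReal.exp (((-(lam * (y.1 : ℝ)) : ℝ) : EReal) - E y.2)

theorem toENNReal_sub_toENNReal_neg (x : EReal) :
    ((x.toENNReal : ℝ≥0∞) : EReal) - (((-x).toENNReal : ℝ≥0∞) : EReal) = x := by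
  rcases le_total 0 x with h | h
  · rw [EReal.coe_toENNReal h, EReal.toENNReal_of_nonpos (by simpa using h)]
    simp
  · rw [EReal.toENNReal_of_nonpos h, EReal.coe_toENNReal (by simpa using h)]
    simp

theorem hamiltonian_ofPoints {E : 𝒳 → EReal} (hE : Measurable E) (hE' : ∀ x, E x ≠ ⊤) {n : ℕ}
    (p : Fin n → Triangle × 𝒳) :
    hamiltonian E (PointMeasure.ofPoints p) = ∑ k, E (p k).2 := by
  have key : ∀ s : Finset (Fin n), ((∑ k ∈ s, (E (p k).2).toENNReal : ℝ≥0∞) : EReal) -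
      ((∑ k ∈ s, (-E (p k).2).toENNReal : ℝ≥0∞) : EReal) = ∑ k ∈ s, E (p k).2 := by
    classical
    intro s
    induction s using Finset.induction_on with
    | empty => simp
    | insert k s hk ih =>
      have h1 : (∑ k ∈ s, (E (p k).2).toENNReal) ≠ ⊤ := by
        simp [ENNReal.sum_eq_top, hE']
      have h2 : (E (p k).2).toENNReal ≠ ⊤ := by simp [hE']
      rw [Finset.sum_insert hk, Finset.sum_insert hk, Finset.sum_insert hk, ← ih]
      nth_rewrite 3 [← toENNReal_sub_toENNReal_neg (E (p k).2)]
      generalize (∑ k ∈ s, (E (p k).2).toENNReal) = A at *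
      generalize (E (p k).2).toENNReal = a at *
      generalize (∑ k ∈ s, (-E (p k).2).toENNReal) = B
      generalize (-E (p k).2).toENNReal = b
      lift A to NNReal using h1
      lift a to NNReal using h2
      induction b with
      | top => simp [sub_eq_add_neg]
      | coe b =>
        induction B with
        | top => simp [sub_eq_add_neg]
        | coe B =>
          simp only [← ENNReal.coe_add, EReal.coe_nnreal_eq_coe_real]
          norm_cast
          push_cast
          ring
  have h1 : Measurable fun q : Triangle × 𝒳 => (E q.2).toENNReal := by fun_prop
  have h2 : Measurable fun q : Triangle × 𝒳 => (-E q.2).toENNReal := by fun_prop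
  simp only [hamiltonian, PointMeasure.ofPoints, lintegral_sum_measure, lintegral_dirac' _ h1,
    lintegral_dirac' _ h2, tsum_fintype]
  exact key Finset.univ

end

end MarkedPartition

end

open MarkedPartition

/-! The Gibbs measure is again a conditioned alternating process, with tilted cycles, so the limit
reduces to renewal theory for that process. To be dormant at `2t` means that for some `n` the start
`S_n` of cycle `n` satisfies `S_n ≤ 2t < S_n + d`, where `d` is the dormant length of that cycle.
Integrating out `d` leaves the factor `exp(-α(2t - S_n))`, and what is seen in the window is exactly
the first `n` cycles. On these, `e^{-H}` equals the product of the weights `exp(-λT - E(χ))` times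
`exp(λ S_n)`. Together the exponentials give `exp(2λt) · exp(-(α+λ)(2t - S_n))`: the first factor is
constant, the second is the tail of `Exp(α+λ)`, and the weights turn `Exp(α) ⊗ Ξ` into `Exp(α+λ) ⊗
Ξ̂` (`cycleLaw_tiltedLaw`). Normalization yields `gibbsLaw_eq_referenceLaw`.

For the renewal part, the exponential hazard rate bounds the density of a cycle length by a multiple
of its survival function (`hasRenewalDensity_cycleLaw`). Since at most one cycle covers a given
time, the renewal density is bounded (`HasRenewalDensity.renewalDensity_le`). A bounded solution of
the renewal equation, with a density positive at all large times, is forced along a suitable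
sequence to be close to its upper limit at almost all earlier times, and likewise for its lower
limit. The identity that exactly one cycle covers each time then shows that both limits are the
inverse mean (`tendsto_of_renewal_equation`, `HasRenewalDensity.tendsto_renewalDensity`).

Writing the law of the future as an integral against the renewal density gives convergence in total
variation to the Palm law (`HasRenewalDensity.tendsto_tvDist`), which is stationary by mass
transport (`isStationary_palmLaw`). The conditioning at time `2t` disappears in the limit because
late dormancy is asymptotically independent of a bounded window, uniformly over window events
(`HasRenewalDensity.exists_mixing`); `HasRenewalDensity.tendstoLocallyTV` combines these facts. -/

open MeasureTheory ProbabilityTheory Filter Topology Set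
open scoped ENNReal NNReal

set_option linter.unusedSectionVars false

/-! ### I.i.d. sequences: concatenation and reindexing -/

section InfiniteProduct

variable {C : Type*}

/-- The sequence that follows `c` before time `n` and then `c'`. -/
def splice (n : ℕ) (c c' : ℕ → C) : ℕ → C := fun k => if k < n then c k else c' (k - n)

theorem splice_of_lt {n k : ℕ} (h : k < n) (c c' : ℕ → C) : splice n c c' k = c k := if_pos h

@[simp]
theorem splice_add (n k : ℕ) (c c' : ℕ → C) : splice n c c' (n + k) = c' k := by
  simp [splice]

variable [MeasurableSpace C]

@[fun_prop]
theorem measurable_splice (n : ℕ) :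
    Measurable fun q : (ℕ → C) × (ℕ → C) => splice n q.1 q.2 := by
  refine measurable_pi_lambda _ fun k => ?_
  unfold splice
  split_ifs <;> fun_prop

/-- The preimage of a box is a product of two boxes, so the masses multiply correctly. This takes
the place of conditioning on the first `n` cycles: the continuation may be drawn independently. -/
theorem map_splice_infinitePi (P : Measure C) [IsProbabilityMeasure P] (n : ℕ) :
    ((Measure.infinitePi fun _ : ℕ => P).prod (Measure.infinitePi fun _ : ℕ => P)).map
      (fun q => splice n q.1 q.2) = Measure.infinitePi fun _ : ℕ => P := by
  refine Measure.eq_infinitePi _ fun s t ht => ?_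
  classical
  rw [Measure.map_apply (measurable_splice n) (.pi s.countable_toSet fun _ _ => ht _)]
  have hpre : (fun q : (ℕ → C) × (ℕ → C) => splice n q.1 q.2) ⁻¹' (Set.pi s t) =
      (Set.pi (s.filter (· < n) : Finset ℕ) t) ×ˢ
      (Set.pi ((s.filter (¬ · < n)).image (· - n) : Finset ℕ) fun k => t (n + k)) := by
    ext ⟨c, c'⟩
    simp only [mem_preimage, Set.mem_pi, Finset.mem_coe, mem_prod, Finset.mem_filter,
      Finset.mem_image, splice]
    constructor
    · intro h
      refine ⟨fun k hk => by simpa [hk.2] using h k hk.1, ?_⟩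
      rintro _ ⟨k, ⟨hk, hkn⟩, rfl⟩
      have := h k hk
      rw [if_neg hkn] at this
      rwa [Nat.add_sub_cancel' (not_lt.1 hkn)]
    · rintro ⟨h1, h2⟩ k hk
      by_cases hkn : k < n
      · simpa [hkn] using h1 k ⟨hk, hkn⟩
      · rw [if_neg hkn]
        have := h2 (k - n) ⟨k, ⟨hk, hkn⟩, rfl⟩
        rwa [Nat.add_sub_cancel' (not_lt.1 hkn)] at this
  rw [hpre, Measure.prod_prod, Measure.infinitePi_pi _ fun i _ => ht i,
    Measure.infinitePi_pi _ fun i _ => ht _, Finset.prod_image, 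
    ← Finset.prod_filter_mul_prod_filter_not s (· < n)]
  · congr 1
    refine Finset.prod_congr rfl fun k hk => ?_
    rw [Nat.add_sub_cancel' (not_lt.1 (Finset.mem_filter.1 hk).2)]
  · intro a ha b hb hab
    simp only [Finset.coe_filter, Set.mem_ofPred_eq] at ha hb hab
    omega

theorem lintegral_infinitePi_splice (P : Measure C) [IsProbabilityMeasure P] (n : ℕ)
    {g : (ℕ → C) → ℝ≥0∞} (hg : Measurable g) :
    ∫⁻ c, g c ∂(Measure.infinitePi fun _ : ℕ => P) =
      ∫⁻ c, ∫⁻ c', g (splice n c c') ∂(Measure.infinitePi fun _ : ℕ => P)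
        ∂(Measure.infinitePi fun _ : ℕ => P) := by
  conv_lhs => rw [← map_splice_infinitePi P n]
  rw [lintegral_map hg (measurable_splice n), lintegral_prod]
  exact (hg.comp (measurable_splice n)).aemeasurable

theorem map_eval_infinitePi {ι : Type*} (P : Measure C) [IsProbabilityMeasure P] (i : ι) :
    (Measure.infinitePi fun _ : ι => P).map (fun c => c i) = P :=
  Measure.infinitePi_map_eval (fun _ : ι => P) i

theorem lintegral_infinitePi_eval {ι : Type*} (P : Measure C) [IsProbabilityMeasure P] (i : ι)
    {g : C → ℝ≥0∞} (hg : Measurable g) :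
    ∫⁻ c, g (c i) ∂(Measure.infinitePi fun _ : ι => P) = ∫⁻ x, g x ∂P := by
  conv_rhs => rw [← map_eval_infinitePi P i]
  rw [lintegral_map hg (by fun_prop)]

/-- One-step decomposition of an i.i.d. sequence. -/
theorem lintegral_infinitePi_cons (P : Measure C) [IsProbabilityMeasure P]
    {g : (ℕ → C) → ℝ≥0∞} (hg : Measurable g) :
    ∫⁻ c, g c ∂(Measure.infinitePi fun _ : ℕ => P) =
      ∫⁻ x, ∫⁻ c', g (splice 1 (fun _ => x) c') ∂(Measure.infinitePi fun _ : ℕ => P) ∂P := by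
  rw [lintegral_infinitePi_splice P 1 hg]
  have h : ∀ c c' : ℕ → C, splice 1 c c' = splice 1 (fun _ => c 0) c' := by
    intro c c'
    funext k
    unfold splice
    split_ifs with h
    · rw [Nat.lt_one_iff.1 h]
    · rfl
  have hm : Measurable fun x : C => ∫⁻ c', g (splice 1 (fun _ => x) c')
      ∂(Measure.infinitePi fun _ : ℕ => P) := by
    refine Measurable.lintegral_prod_right' (f := fun q : C × (ℕ → C) =>
      g (splice 1 (fun _ => q.1) q.2)) ?_
    exact hg.comp ((measurable_splice 1).comp (by fun_prop :
      Measurable fun q : C × (ℕ → C) => ((fun _ : ℕ => q.1), q.2)))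
  rw [← lintegral_infinitePi_eval P 0 hm]
  refine lintegral_congr fun c => lintegral_congr fun c' => ?_
  rw [h]

theorem measurable_reindex {ι κ : Type*} (e : κ → ι) :
    Measurable fun (c : ι → C) (k : κ) => c (e k) :=
  measurable_pi_lambda _ fun _ => measurable_pi_apply _

/-- Injectivity ensures that no coordinate is read twice. It is applied to the two halves of a
two-sided sequence and to the relabellings of `ℤ`. -/
theorem map_comp_infinitePi {ι κ : Type*} (P : Measure C) [IsProbabilityMeasure P]
    {e : κ → ι} (he : Function.Injective e) :
    (Measure.infinitePi fun _ : ι => P).map (fun c k => c (e k)) =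
      Measure.infinitePi fun _ : κ => P := by
  refine Measure.eq_infinitePi _ fun s t ht => ?_
  classical
  rw [Measure.map_apply (by fun_prop) (.pi s.countable_toSet fun _ _ => ht _)]
  -- The intersection has a single member for `i` in the image of `e`; it expresses `t (e⁻¹ i)`
  -- without choosing an inverse.
  have : (fun (c : ι → C) k => c (e k)) ⁻¹' (Set.pi s t) =
      Set.pi (s.image e : Finset ι) (fun i => ⋂ k ∈ {k ∈ s | e k = i}, t k) := by
    ext c
    simp only [mem_preimage, Set.mem_pi, Finset.mem_coe, Finset.mem_image, mem_iInter,
      Finset.mem_filter]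
    exact ⟨by rintro h _ ⟨k, hk, rfl⟩ k' ⟨hk', h'⟩; exact h' ▸ h k' hk',
      fun h k hk => h _ ⟨k, hk, rfl⟩ k ⟨hk, rfl⟩⟩
  rw [this, Measure.infinitePi_pi, Finset.prod_image he.injOn]
  · refine Finset.prod_congr rfl fun k hk => congrArg P ?_
    ext x
    simp only [mem_iInter, Finset.mem_filter]
    exact ⟨fun h => h k ⟨hk, rfl⟩, fun h k' hk' => by rwa [he hk'.2]⟩
  · intro i _
    exact Finset.measurableSet_biInter _ fun k _ => ht k

theorem ae_infinitePi {ι : Type*} [Countable ι] (P : Measure C) [IsProbabilityMeasure P]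
    {p : C → Prop} (hp : ∀ᵐ x ∂P, p x) :
    ∀ᵐ c ∂(Measure.infinitePi fun _ : ι => P), ∀ i, p (c i) := by
  rw [ae_all_iff]
  intro i
  exact (measurePreserving_eval_infinitePi (fun _ : ι => P) i).quasiMeasurePreserving.ae hp

end InfiniteProduct

/-! ### An analytic renewal theorem for bounded functions -/

section RenewalTheorem

/-- If `q` is asymptotically dominated by its convolution with the probability density `f`, then
along a sequence of times the values of `q` at almost all earlier times in the support of `f` tend
to the upper limit of `q`. -/
theorem exists_seq_ae_tendsto_limsup {q f : ℝ → ℝ} {K : ℝ} (hq : Measurable q)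
    (hK : ∀ x, |q x| ≤ K) (hf : Integrable f) (hf0 : ∀ t, 0 ≤ f t) (hf1 : ∫ t, f t = 1)
    (hlim : Tendsto (fun u => q u - ∫ t, q (u - t) * f t) atTop (𝓝 0)) :
    ∃ v : ℕ → ℝ, Tendsto v atTop atTop ∧
      ∀ᵐ t, f t ≠ 0 → Tendsto (fun k => q (v k - t)) atTop (𝓝 (limsup q atTop)) := by
  have hbdd : IsBoundedUnder (· ≤ ·) atTop q :=
    isBoundedUnder_of ⟨K, fun x => (abs_le.1 (hK x)).2⟩
  have hcobdd : IsCoboundedUnder (· ≤ ·) atTop q :=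
    IsBoundedUnder.isCoboundedUnder_le (isBoundedUnder_of ⟨-K, fun x => (abs_le.1 (hK x)).1⟩)
  obtain ⟨v, hqv, hv⟩ := exists_seq_tendsto_limsup hcobdd hbdd
  set M := limsup q atTop with hM
  have hvt : ∀ t : ℝ, Tendsto (fun k => v k - t) atTop atTop := fun t =>
    tendsto_atTop_add_const_right _ _ hv
  have hMK : ∀ x, |q x - M| ≤ K + |M| := fun x =>
    (abs_sub _ _).trans (by gcongr; exact hK x)
  have hmeas : ∀ k, AEStronglyMeasurable (fun t => q (v k - t)) (volume : Measure ℝ) := fun k =>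
    (hq.comp (measurable_const.sub measurable_id)).aestronglyMeasurable
  have hint : ∀ k, Integrable fun t => (q (v k - t) - M) * f t := fun k => by
    refine hf.bdd_mul ((hmeas k).sub aestronglyMeasurable_const) (c := K + |M|) ?_
    exact ae_of_all _ fun t => hMK _
  have hintq : ∀ k, Integrable fun t => q (v k - t) * f t := fun k =>
    hf.bdd_mul (hmeas k) (c := K) (ae_of_all _ fun t => hK _)
  have hintpos : ∀ k, Integrable fun t => max (q (v k - t) - M) 0 * f t := fun k => by
    refine hf.bdd_mul (((hmeas k).sub aestronglyMeasurable_const).sup aestronglyMeasurable_const)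
      (c := K + |M|) (ae_of_all _ fun t => ?_)
    refine le_trans ?_ (hMK (v k - t))
    rw [Real.norm_eq_abs, abs_of_nonneg (le_max_right _ _)]
    exact max_le (le_abs_self _) (abs_nonneg _)
  -- For fixed `t` the times `v k - t` tend to infinity, so `q` cannot exceed `M` there by a fixed
  -- amount in the limit; domination by a multiple of `f` does the rest.
  have hpos : Tendsto (fun k => ∫ t, max (q (v k - t) - M) 0 * f t) atTop (𝓝 0) := by
    have := tendsto_integral_of_dominated_convergence (μ := (volume : Measure ℝ))
      (F := fun k t => max (q (v k - t) - M) 0 * f t) (f := fun _ => (0 : ℝ))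
      (fun t => (K + |M|) * f t) (fun k => (hintpos k).aestronglyMeasurable) (hf.const_mul _)
      (fun k => ae_of_all _ fun t => ?_) (ae_of_all _ fun t => ?_)
    · simpa using this
    · rw [Real.norm_eq_abs, abs_mul, abs_of_nonneg (hf0 t), abs_of_nonneg (le_max_right _ _)]
      exact mul_le_mul_of_nonneg_right
        (max_le ((le_abs_self _).trans (hMK _)) ((abs_nonneg _).trans (hMK 0))) (hf0 t)
    · have : Tendsto (fun k => max (q (v k - t) - M) 0) atTop (𝓝 0) := by
        rw [Metric.tendsto_atTop']
        intro ε hε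
        obtain ⟨N, hN⟩ := eventually_atTop.1 ((hvt t).eventually
          (eventually_lt_of_limsup_lt (b := M + ε) (by linarith) hbdd))
        refine ⟨N, fun n hn => ?_⟩
        rw [dist_zero_right, Real.norm_eq_abs, abs_of_nonneg (le_max_right _ _)]
        exact max_lt (by linarith [hN n hn.le]) hε
      simpa using this.mul_const (f t)
  -- By `hlim` the convolution at `v k` is close to `q (v k)`, which tends to `M`.
  have hsub : Tendsto (fun k => ∫ t, (q (v k - t) - M) * f t) atTop (𝓝 0) := by
    have : ∀ k, ∫ t, (q (v k - t) - M) * f t =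
        q (v k) - (q (v k) - ∫ t, q (v k - t) * f t) - M := by
      intro k
      simp_rw [sub_mul]
      rw [integral_sub (hintq k) (hf.const_mul M), integral_const_mul, hf1]
      ring
    simp_rw [this]
    simpa using (hqv.sub (hlim.comp hv)).sub_const M
  -- Since `|x| = 2 max(x, 0) - x`, the previous two limits give convergence in `L¹`, hence almost
  -- everywhere along a subsequence.
  have habs : Tendsto (fun k => ∫ t, |(q (v k - t) - M) * f t|) atTop (𝓝 0) := by
    have : ∀ k, ∫ t, |(q (v k - t) - M) * f t| =
        2 * (∫ t, max (q (v k - t) - M) 0 * f t) - ∫ t, (q (v k - t) - M) * f t := by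
      intro k
      rw [← integral_const_mul, ← integral_sub ((hintpos k).const_mul 2) (hint k)]
      refine integral_congr_ae (ae_of_all _ fun t => ?_)
      simp only [abs_mul, abs_of_nonneg (hf0 t)]
      rcases le_total (q (v k - t) - M) 0 with h | h
      · rw [abs_of_nonpos h, max_eq_right h]; ring
      · rw [abs_of_nonneg h, max_eq_left h]; ring
    simp_rw [this]
    simpa using (hpos.const_mul 2).sub hsub
  have hmeasure : TendstoInMeasure volume (fun k t => (q (v k - t) - M) * f t) atTop
      fun _ => (0 : ℝ) := by
    refine tendstoInMeasure_of_tendsto_eLpNorm one_ne_zero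
      (fun k => (hint k).aestronglyMeasurable) aestronglyMeasurable_const ?_
    have : ∀ k, eLpNorm ((fun t => (q (v k - t) - M) * f t) - fun _ => (0 : ℝ)) 1 volume =
        ENNReal.ofReal (∫ t, |(q (v k - t) - M) * f t|) := by
      intro k
      rw [eLpNorm_one_eq_lintegral_enorm]
      have h := ofReal_integral_norm_eq_lintegral_enorm (hint k)
      simp only [Real.norm_eq_abs] at h
      rw [h]
      simp
    simp_rw [this]
    simpa using ENNReal.tendsto_ofReal habs
  obtain ⟨ns, hns, hae⟩ := hmeasure.exists_seq_tendsto_ae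
  refine ⟨fun k => v (ns k), hv.comp hns.tendsto_atTop, hae.mono fun t ht hft => ?_⟩
  have := (ht.mul_const (f t)⁻¹).add_const M
  simpa [mul_assoc, hft] using this

/-- As `f` does not vanish beyond `a₀`, moving the sequence `v` back by `a₀ + 1` gives times `u_k`
with `q (u_k - t)` tending to the upper limit for almost every `t ≥ 0`. That covers the support of
`G`, and dominated convergence evaluates the limit of the convolution with `G`. -/
theorem limsup_mul_integral_eq {q f G : ℝ → ℝ} {K L a₀ : ℝ} (hq : Measurable q)
    (hK : ∀ x, |q x| ≤ K) (hf : Integrable f) (hf0 : ∀ t, 0 ≤ f t) (hf1 : ∫ t, f t = 1)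
    (hfpos : ∀ t, a₀ < t → f t ≠ 0) (hG : Integrable G) (hG0 : ∀ t, t < 0 → G t = 0)
    (hlim : Tendsto (fun u => q u - ∫ t, q (u - t) * f t) atTop (𝓝 0))
    (hqG : Tendsto (fun u => ∫ t, q (u - t) * G t) atTop (𝓝 L)) :
    limsup q atTop * ∫ t, G t = L := by
  obtain ⟨v, hv, hae⟩ := exists_seq_ae_tendsto_limsup hq hK hf hf0 hf1 hlim
  set M := limsup q atTop
  have hae' : ∀ᵐ t, 0 ≤ t → Tendsto (fun k => q (v k - (a₀ + 1) - t)) atTop (𝓝 M) := by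
    have := (measurePreserving_add_left (volume : Measure ℝ) (a₀ + 1)).quasiMeasurePreserving.ae hae
    filter_upwards [this] with t ht h0
    simpa [sub_sub] using ht (hfpos _ (by linarith))
  have hu : Tendsto (fun k => v k - (a₀ + 1)) atTop atTop := tendsto_atTop_add_const_right _ _ hv
  refine tendsto_nhds_unique ?_ (hqG.comp hu)
  rw [← integral_const_mul]
  refine tendsto_integral_of_dominated_convergence (fun t => K * |G t|) (fun k => ?_)
    (hG.abs.const_mul K) (fun k => ae_of_all _ fun t => ?_) ?_
  · exact ((hq.comp (measurable_const.sub measurable_id)).aestronglyMeasurable).mul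
      hG.aestronglyMeasurable
  · rw [Real.norm_eq_abs, abs_mul]
    exact mul_le_mul_of_nonneg_right (hK _) (abs_nonneg _)
  · filter_upwards [hae'] with t ht
    rcases lt_or_ge t 0 with h | h
    · simp [hG0 t h]
    · exact (ht h).mul_const _

/-- The key renewal theorem for bounded asymptotic solutions of the renewal equation with a
density which is eventually positive. -/
theorem tendsto_of_renewal_equation {m f G : ℝ → ℝ} {K L a₀ : ℝ} (hm : Measurable m)
    (hK : ∀ x, |m x| ≤ K) (hf : Integrable f) (hf0 : ∀ t, 0 ≤ f t) (hf1 : ∫ t, f t = 1)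
    (hfpos : ∀ t, a₀ < t → f t ≠ 0) (hG : Integrable G) (hG0 : ∀ t, t < 0 → G t = 0)
    (hGpos : 0 < ∫ t, G t)
    (hlim : Tendsto (fun u => m u - ∫ t, m (u - t) * f t) atTop (𝓝 0))
    (hmG : Tendsto (fun u => ∫ t, m (u - t) * G t) atTop (𝓝 L)) :
    Tendsto m atTop (𝓝 (L / ∫ t, G t)) := by
  have h1 := limsup_mul_integral_eq hm hK hf hf0 hf1 hfpos hG hG0 hlim hmG
  -- All hypotheses are invariant under a change of sign, so the lower limit is identified in the
  -- same way.
  have h2 := limsup_mul_integral_eq (q := fun x => -m x) (L := -L) hm.neg (by simpa using hK) hf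
    hf0 hf1 hfpos hG hG0
    (by
      have := hlim.neg
      simp only [neg_zero] at this
      refine this.congr fun u => ?_
      simp only [neg_mul, integral_neg]
      ring)
    (by simpa only [neg_mul, integral_neg] using hmG.neg)
  have hle : ∀ x, m x ≤ K := fun x => (abs_le.1 (hK x)).2
  have hge : ∀ x, -K ≤ m x := fun x => (abs_le.1 (hK x)).1
  have hb1 : IsBoundedUnder (· ≤ ·) atTop m := isBoundedUnder_of ⟨K, hle⟩
  have hb2 : IsBoundedUnder (· ≤ ·) atTop fun x => -m x :=
    isBoundedUnder_of ⟨K, fun x => by linarith [hge x]⟩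
  have e1 : limsup m atTop = L / ∫ t, G t := by rw [eq_div_iff hGpos.ne', h1]
  have e2 : limsup (fun x => -m x) atTop = -(L / ∫ t, G t) := by
    rw [← neg_div, eq_div_iff hGpos.ne', h2]
  rw [tendsto_order]
  refine ⟨fun a ha => ?_, fun a ha => eventually_lt_of_limsup_lt (by rwa [e1]) hb1⟩
  filter_upwards [eventually_lt_of_limsup_lt (b := -a) (by rw [e2]; linarith) hb2] with x hx
  linarith

end RenewalTheorem

namespace MarkedPartition

/-! ### Point measures given by their points -/

section PointMeasures

variable {X : Type*} [MeasurableSpace X]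

theorem measurable_ofPoints {Ω : Type*} [MeasurableSpace Ω] {ι : Type} [Countable ι]
    {p : Ω → ι → X} (hp : ∀ i, Measurable fun ω => p ω i) :
    Measurable fun ω => PointMeasure.ofPoints (p ω) := by
  refine Measurable.subtype_mk (Measure.measurable_of_measurable_coe _ fun B hB => ?_)
  simp_rw [Measure.sum_apply _ hB]
  exact Measurable.tsum fun i =>
    (Measure.measurable_coe hB).comp (Measure.measurable_dirac.comp (hp i))

theorem measurable_pointMeasure_apply {B : Set X} (hB : MeasurableSet B) :
    Measurable fun ζ : PointMeasure X => ζ.1 B :=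
  (Measure.measurable_coe hB).comp measurable_subtype_coe

theorem ofPoints_apply {ι : Type} [Countable ι] (p : ι → X) {B : Set X} (hB : MeasurableSet B) :
    (PointMeasure.ofPoints p).1 B = ∑' i, B.indicator 1 (p i) := by
  simp [PointMeasure.ofPoints, Measure.sum_apply _ hB, Measure.dirac_apply' _ hB]

theorem ofPoints_apply_eq_zero {ι : Type} [Countable ι] (p : ι → X) {B : Set X}
    (hB : MeasurableSet B) : (PointMeasure.ofPoints p).1 B = 0 ↔ ∀ i, p i ∉ B := by
  simp [ofPoints_apply p hB]

theorem ofPoints_comp_equiv {ι κ : Type} [Countable ι] [Countable κ] (e : κ ≃ ι) (p : ι → X) :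
    PointMeasure.ofPoints (fun k => p (e k)) = PointMeasure.ofPoints p :=
  Subtype.ext (Measure.sum_comp_equiv e fun i => Measure.dirac (p i))

end PointMeasures

/-! ### Translation, restriction and dormancy -/

section Intervals

variable {𝒳 : Type*} [MeasurableSpace 𝒳]

theorem shift_ofPoints {ι : Type} [Countable ι] (u : ℝ) (p : ι → Triangle × 𝒳) :
    shift u (PointMeasure.ofPoints p) = PointMeasure.ofPoints fun i => shiftPoint u (p i) := by
  refine Subtype.ext ?_
  simp only [shift, PointMeasure.ofPoints]
  rw [Measure.map_sum (measurable_shiftPoint u).aemeasurable]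
  simp_rw [Measure.map_dirac' (measurable_shiftPoint u)]

theorem shiftPoint_shiftPoint (u v : ℝ) (q : Triangle × 𝒳) :
    shiftPoint u (shiftPoint v q) = shiftPoint (v + u) q := by
  simp [shiftPoint, sub_sub]

theorem shift_shift (u v : ℝ) (ζ : PointMeasure (Triangle × 𝒳)) :
    shift u (shift v ζ) = shift (v + u) ζ := by
  refine Subtype.ext ?_
  simp only [shift]
  rw [Measure.map_map (measurable_shiftPoint u) (measurable_shiftPoint v)]
  congr 1
  funext q
  exact shiftPoint_shiftPoint u v q

theorem measurable_shift (u : ℝ) :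
    Measurable (shift u : PointMeasure (Triangle × 𝒳) → PointMeasure (Triangle × 𝒳)) :=
  Measurable.subtype_mk ((Measure.measurable_map _ (measurable_shiftPoint u)).comp
    measurable_subtype_coe)

theorem shift_apply (u : ℝ) (ζ : PointMeasure (Triangle × 𝒳)) {B : Set (Triangle × 𝒳)}
    (hB : MeasurableSet B) : (shift u ζ).1 B = ζ.1 (shiftPoint u ⁻¹' B) :=
  Measure.map_apply (measurable_shiftPoint u) hB

theorem hitting_Icc {a b : ℝ} (h : a ≤ b) :
    hitting 𝒳 (Icc a b) = {q | q.1.1.1 ≤ b ∧ a ≤ q.1.1.2} := by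
  ext ⟨⟨⟨s, t⟩, hst⟩, x⟩
  simp only at hst
  constructor
  · rintro ⟨r, ⟨h1, h2⟩, h3, h4⟩
    exact ⟨h1.trans h4, h3.trans h2⟩
  · rintro ⟨h1, h2⟩
    exact ⟨max s a, ⟨le_max_left _ _, max_le hst.le h2⟩, le_max_right _ _, max_le h1 h⟩

theorem hitting_Ici (a : ℝ) : hitting 𝒳 (Ici a) = {q | a ≤ q.1.1.2} := by
  ext ⟨⟨⟨s, t⟩, hst⟩, x⟩
  constructor
  · rintro ⟨r, ⟨h1, h2⟩, h3⟩
    exact h3.trans h2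
  · intro h
    exact ⟨t, ⟨hst.le, le_rfl⟩, h⟩

theorem measurable_leftEnd : Measurable fun q : Triangle × 𝒳 => q.1.1.1 := by fun_prop

theorem measurable_rightEnd : Measurable fun q : Triangle × 𝒳 => q.1.1.2 := by fun_prop

theorem measurableSet_hitting_Icc {a b : ℝ} (h : a ≤ b) :
    MeasurableSet (hitting 𝒳 (Icc a b)) := by
  rw [hitting_Icc h]
  exact (measurableSet_le measurable_leftEnd measurable_const).inter
    (measurableSet_le measurable_const measurable_rightEnd)

theorem measurableSet_hitting_Ici (a : ℝ) : MeasurableSet (hitting 𝒳 (Ici a)) := by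
  rw [hitting_Ici]
  exact measurableSet_le measurable_const measurable_rightEnd

theorem measurableSet_covering (u : ℝ) :
    MeasurableSet {q : Triangle × 𝒳 | q.1.1.1 ≤ u ∧ u < q.1.1.2} :=
  (measurableSet_le measurable_leftEnd measurable_const).inter
    (measurableSet_lt measurable_const measurable_rightEnd)

theorem measurableSet_dormantAt (u : ℝ) : MeasurableSet (dormantAt 𝒳 u) :=
  measurable_pointMeasure_apply (measurableSet_covering u) (measurableSet_singleton 0)

theorem mem_dormantAt_ofPoints {ι : Type} [Countable ι] (p : ι → Triangle × 𝒳) (u : ℝ) :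
    PointMeasure.ofPoints p ∈ dormantAt 𝒳 u ↔ ∀ i, ¬ ((p i).1.1.1 ≤ u ∧ u < (p i).1.1.2) :=
  ofPoints_apply_eq_zero p (measurableSet_covering u)

theorem shift_mem_dormantAt (u v : ℝ) (ζ : PointMeasure (Triangle × 𝒳)) :
    shift v ζ ∈ dormantAt 𝒳 u ↔ ζ ∈ dormantAt 𝒳 (u + v) := by
  change (shift v ζ).1 _ = 0 ↔ ζ.1 _ = 0
  rw [shift_apply v ζ (measurableSet_covering u)]
  simp only [shiftPoint, preimage_ofPred_eq, sub_le_iff_le_add, lt_sub_iff_add_lt]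

variable [MeasurableSingletonClass 𝒳]

theorem measurable_restrictTo {I : Set ℝ} (hI : MeasurableSet (hitting 𝒳 I)) :
    Measurable (restrictTo I : PointMeasure (Triangle × 𝒳) → PointMeasure (Triangle × 𝒳)) :=
  Measurable.subtype_mk <| Measure.measurable_of_measurable_coe _ fun B hB => by
    simp_rw [Measure.restrict_apply hB]
    exact measurable_pointMeasure_apply (hB.inter hI)

theorem hitting_mono {I J : Set ℝ} (h : I ⊆ J) : hitting 𝒳 I ⊆ hitting 𝒳 J :=
  fun _ hq => hq.mono (inter_subset_inter_right _ h)

theorem restrictTo_restrictTo {I J : Set ℝ} (hI : MeasurableSet (hitting 𝒳 I)) (h : I ⊆ J)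
    (ζ : PointMeasure (Triangle × 𝒳)) : restrictTo I (restrictTo J ζ) = restrictTo I ζ := by
  refine Subtype.ext ?_
  simp only [restrictTo]
  rw [Measure.restrict_restrict hI, inter_eq_left.2 (hitting_mono h)]

theorem restrictTo_Icc_shift {a b : ℝ} (h : a ≤ b) (u : ℝ) (ζ : PointMeasure (Triangle × 𝒳)) :
    restrictTo (Icc a b) (shift u ζ) = shift u (restrictTo (Icc (a + u) (b + u)) ζ) := by
  refine Subtype.ext ?_
  simp only [restrictTo, shift]
  rw [Measure.restrict_map (measurable_shiftPoint u) (measurableSet_hitting_Icc h)]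
  congr 2
  rw [hitting_Icc h, hitting_Icc (by linarith)]
  simp only [shiftPoint, preimage_ofPred_eq, sub_le_iff_le_add, le_sub_iff_add_le]

/-- An interval that covers a time `u ∈ I` meets `I`, so the restriction removes no interval that
matters. -/
theorem restrictTo_mem_dormantAt {I : Set ℝ} {u : ℝ} (hu : u ∈ I)
    (ζ : PointMeasure (Triangle × 𝒳)) :
    restrictTo I ζ ∈ dormantAt 𝒳 u ↔ ζ ∈ dormantAt 𝒳 u := by
  change (restrictTo I ζ).1 _ = 0 ↔ ζ.1 _ = 0
  simp only [restrictTo]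
  rw [Measure.restrict_apply (measurableSet_covering u), inter_eq_left.2]
  exact fun q hq => ⟨u, ⟨hq.1, hq.2.le⟩, hu⟩

/-- The tool for discarding past or future cycles, which form the part `ρ`. -/
theorem restrictTo_eq_of_add {I : Set ℝ} {ζ ξ ρ : PointMeasure (Triangle × 𝒳)}
    (h : ζ.1 = ξ.1 + ρ.1) (hρ : ρ.1 (hitting 𝒳 I) = 0) :
    restrictTo I ζ = restrictTo I ξ := by
  refine Subtype.ext ?_
  simp only [restrictTo]
  rw [h, Measure.restrict_add, Measure.restrict_eq_zero.2 hρ, add_zero]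

end Intervals

/-! ### The one-sided process, path by path -/

section Paths

variable {𝒳 : Type*} [MeasurableSpace 𝒳]

/-- The starting time of the `n`-th cycle. -/
noncomputable def cycleStart (c : ℕ → RenewalCycle 𝒳) (n : ℕ) : ℝ :=
  ∑ k ∈ Finset.range n, (c k).duration

/-- The point process of the first `n` cycles. -/
noncomputable def firstCycles (n : ℕ) (c : ℕ → RenewalCycle 𝒳) : PointMeasure (Triangle × 𝒳) :=
  PointMeasure.ofPoints fun k : Fin n => (c k).interval (cycleStart c k)

@[fun_prop]
theorem measurable_duration : Measurable (RenewalCycle.duration : RenewalCycle 𝒳 → ℝ) := by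
  unfold RenewalCycle.duration
  fun_prop

@[fun_prop]
theorem measurable_cycleStart (n : ℕ) :
    Measurable fun c : ℕ → RenewalCycle 𝒳 => cycleStart c n := by
  unfold cycleStart
  exact Finset.measurable_sum _ fun k _ => measurable_duration.comp (measurable_pi_apply k)

theorem measurable_interval {Ω : Type*} [MeasurableSpace Ω] {s : Ω → ℝ} {c : Ω → RenewalCycle 𝒳}
    (hs : Measurable s) (hc : Measurable c) : Measurable fun ω => (c ω).interval (s ω) := by
  unfold RenewalCycle.interval
  fun_prop

@[simp]
theorem cycleStart_zero (c : ℕ → RenewalCycle 𝒳) : cycleStart c 0 = 0 := by simp [cycleStart]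

theorem cycleStart_succ (c : ℕ → RenewalCycle 𝒳) (n : ℕ) :
    cycleStart c (n + 1) = cycleStart c n + (c n).duration := Finset.sum_range_succ _ _

theorem cycleStart_add (c : ℕ → RenewalCycle 𝒳) (n k : ℕ) :
    cycleStart c (n + k) = cycleStart c n + cycleStart (fun i => c (n + i)) k :=
  Finset.sum_range_add _ _ _

theorem cycleStart_congr {c c' : ℕ → RenewalCycle 𝒳} {n : ℕ} (h : ∀ k < n, c k = c' k) :
    cycleStart c n = cycleStart c' n :=
  Finset.sum_congr rfl fun k hk => by rw [h k (Finset.mem_range.1 hk)]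

theorem firstCycles_congr {c c' : ℕ → RenewalCycle 𝒳} {n : ℕ} (h : ∀ k < n, c k = c' k) :
    firstCycles n c = firstCycles n c' := by
  unfold firstCycles
  congr 1
  funext k
  rw [h k k.2, cycleStart_congr fun i hi => h i (hi.trans k.2)]

theorem cycleStart_splice (n : ℕ) (c c' : ℕ → RenewalCycle 𝒳) :
    cycleStart (splice n c c') n = cycleStart c n :=
  cycleStart_congr fun _ hk => splice_of_lt hk c c'

theorem alternating_eq_ofPoints (c : ℕ → RenewalCycle 𝒳) :
    alternating c = PointMeasure.ofPoints fun n => (c n).interval (cycleStart c n) := rfl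

theorem shiftPoint_interval (u s : ℝ) (c : RenewalCycle 𝒳) :
    shiftPoint u (c.interval s) = c.interval (s - u) := by
  simp only [shiftPoint, RenewalCycle.interval]
  congr 3 <;> ring

theorem measurable_shift_alternating :
    Measurable fun q : (ℕ → RenewalCycle 𝒳) × ℝ => shift q.2 (alternating q.1) := by
  simp_rw [alternating_eq_ofPoints, shift_ofPoints, shiftPoint_interval]
  exact measurable_ofPoints fun n => measurable_interval
    (((measurable_cycleStart n).comp measurable_fst).sub measurable_snd)
    ((measurable_pi_apply n).comp measurable_fst)

theorem measurable_alternating :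
    Measurable (alternating : (ℕ → RenewalCycle 𝒳) → PointMeasure (Triangle × 𝒳)) :=
  measurable_ofPoints fun n => measurable_interval (measurable_cycleStart n) (measurable_pi_apply n)

theorem measurable_shift_firstCycles (n : ℕ) :
    Measurable fun q : (ℕ → RenewalCycle 𝒳) × ℝ => shift q.2 (firstCycles n q.1) := by
  simp_rw [firstCycles, shift_ofPoints, shiftPoint_interval]
  exact measurable_ofPoints fun k => measurable_interval
    (((measurable_cycleStart k).comp measurable_fst).sub measurable_snd)
    ((measurable_pi_apply (k : ℕ)).comp measurable_fst)

theorem tsum_eq_tsum_fin_add (n : ℕ) (F : ℕ → ℝ≥0∞) :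
    ∑' k, F k = ∑' k : Fin n, F k + ∑' k, F (k + n) := by
  rw [tsum_fintype fun k : Fin n => F k, ← Finset.sum_range F,
    Summable.sum_add_tsum_nat_add' ENNReal.summable]

/-- Regeneration at the level of paths. The minus sign appears because `shift u` moves points by
`-u`. -/
theorem alternating_eq_add (n : ℕ) (c : ℕ → RenewalCycle 𝒳) :
    (alternating c).1 = (firstCycles n c).1 +
      (shift (-cycleStart c n) (alternating fun k => c (n + k))).1 := by
  have htail : shift (-cycleStart c n) (alternating fun k => c (n + k)) =
      PointMeasure.ofPoints fun k => (c (k + n)).interval (cycleStart c (k + n)) := by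
    rw [alternating_eq_ofPoints, shift_ofPoints]
    refine congrArg PointMeasure.ofPoints (funext fun k => ?_)
    rw [shiftPoint_interval, sub_neg_eq_add, add_comm (cycleStart _ _), ← cycleStart_add,
      add_comm n]
  rw [htail]
  refine Measure.ext fun B hB => ?_
  rw [Measure.add_apply, alternating_eq_ofPoints, firstCycles, ofPoints_apply _ hB,
    ofPoints_apply _ hB, ofPoints_apply _ hB]
  exact tsum_eq_tsum_fin_add n fun k => B.indicator 1 ((c k).interval (cycleStart c k))

theorem cycleStart_mono {c : ℕ → RenewalCycle 𝒳} (hc : ∀ k, 0 < (c k).1) :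
    StrictMono (cycleStart c) :=
  strictMono_nat_of_lt_succ fun n => by
    rw [cycleStart_succ]
    exact lt_add_of_pos_right _ (add_pos (hc n) (c n).2.1.2)

theorem interval_snd (s : ℝ) (c : RenewalCycle 𝒳) : (c.interval s).1.1.2 = s + c.duration := by
  simp [RenewalCycle.interval, RenewalCycle.duration, add_assoc]

theorem interval_fst (s : ℝ) (c : RenewalCycle 𝒳) : (c.interval s).1.1.1 = s + c.1 := rfl

theorem alternating_mem_dormantAt (c : ℕ → RenewalCycle 𝒳) (u : ℝ) :
    alternating c ∈ dormantAt 𝒳 u ↔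
      ∀ k, ¬ (cycleStart c k + (c k).1 ≤ u ∧ u < cycleStart c (k + 1)) := by
  rw [alternating_eq_ofPoints, mem_dormantAt_ofPoints]
  simp_rw [interval_snd, interval_fst, cycleStart_succ]

/-- Only the cycle that covers `u` can be active at `u`, since the starting times are strictly
increasing. -/
theorem alternating_mem_dormantAt_iff {c : ℕ → RenewalCycle 𝒳} (hc : ∀ k, 0 < (c k).1) {u : ℝ}
    {n : ℕ} (h1 : cycleStart c n ≤ u) (h2 : u < cycleStart c (n + 1)) :
    alternating c ∈ dormantAt 𝒳 u ↔ u < cycleStart c n + (c n).1 := by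
  rw [alternating_mem_dormantAt]
  refine ⟨fun h => not_le.1 fun h' => h n ⟨h', h2⟩, fun h k hk => ?_⟩
  have hk1 : cycleStart c k ≤ u := by linarith [hc k, hk.1]
  have e1 : k < n + 1 := (cycleStart_mono hc).lt_iff_lt.1 (hk1.trans_lt h2)
  have e2 : n < k + 1 := (cycleStart_mono hc).lt_iff_lt.1 (h1.trans_lt hk.2)
  obtain rfl : k = n := by omega
  exact absurd hk.1 (not_le.2 h)

theorem alternating_mem_dormantAt_tail {c : ℕ → RenewalCycle 𝒳} (hc : ∀ k, 0 < (c k).1) {u : ℝ}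
    {n : ℕ} (h : cycleStart c n ≤ u) :
    alternating c ∈ dormantAt 𝒳 u ↔
      (alternating fun k => c (n + k)) ∈ dormantAt 𝒳 (u - cycleStart c n) := by
  rw [alternating_mem_dormantAt, alternating_mem_dormantAt]
  have key : ∀ k, cycleStart c (n + k) = cycleStart c n + cycleStart (fun i => c (n + i)) k :=
    cycleStart_add c n
  constructor
  · intro h' k hk
    refine h' (n + k) ⟨?_, ?_⟩
    · rw [key]; linarith [hk.1]
    · rw [add_assoc, key]; linarith [hk.2]
  · intro h' k hk
    have e2 : n < k + 1 := (cycleStart_mono hc).lt_iff_lt.1 (h.trans_lt hk.2)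
    obtain ⟨k, rfl⟩ := Nat.exists_eq_add_of_le (Nat.lt_succ_iff.1 e2)
    have h1 := hk.1
    have h2 := hk.2
    rw [key] at h1
    rw [add_assoc, key] at h2
    exact h' k ⟨by linarith, by linarith⟩

variable [MeasurableSingletonClass 𝒳]

/-- The cycles before the `n`-th have ended by `cycleStart c n`. The inequality is strict because
`hitting` uses closed intervals: an active period ending exactly at `v` would still touch `[0, ∞)`
after the translation. -/
theorem restrictTo_Ici_shift_alternating {c : ℕ → RenewalCycle 𝒳} (hc : ∀ k, 0 < (c k).1) {v : ℝ}
    {n : ℕ} (h : cycleStart c n < v) :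
    restrictTo (Ici 0) (shift v (alternating c)) =
      restrictTo (Ici 0) (shift (v - cycleStart c n) (alternating fun k => c (n + k))) := by
  refine restrictTo_eq_of_add (ρ := shift v (firstCycles n c)) ?_ ?_
  · have := congrArg (Measure.map (shiftPoint v)) (alternating_eq_add n c)
    rw [Measure.map_add _ _ (measurable_shiftPoint v), add_comm] at this
    have e := congrArg Subtype.val
      (shift_shift v (-cycleStart c n) (alternating fun k => c (n + k)))
    rw [neg_add_eq_sub] at e
    rw [← e]
    exact this
  · rw [firstCycles, shift_ofPoints, ofPoints_apply_eq_zero _ (measurableSet_hitting_Ici 0),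
      hitting_Ici]
    intro k hk
    rw [shiftPoint_interval, Set.mem_ofPred_eq, interval_snd] at hk
    have := (cycleStart_mono hc).monotone (Nat.succ_le_of_lt k.2)
    rw [Nat.succ_eq_add_one, cycleStart_succ] at this
    linarith

/-- All active periods from the `n`-th on begin after the window; the dormant period of cycle `n` is
allowed to overlap it. -/
theorem restrictTo_Icc_shift_alternating {c : ℕ → RenewalCycle 𝒳} (hc : ∀ k, 0 < (c k).1)
    {v a b : ℝ} (hab : a ≤ b) {n : ℕ} (h : v + b < cycleStart c n + (c n).1) :
    restrictTo (Icc a b) (shift v (alternating c)) =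
      restrictTo (Icc a b) (shift v (firstCycles n c)) := by
  refine restrictTo_eq_of_add
    (ρ := shift v (shift (-cycleStart c n) (alternating fun k => c (n + k)))) ?_ ?_
  · have := congrArg (Measure.map (shiftPoint v)) (alternating_eq_add n c)
    rw [Measure.map_add _ _ (measurable_shiftPoint v)] at this
    exact this
  · rw [shift_shift, alternating_eq_ofPoints, shift_ofPoints,
      ofPoints_apply_eq_zero _ (measurableSet_hitting_Icc hab), hitting_Icc hab]
    intro k hk
    rw [shiftPoint_interval] at hk
    have hk1 := hk.1
    rw [interval_fst] at hk1
    have e := cycleStart_add c n k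
    have : cycleStart c n + (c n).1 ≤ cycleStart c (n + k) + (c (n + k)).1 := by
      rcases Nat.eq_zero_or_pos k with rfl | hk0
      · simp
      · have e3 := (cycleStart_mono hc).monotone (show n + 1 ≤ n + k by omega)
        rw [cycleStart_succ, RenewalCycle.duration] at e3
        have e4 : (0 : ℝ) < (c n).2.1 := (c n).2.1.2
        have := hc (n + k)
        linarith
    linarith

end Paths

/-! ### The two-sided process, path by path -/

section TwoSided

variable {𝒳 : Type*} [MeasurableSpace 𝒳]

theorem startTime_natCast (c : ℤ → RenewalCycle 𝒳) (n : ℕ) :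
    startTime c n = cycleStart (fun k : ℕ => c k) n := rfl

theorem startTime_add_one (c : ℤ → RenewalCycle 𝒳) (k : ℤ) :
    startTime c (k + 1) = startTime c k + (c k).duration := by
  match k with
  | Int.ofNat n => exact cycleStart_succ (fun k : ℕ => c k) n
  | Int.negSucc 0 => simp [startTime]
  | Int.negSucc (n + 1) =>
    rw [show Int.negSucc (n + 1) + 1 = Int.negSucc n by omega]
    simp only [startTime]
    rw [Finset.sum_range_succ _ (n + 1)]
    ring

theorem startTime_shift (c : ℤ → RenewalCycle 𝒳) (n k : ℤ) :
    startTime (fun i => c (n + i)) k = startTime c (n + k) - startTime c n := by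
  induction k using Int.induction_on with
  | zero => simp [startTime]
  | succ k ih =>
    rw [startTime_add_one, ih, ← add_assoc, startTime_add_one]
    ring
  | pred k ih =>
    have h1 := startTime_add_one (fun i => c (n + i)) (-k - 1)
    have h2 := startTime_add_one c (n + (-k - 1))
    rw [sub_add_cancel, ih] at h1
    rw [show n + (-(k : ℤ) - 1) + 1 = n + -k by ring] at h2
    linarith

/-- Relabelling the cycles puts the origin at the start of the new zeroth cycle. Together with the
invariance of the i.i.d. law under relabelling, this is what makes Palm inversion stationary. -/
theorem twoSided_shift (c : ℤ → RenewalCycle 𝒳) (n : ℤ) :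
    twoSided (fun i => c (n + i)) = shift (startTime c n) (twoSided c) := by
  have h : shift (startTime c n) (twoSided c) = PointMeasure.ofPoints fun k : ℤ =>
      (c (n + k)).interval (startTime c (n + k) - startTime c n) := by
    rw [twoSided, shift_ofPoints]
    simp_rw [shiftPoint_interval]
    exact (ofPoints_comp_equiv (Equiv.addLeft n) fun k : ℤ =>
      (c k).interval (startTime c k - startTime c n)).symm
  rw [h]
  refine congrArg PointMeasure.ofPoints (funext fun k => ?_)
  rw [startTime_shift]

@[fun_prop]
theorem measurable_startTime (n : ℤ) : Measurable fun c : ℤ → RenewalCycle 𝒳 => startTime c n := by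
  rcases n with n | n <;> simp only [startTime] <;>
    fun_prop (disch := exact fun k => measurable_duration.comp (measurable_pi_apply _))

theorem measurable_shift_twoSided :
    Measurable fun q : (ℤ → RenewalCycle 𝒳) × ℝ => shift q.2 (twoSided q.1) := by
  unfold twoSided
  simp_rw [shift_ofPoints, shiftPoint_interval]
  exact measurable_ofPoints fun n => measurable_interval
    (((measurable_startTime n).comp measurable_fst).sub measurable_snd)
    ((measurable_pi_apply n).comp measurable_fst)

theorem startTime_strictMono {c : ℤ → RenewalCycle 𝒳} (hc : ∀ k, 0 < (c k).1) :
    StrictMono (startTime c) :=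
  strictMono_int_of_lt_succ fun n => by
    rw [startTime_add_one]
    exact lt_add_of_pos_right _ (add_pos (hc n) (c n).2.1.2)

variable [MeasurableSingletonClass 𝒳]

/-- The cycles of negative index have ended by time `0`. At `v = 0` the last of them would still
touch `[0, ∞)`. -/
theorem restrictTo_Ici_shift_twoSided {c : ℤ → RenewalCycle 𝒳} (hc : ∀ k, 0 < (c k).1) {v : ℝ}
    (hv : 0 < v) :
    restrictTo (Ici 0) (shift v (twoSided c)) =
      restrictTo (Ici 0) (shift v (alternating fun k : ℕ => c k)) := by
  let past : PointMeasure (Triangle × 𝒳) :=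
    PointMeasure.ofPoints fun k : ℕ => (c (-(k + 1 : ℤ))).interval (startTime c (-(k + 1 : ℤ)))
  have hadd : (twoSided c).1 = (alternating fun k : ℕ => c k).1 + past.1 := by
    ext B hB
    rw [twoSided, alternating_eq_ofPoints, Measure.add_apply, ofPoints_apply _ hB,
      ofPoints_apply _ hB, ofPoints_apply _ hB]
    exact (HasSum.of_nat_of_neg_add_one
      (f := fun k : ℤ => B.indicator (1 : Triangle × 𝒳 → ℝ≥0∞) ((c k).interval (startTime c k)))
      ENNReal.summable.hasSum ENNReal.summable.hasSum).tsum_eq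
  refine restrictTo_eq_of_add (ρ := shift v past) ?_ ?_
  · have := congrArg (Measure.map (shiftPoint v)) hadd
    rw [Measure.map_add _ _ (measurable_shiftPoint v)] at this
    exact this
  · rw [shift_ofPoints, ofPoints_apply_eq_zero _ (measurableSet_hitting_Ici 0), hitting_Ici]
    intro k hk
    rw [shiftPoint_interval, Set.mem_ofPred_eq, interval_snd] at hk
    have h1 := startTime_add_one c (-(k + 1 : ℤ))
    have h2 := (startTime_strictMono hc).monotone (show -(k + 1 : ℤ) + 1 ≤ 0 by omega)
    rw [show startTime c 0 = 0 by simp [startTime]] at h2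
    linarith

end TwoSided

/-! ### Half-open intervals between successive times -/

section Partition

theorem tsum_indicator_Ico_le_one {ι : Type*} [LinearOrder ι] [SuccOrder ι] {S : ι → ℝ}
    (hS : Monotone S) (u : ℝ) :
    ∑' n, (Ico (S n) (S (Order.succ n))).indicator (1 : ℝ → ℝ≥0∞) u ≤ 1 := by
  by_cases h : ∃ n, u ∈ Ico (S n) (S (Order.succ n))
  · obtain ⟨n, hn⟩ := h
    rw [tsum_eq_single n]
    · simp [hn]
    · intro k hk
      refine indicator_of_notMem (fun hk' => ?_) _
      exact (disjoint_left.1 (hS.pairwise_disjoint_on_Ico_succ hk) hk') hn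
  · push Not at h
    simp [h]

theorem tsum_indicator_Ico_eq_one {ι : Type*} [LinearOrder ι] [SuccOrder ι] {S : ι → ℝ}
    (hS : Monotone S) {u : ℝ} (h : ∃ n, u ∈ Ico (S n) (S (Order.succ n))) :
    ∑' n, (Ico (S n) (S (Order.succ n))).indicator (1 : ℝ → ℝ≥0∞) u = 1 := by
  obtain ⟨n, hn⟩ := h
  refine le_antisymm (tsum_indicator_Ico_le_one hS u) ?_
  refine le_trans ?_ (ENNReal.le_tsum n)
  simp [hn]

theorem exists_mem_Ico_nat {S : ℕ → ℝ} {u : ℝ} (h0 : S 0 ≤ u) (h : ∃ n, u < S n) :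
    ∃ n, u ∈ Ico (S n) (S (n + 1)) := by
  classical
  have h1 := Nat.find_spec h
  obtain ⟨k, hk⟩ : ∃ k, Nat.find h = k + 1 := Nat.exists_eq_succ_of_ne_zero fun h' => by
    rw [h'] at h1
    exact absurd h0 (not_le.2 h1)
  refine ⟨k, not_lt.1 (Nat.find_min h (by omega)), ?_⟩
  rwa [hk] at h1

end Partition

/-! ### Measurability of interval indicators -/

section Measurability

variable {Ω : Type*} [MeasurableSpace Ω] {f g h : Ω → ℝ}

theorem measurableSet_mem_Ico (hf : Measurable f) (hg : Measurable g) (hh : Measurable h) :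
    MeasurableSet {ω | f ω ≤ h ω ∧ h ω < g ω} :=
  (measurableSet_le hf hh).inter (measurableSet_lt hh hg)

theorem measurable_indicator_Ico (hf : Measurable f) (hg : Measurable g) (hh : Measurable h) :
    Measurable fun ω => (Ico (f ω) (g ω)).indicator (1 : ℝ → ℝ≥0∞) (h ω) :=
  measurable_one.indicator (measurableSet_mem_Ico hf hg hh)

end Measurability

/-! ### Renewal density, renewal equation and limit -/

section Renewal

variable {𝒳 : Type*} [MeasurableSpace 𝒳]

/-- The law of an i.i.d. sequence. -/
noncomputable abbrev iidLaw {C : Type*} [MeasurableSpace C] (P : Measure C) : Measure (ℕ → C) :=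
  Measure.infinitePi fun _ : ℕ => P

/-- The probability that the cycle that starts at time `0` covers the time `v`. -/
noncomputable def survival (P : Measure (RenewalCycle 𝒳)) (v : ℝ) : ℝ≥0∞ :=
  P {c | 0 ≤ v ∧ v < c.duration}

/-- The density of the renewal measure without its atom at `0`, when the durations of the cycles
have density `φ`. -/
noncomputable def renewalDensity (P : Measure (RenewalCycle 𝒳)) (φ : ℝ → ℝ≥0∞) (s : ℝ) : ℝ≥0∞ :=
  ∑' n, ∫⁻ c, φ (s - cycleStart c n) ∂iidLaw P

variable {P : Measure (RenewalCycle 𝒳)} [IsProbabilityMeasure P]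

theorem cycleStart_splice_succ (n : ℕ) (c c' : ℕ → RenewalCycle 𝒳) :
    cycleStart (splice n c c') (n + 1) = cycleStart c n + (c' 0).duration := by
  rw [cycleStart_succ, cycleStart_splice]
  congr 2
  simpa using splice_add n 0 c c'

theorem cycleStart_splice_one (n : ℕ) (c c' : ℕ → RenewalCycle 𝒳) :
    cycleStart (splice 1 c c') (n + 1) = (c 0).duration + cycleStart c' n := by
  rw [add_comm n 1, cycleStart_add, cycleStart_splice, cycleStart_succ, cycleStart_zero, zero_add]
  simp_rw [splice_add]

theorem lintegral_cycleStart_succ {g : ℝ → ℝ≥0∞} (hg : Measurable g) (n : ℕ) :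
    ∫⁻ c, g (cycleStart c (n + 1)) ∂iidLaw P =
      ∫⁻ c, ∫⁻ x, g (cycleStart c n + x.duration) ∂P ∂iidLaw P := by
  rw [lintegral_infinitePi_splice P n (g := fun c => g (cycleStart c (n + 1))) (by fun_prop)]
  refine lintegral_congr fun c => ?_
  simp_rw [cycleStart_splice_succ]
  exact lintegral_infinitePi_eval P 0 (g := fun x => g (cycleStart c n + x.duration))
    (by fun_prop)

theorem lintegral_cycleStart_succ' {g : ℝ → ℝ≥0∞} (hg : Measurable g) (n : ℕ) :
    ∫⁻ c, g (cycleStart c (n + 1)) ∂iidLaw P =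
      ∫⁻ x, ∫⁻ c, g (x.duration + cycleStart c n) ∂iidLaw P ∂P := by
  rw [lintegral_infinitePi_cons P (g := fun c => g (cycleStart c (n + 1))) (by fun_prop)]
  simp_rw [cycleStart_splice_one]

theorem lintegral_exp_neg_cycleStart (n : ℕ) :
    ∫⁻ c, ENNReal.ofReal (Real.exp (-cycleStart c n)) ∂iidLaw P =
      (∫⁻ x, ENNReal.ofReal (Real.exp (-x.duration)) ∂P) ^ n := by
  induction n with
  | zero => simp
  | succ n ih =>
    rw [lintegral_cycleStart_succ (g := fun s => ENNReal.ofReal (Real.exp (-s))) (by fun_prop),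
      pow_succ, ← ih, ← lintegral_mul_const _ (by fun_prop)]
    refine lintegral_congr fun c => ?_
    rw [← lintegral_const_mul _ (by fun_prop)]
    refine lintegral_congr fun x => ?_
    rw [neg_add, Real.exp_add, ENNReal.ofReal_mul (Real.exp_nonneg _)]

theorem duration_pos {c : RenewalCycle 𝒳} (hc : 0 < c.1) : 0 < c.duration := add_pos hc c.2.1.2

theorem lintegral_exp_neg_duration_lt_one (hpos : ∀ᵐ c ∂P, 0 < c.1) :
    ∫⁻ x, ENNReal.ofReal (Real.exp (-x.duration)) ∂P < 1 := by
  have h : ∫⁻ _, (1 : ℝ≥0∞) ∂P = 1 := by simp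
  rw [← h]
  refine lintegral_strict_mono (IsProbabilityMeasure.ne_zero P) aemeasurable_const ?_ ?_
  · refine ((lintegral_mono_ae ?_).trans_lt (h.trans_lt ENNReal.one_lt_top)).ne
    filter_upwards [hpos] with c hc
    exact ENNReal.ofReal_le_one.2 (Real.exp_le_one_iff.2 (neg_nonpos.2 (duration_pos hc).le))
  · filter_upwards [hpos] with c hc
    exact ENNReal.ofReal_lt_one.2 (Real.exp_lt_one_iff.2 (neg_neg_iff_pos.2 (duration_pos hc)))

theorem ae_pos (hpos : ∀ᵐ c ∂P, 0 < c.1) : ∀ᵐ c ∂iidLaw P, ∀ k, 0 < (c k).1 :=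
  ae_infinitePi P hpos

/-- A Chernoff bound: the indicator of `S_n ≤ u` is at most `exp(u - S_n)`. For positive durations
the base of the power is less than `1`, so the decay is geometric without any moment assumption. -/
theorem measure_cycleStart_le (n : ℕ) (u : ℝ) :
    iidLaw P {c | cycleStart c n ≤ u} ≤ ENNReal.ofReal (Real.exp u) *
      (∫⁻ x, ENNReal.ofReal (Real.exp (-x.duration)) ∂P) ^ n := by
  rw [← lintegral_exp_neg_cycleStart, ← lintegral_const_mul _ (by fun_prop),
    ← lintegral_indicator_one (measurableSet_le (measurable_cycleStart n) measurable_const)]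
  refine lintegral_mono fun c => ?_
  by_cases h : cycleStart c n ≤ u
  · rw [indicator_of_mem (by exact h), ← ENNReal.ofReal_mul (Real.exp_nonneg _), ← Real.exp_add,
      Pi.one_apply, ENNReal.one_le_ofReal]
    exact Real.one_le_exp (by linarith)
  · rw [indicator_of_notMem (by exact h)]
    exact zero_le

theorem tendsto_measure_cycleStart_le (hpos : ∀ᵐ c ∂P, 0 < c.1) (u : ℝ) :
    Tendsto (fun n => iidLaw P {c | cycleStart c n ≤ u}) atTop (𝓝 0) := by
  refine tendsto_of_tendsto_of_tendsto_of_le_of_le tendsto_const_nhds ?_ (fun _ => zero_le)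
    fun n => measure_cycleStart_le n u
  have := ENNReal.Tendsto.const_mul (a := ENNReal.ofReal (Real.exp u))
    (ENNReal.tendsto_pow_atTop_nhds_zero_of_lt_one (lintegral_exp_neg_duration_lt_one hpos))
    (Or.inr ENNReal.ofReal_ne_top)
  simpa using this

/-- If all starts stay below `j`, an event of probability at most that of `S_n ≤ j` occurs for every
`n`. Integer levels suffice to treat all real `u` at once. -/
theorem ae_exists_lt_cycleStart (hpos : ∀ᵐ c ∂P, 0 < c.1) :
    ∀ᵐ c ∂iidLaw P, ∀ u, ∃ n, u < cycleStart c n := by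
  have h : ∀ᵐ c ∂iidLaw P, ∀ j : ℕ, ∃ n, (j : ℝ) < cycleStart c n := by
    rw [ae_all_iff]
    intro j
    refine nonpos_iff_eq_zero.1 (ge_of_tendsto' (tendsto_measure_cycleStart_le hpos j) fun n =>
      measure_mono fun c hc => ?_)
    simp only [Set.mem_compl_iff, Set.mem_ofPred_eq, not_exists, not_lt] at hc
    exact hc n
  filter_upwards [h] with c hc u
  obtain ⟨j, hj⟩ := exists_nat_gt u
  obtain ⟨n, hn⟩ := hc j
  exact ⟨n, hj.trans hn⟩

theorem ae_exists_mem_Ico (hpos : ∀ᵐ c ∂P, 0 < c.1) :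
    ∀ᵐ c ∂iidLaw P, ∀ u, 0 ≤ u → ∃ n, u ∈ Ico (cycleStart c n) (cycleStart c (n + 1)) := by
  filter_upwards [ae_exists_lt_cycleStart hpos] with c hc u hu
  exact exists_mem_Ico_nat (by simpa using hu) (hc u)

/-- Decomposition according to the cycle that covers a given time. -/
theorem lintegral_eq_tsum_cycle (hpos : ∀ᵐ c ∂P, 0 < c.1) {u : ℝ} (hu : 0 ≤ u)
    {g : (ℕ → RenewalCycle 𝒳) → ℝ≥0∞} (hg : Measurable g) :
    ∫⁻ c, g c ∂iidLaw P = ∑' n, ∫⁻ c,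
      (Ico (cycleStart c n) (cycleStart c (n + 1))).indicator 1 u * g c ∂iidLaw P := by
  have hm : ∀ n, Measurable fun c : ℕ → RenewalCycle 𝒳 =>
      (Ico (cycleStart c n) (cycleStart c (n + 1))).indicator (1 : ℝ → ℝ≥0∞) u := fun n =>
    measurable_indicator_Ico (by fun_prop) (by fun_prop) (by fun_prop)
  rw [← lintegral_tsum (f := fun n c =>
    (Ico (cycleStart c n) (cycleStart c (n + 1))).indicator (1 : ℝ → ℝ≥0∞) u * g c)
    fun n => ((hm n).mul hg).aemeasurable]
  refine lintegral_congr_ae ?_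
  filter_upwards [ae_pos hpos, ae_exists_mem_Ico hpos] with c hc hc'
  rw [ENNReal.tsum_mul_right]
  have := tsum_indicator_Ico_eq_one (cycleStart_mono hc).monotone (hc' u hu)
  simp only [Nat.succ_eq_succ, Nat.succ_eq_add_one] at this
  rw [this, one_mul]

@[fun_prop]
theorem measurable_survival : Measurable (survival P) := by
  have : MeasurableSet {q : ℝ × RenewalCycle 𝒳 | 0 ≤ q.1 ∧ q.1 < q.2.duration} :=
    measurableSet_mem_Ico (by fun_prop) (by fun_prop) (by fun_prop)
  exact measurable_measure_prodMk_left this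

theorem survival_le_one (v : ℝ) : survival P v ≤ 1 := prob_le_one

theorem survival_of_neg {v : ℝ} (hv : v < 0) : survival P v = 0 := by
  simp [survival, not_le.2 hv]

theorem lintegral_survival : ∫⁻ v, survival P v = ∫⁻ c, ENNReal.ofReal c.duration ∂P := by
  have hm : MeasurableSet {q : ℝ × RenewalCycle 𝒳 | 0 ≤ q.1 ∧ q.1 < q.2.duration} :=
    measurableSet_mem_Ico (by fun_prop) (by fun_prop) (by fun_prop)
  have h1 := Measure.prod_apply (μ := volume) (ν := P) hm
  have h2 := Measure.prod_apply_symm (μ := volume) (ν := P) hm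
  rw [h1] at h2
  refine h2.trans (lintegral_congr fun c => ?_)
  have : (fun x : ℝ => (x, c)) ⁻¹' {q : ℝ × RenewalCycle 𝒳 | 0 ≤ q.1 ∧ q.1 < q.2.duration} =
      Ico 0 c.duration := rfl
  rw [this, Real.volume_Ico, sub_zero]

theorem tendsto_survival : Tendsto (survival P) atTop (𝓝 0) := by
  have hanti : Antitone fun v : ℝ => {c : RenewalCycle 𝒳 | v < c.duration} :=
    fun v w hvw c (hc : w < c.duration) => hvw.trans_lt hc
  have h := tendsto_measure_iInter_atTop (μ := P)
    (fun v => (measurableSet_lt measurable_const measurable_duration).nullMeasurableSet) hanti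
    ⟨0, measure_ne_top _ _⟩
  have he : ⋂ v : ℝ, {c : RenewalCycle 𝒳 | v < c.duration} = ∅ := by
    ext c
    simp only [mem_iInter, Set.mem_ofPred_eq, mem_empty_iff_false, iff_false, not_forall, not_lt]
    exact ⟨c.duration, le_rfl⟩
  rw [he, measure_empty] at h
  exact tendsto_of_tendsto_of_tendsto_of_le_of_le tendsto_const_nhds h (fun _ => zero_le)
    fun v => measure_mono fun c hc => hc.2

theorem lintegral_survival_sub_cycleStart (u : ℝ) (n : ℕ) :
    ∫⁻ c, survival P (u - cycleStart c n) ∂iidLaw P =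
      ∫⁻ c, (Ico (cycleStart c n) (cycleStart c (n + 1))).indicator 1 u ∂iidLaw P := by
  rw [lintegral_infinitePi_splice P n (g := fun c =>
    (Ico (cycleStart c n) (cycleStart c (n + 1))).indicator (1 : ℝ → ℝ≥0∞) u)
    (measurable_indicator_Ico (by fun_prop) (by fun_prop) (by fun_prop))]
  refine lintegral_congr fun c => ?_
  have hm : MeasurableSet {x : RenewalCycle 𝒳 |
      0 ≤ u - cycleStart c n ∧ u - cycleStart c n < x.duration} :=
    measurableSet_mem_Ico (by fun_prop) (by fun_prop) (by fun_prop)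
  rw [survival, ← lintegral_indicator_one hm,
    ← lintegral_infinitePi_eval P (0 : ℕ) (measurable_one.indicator hm)]
  refine lintegral_congr fun c' => ?_
  rw [cycleStart_splice_succ, cycleStart_splice]
  simp only [indicator, Set.mem_ofPred_eq, mem_Ico, sub_nonneg, sub_lt_iff_lt_add', Pi.one_apply]

/-- The `n`-th term is the probability that cycle `n` covers `u`, and at most one cycle does. The
bound is needed for every real `u`; equality requires `0 ≤ u`. -/
theorem tsum_survival_le_one (hpos : ∀ᵐ c ∂P, 0 < c.1) (u : ℝ) :
    ∑' n, ∫⁻ c, survival P (u - cycleStart c n) ∂iidLaw P ≤ 1 := by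
  simp_rw [lintegral_survival_sub_cycleStart]
  rw [← lintegral_tsum fun n => (measurable_indicator_Ico (by fun_prop) (by fun_prop)
    (by fun_prop)).aemeasurable]
  calc _ ≤ ∫⁻ _, 1 ∂iidLaw P := lintegral_mono_ae ?_
    _ = 1 := by simp
  filter_upwards [ae_pos hpos] with c hc
  exact tsum_indicator_Ico_le_one (cycleStart_mono hc).monotone u

theorem tsum_survival_eq_one (hpos : ∀ᵐ c ∂P, 0 < c.1) {u : ℝ} (hu : 0 ≤ u) :
    ∑' n, ∫⁻ c, survival P (u - cycleStart c n) ∂iidLaw P = 1 := by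
  simp_rw [lintegral_survival_sub_cycleStart]
  have := lintegral_eq_tsum_cycle hpos hu (g := fun _ => 1) measurable_const
  simpa using this.symm

/-- The durations of the cycles have a density `φ` which is bounded by a multiple of the survival
function and positive at all large times, and their mean is finite. -/
structure HasRenewalDensity (P : Measure (RenewalCycle 𝒳)) (φ : ℝ → ℝ≥0∞) (K : ℝ≥0) : Prop where
  pos : ∀ᵐ c ∂P, 0 < c.1
  measurable : Measurable φ
  map_eq : P.map RenewalCycle.duration = volume.withDensity φ
  le_survival : ∀ x, φ x ≤ K * survival P x
  ne_zero : ∃ a₀, ∀ t, a₀ < t → φ t ≠ 0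
  mean_ne_top : ∫⁻ c, ENNReal.ofReal c.duration ∂P ≠ ∞

namespace HasRenewalDensity

variable {φ : ℝ → ℝ≥0∞} {K : ℝ≥0}

theorem lintegral_duration (h : HasRenewalDensity P φ K) {g : ℝ → ℝ≥0∞} (hg : Measurable g) :
    ∫⁻ x, g x.duration ∂P = ∫⁻ t, g t * φ t := by
  rw [← lintegral_map hg measurable_duration, h.map_eq,
    lintegral_withDensity_eq_lintegral_mul _ h.measurable hg]
  simp_rw [Pi.mul_apply, mul_comm]

theorem measurable_renewalDensity (h : HasRenewalDensity P φ K) :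
    Measurable (renewalDensity P φ) := by
  refine Measurable.tsum fun n => ?_
  exact Measurable.lintegral_prod_right'
    (f := fun q : ℝ × (ℕ → RenewalCycle 𝒳) => φ (q.1 - cycleStart q.2 n))
    (h.measurable.comp (by fun_prop))

/-- Domination of `φ` by the survival function compares the renewal density at `s` with `K` times
the probability that some cycle covers `s`. -/
theorem renewalDensity_le (h : HasRenewalDensity P φ K) (s : ℝ) : renewalDensity P φ s ≤ K := by
  calc renewalDensity P φ s
      ≤ ∑' n, ∫⁻ c, K * survival P (s - cycleStart c n) ∂iidLaw P :=
        ENNReal.tsum_le_tsum fun n => lintegral_mono fun c => h.le_survival _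
    _ = K * ∑' n, ∫⁻ c, survival P (s - cycleStart c n) ∂iidLaw P := by
        rw [← ENNReal.tsum_mul_left]
        exact tsum_congr fun n => lintegral_const_mul _ (by fun_prop)
    _ ≤ K * 1 := by gcongr; exact tsum_survival_le_one h.pos s
    _ = K := mul_one _

/-- The term `n = 0` is the atom at the origin; afterwards, the last of the first `n + 1` durations
has density `φ` and is independent of `S_n`. -/
theorem tsum_lintegral_cycleStart (h : HasRenewalDensity P φ K) {g : ℝ → ℝ≥0∞}
    (hg : Measurable g) :
    ∑' n, ∫⁻ c, g (cycleStart c n) ∂iidLaw P = g 0 + ∫⁻ s, g s * renewalDensity P φ s := by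
  have hm := h.measurable
  rw [tsum_eq_zero_add' ENNReal.summable]
  congr 1
  · simp
  · unfold renewalDensity
    simp_rw [← ENNReal.tsum_mul_left]
    rw [lintegral_tsum (f := fun n s => g s * ∫⁻ c, φ (s - cycleStart c n) ∂iidLaw P)
      fun n => (hg.mul (Measurable.lintegral_prod_right'
        (f := fun q : ℝ × (ℕ → RenewalCycle 𝒳) => φ (q.1 - cycleStart q.2 n))
        (hm.comp (by fun_prop)))).aemeasurable]
    refine tsum_congr fun n => ?_
    rw [lintegral_cycleStart_succ hg]
    calc _ = ∫⁻ c, (∫⁻ s, g s * φ (s - cycleStart c n)) ∂iidLaw P := by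
          refine lintegral_congr fun c => ?_
          rw [h.lintegral_duration (g := fun t => g (cycleStart c n + t)) (by fun_prop)]
          rw [← lintegral_add_left_eq_self (fun s => g s * φ (s - cycleStart c n)) (cycleStart c n)]
          simp only [add_sub_cancel_left]
      _ = _ := by
          rw [lintegral_lintegral_swap]
          · exact lintegral_congr fun s => lintegral_const_mul _ (hm.comp (by fun_prop))
          · exact (Measurable.mul (hg.comp measurable_snd)
              (hm.comp (by fun_prop))).aemeasurable

/-- Here the first duration is split off instead of the last one, which reproduces the renewal
density after time `t`. -/
theorem renewalDensity_eq (h : HasRenewalDensity P φ K) (s : ℝ) :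
    renewalDensity P φ s = φ s + ∫⁻ t, renewalDensity P φ (s - t) * φ t := by
  have hm := h.measurable
  rw [renewalDensity, tsum_eq_zero_add' ENNReal.summable]
  congr 1
  · simp
  · rw [← h.lintegral_duration (g := fun t => renewalDensity P φ (s - t))
      (h.measurable_renewalDensity.comp (by fun_prop))]
    unfold renewalDensity
    rw [lintegral_tsum fun n => Measurable.aemeasurable (Measurable.lintegral_prod_right'
      (f := fun q : RenewalCycle 𝒳 × (ℕ → RenewalCycle 𝒳) =>
        φ (s - q.1.duration - cycleStart q.2 n)) (hm.comp (by fun_prop)))]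
    refine tsum_congr fun n => ?_
    rw [lintegral_cycleStart_succ' (g := fun r => φ (s - r)) (hm.comp (by fun_prop))]
    simp_rw [sub_sub]

/-- Exactly one cycle covers `u`: the initial one, or one that started at `u - v`. This second
convolution identity fixes the limit, because the integral of the survival function is the mean. -/
theorem survival_add_lintegral (h : HasRenewalDensity P φ K) {u : ℝ} (hu : 0 ≤ u) :
    survival P u + ∫⁻ v, renewalDensity P φ (u - v) * survival P v = 1 := by
  rw [← tsum_survival_eq_one h.pos hu,
    h.tsum_lintegral_cycleStart (g := fun s => survival P (u - s)) (by fun_prop), sub_zero]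
  congr 1
  rw [← lintegral_sub_left_eq_self _ u]
  simp_rw [sub_sub_cancel, mul_comm]

theorem mean_ne_zero (h : HasRenewalDensity P φ K) :
    ∫⁻ c, ENNReal.ofReal c.duration ∂P ≠ 0 := by
  rw [Ne, lintegral_eq_zero_iff (by fun_prop)]
  intro h0
  obtain ⟨c, hc, hc'⟩ := (h0.and h.pos).exists
  exact (ENNReal.ofReal_pos.2 (duration_pos hc')).ne' hc

theorem lintegral_density (h : HasRenewalDensity P φ K) : ∫⁻ t, φ t = 1 := by
  have := h.lintegral_duration (g := fun _ => 1) measurable_const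
  simpa using this.symm

/-- The renewal theorem for the density of the renewal measure. -/
theorem tendsto_renewalDensity (h : HasRenewalDensity P φ K) :
    Tendsto (renewalDensity P φ) atTop (𝓝 (∫⁻ c, ENNReal.ofReal c.duration ∂P)⁻¹) := by
  set κ := ∫⁻ c, ENNReal.ofReal c.duration ∂P with hκ
  set m := renewalDensity P φ with hm_def
  have hm : Measurable m := h.measurable_renewalDensity
  have hφ : Measurable φ := h.measurable
  have hm_le : ∀ s, m s ≤ K := h.renewalDensity_le
  have hm_top : ∀ s, m s ≠ ∞ := fun s => ((hm_le s).trans_lt ENNReal.coe_lt_top).ne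
  have hφ_top : ∀ s, φ s ≠ ∞ := fun s => ((h.le_survival s).trans_lt
    (ENNReal.mul_lt_top ENNReal.coe_lt_top ((survival_le_one s).trans_lt ENNReal.one_lt_top))).ne
  have hS_top : ∀ s, survival P s ≠ ∞ := fun s =>
    ((survival_le_one s).trans_lt ENNReal.one_lt_top).ne
  -- The inhomogeneous term of the renewal equation vanishes at infinity because the survival
  -- function does.
  have hφ_lim : Tendsto φ atTop (𝓝 0) := by
    have := ENNReal.Tendsto.const_mul (a := (K : ℝ≥0∞)) (tendsto_survival (P := P))
      (Or.inr ENNReal.coe_ne_top)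
    rw [mul_zero] at this
    exact tendsto_of_tendsto_of_tendsto_of_le_of_le tendsto_const_nhds this (fun _ => zero_le)
      h.le_survival
  have hconv : ∀ {f : ℝ → ℝ≥0∞}, Measurable f → (∀ s, f s ≠ ∞) → ∀ u,
      ∫ t, (m (u - t)).toReal * (f t).toReal = (∫⁻ t, m (u - t) * f t).toReal := by
    intro f hf hft u
    simp_rw [← ENNReal.toReal_mul]
    refine integral_toReal (by fun_prop) (ae_of_all _ fun t => ?_)
    exact ENNReal.mul_lt_top (hm_top _).lt_top (hft t).lt_top
  have hint : ∀ {f : ℝ → ℝ≥0∞}, Measurable f → (∀ s, f s ≠ ∞) →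
      ∫ t, (f t).toReal = (∫⁻ t, f t).toReal := fun hf hft =>
    integral_toReal hf.aemeasurable (ae_of_all _ fun t => (hft t).lt_top)
  obtain ⟨a₀, ha₀⟩ := h.ne_zero
  have hκ_eq : ∫ t, (survival P t).toReal = κ.toReal := by
    rw [hint measurable_survival hS_top, lintegral_survival]
  have hκ_pos : 0 < κ.toReal := ENNReal.toReal_pos h.mean_ne_zero h.mean_ne_top
  have hmφ_top : ∀ u, ∫⁻ t, m (u - t) * φ t ≠ ∞ := fun u => by
    refine ((le_add_self.trans (h.renewalDensity_eq u).ge).trans_lt (hm_top u).lt_top).ne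
  have hmS : ∀ u, 0 ≤ u → ∫⁻ v, m (u - v) * survival P v ≠ ∞ := fun u hu =>
    ((le_add_self.trans (h.survival_add_lintegral hu).le).trans_lt ENNReal.one_lt_top).ne
  -- `G` is the survival function; its convolution with the renewal density is `1` minus a term
  -- tending to `0`, hence `L = 1`.
  have key := tendsto_of_renewal_equation (m := fun s => (m s).toReal)
    (f := fun s => (φ s).toReal) (G := fun s => (survival P s).toReal) (K := K) (L := 1) (a₀ := a₀)
    hm.ennreal_toReal (fun s => by
      rw [abs_of_nonneg ENNReal.toReal_nonneg]
      exact ENNReal.toReal_mono ENNReal.coe_ne_top (hm_le s))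
    (integrable_toReal_of_lintegral_ne_top hφ.aemeasurable (by simp [h.lintegral_density]))
    (fun _ => ENNReal.toReal_nonneg)
    (by rw [hint hφ hφ_top, h.lintegral_density, ENNReal.toReal_one])
    (fun t ht => (ENNReal.toReal_pos (ha₀ t ht) (hφ_top t)).ne')
    (integrable_toReal_of_lintegral_ne_top measurable_survival.aemeasurable
      (by rw [lintegral_survival]; exact h.mean_ne_top))
    (fun t ht => by simp [survival_of_neg ht])
    (by rwa [hκ_eq])
    (by
      have hl := (ENNReal.tendsto_toReal ENNReal.zero_ne_top).comp hφ_lim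
      rw [ENNReal.toReal_zero] at hl
      refine hl.congr fun u => ?_
      have hu : m u = φ u + ∫⁻ t, m (u - t) * φ t := h.renewalDensity_eq u
      rw [hconv hφ hφ_top, Function.comp_apply, hu, ENNReal.toReal_add (hφ_top u) (hmφ_top u)]
      ring)
    (by
      have hl := (ENNReal.tendsto_toReal ENNReal.zero_ne_top).comp (tendsto_survival (P := P))
      rw [ENNReal.toReal_zero] at hl
      have hl' := hl.const_sub 1
      rw [sub_zero] at hl'
      refine hl'.congr' ?_
      filter_upwards [eventually_ge_atTop 0] with u hu
      rw [hconv measurable_survival hS_top, Function.comp_apply, sub_eq_iff_eq_add',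
        ← ENNReal.toReal_add (hS_top u) (hmS u hu), h.survival_add_lintegral hu,
        ENNReal.toReal_one])
  rw [hκ_eq, one_div, ← ENNReal.toReal_inv] at key
  rwa [ENNReal.tendsto_toReal_iff hm_top (ENNReal.inv_ne_top.2 h.mean_ne_zero)] at key

end HasRenewalDensity

end Renewal

/-! ### Elementary bounds for total variation -/

section TotalVariation

variable {X : Type*} [MeasurableSpace X]

theorem tvDist_le {μ ν : Measure X} {D : ℝ≥0∞}
    (h : ∀ A, MeasurableSet A → μ A ≤ ν A + D ∧ ν A ≤ μ A + D) : tvDist μ ν ≤ D :=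
  iSup₂_le fun A hA => max_le (tsub_le_iff_left.2 (h A hA).1) (tsub_le_iff_left.2 (h A hA).2)

theorem le_add_tvDist {μ ν : Measure X} {A : Set X} (hA : MeasurableSet A) :
    μ A ≤ ν A + tvDist μ ν :=
  tsub_le_iff_left.1 ((le_max_left _ _).trans
    (le_iSup₂ (f := fun (A : Set X) (_ : MeasurableSet A) => max (μ A - ν A) (ν A - μ A)) A hA))

theorem le_add_tvDist' {μ ν : Measure X} {A : Set X} (hA : MeasurableSet A) :
    ν A ≤ μ A + tvDist μ ν :=
  tsub_le_iff_left.1 ((le_max_right _ _).trans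
    (le_iSup₂ (f := fun (A : Set X) (_ : MeasurableSet A) => max (μ A - ν A) (ν A - μ A)) A hA))

end TotalVariation

/-! ### Palm inversion and stationarity -/

section Palm

variable {𝒳 : Type*} [MeasurableSpace 𝒳]

/-- The stationary version of the two-sided alternating process with i.i.d. cycles of law `P`. -/
noncomputable def palmLaw (P : Measure (RenewalCycle 𝒳)) :
    Measure (PointMeasure (Triangle × 𝒳)) :=
  (∫⁻ c, ENNReal.ofReal c.duration ∂P)⁻¹ •
    (((Measure.infinitePi fun _ : ℤ => P).prod volume).restrict
      {q : (ℤ → RenewalCycle 𝒳) × ℝ | 0 ≤ q.2 ∧ q.2 < (q.1 0).duration}).map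
        fun q => shift q.2 (twoSided q.1)

theorem stationaryLaw_eq (α : ℝ) (Ξ : Measure (Ioi (0 : ℝ) × 𝒳)) :
    stationaryLaw α Ξ = palmLaw (cycleLaw α Ξ) := rfl

variable {P : Measure (RenewalCycle 𝒳)} [IsProbabilityMeasure P]

/-- The indicator of the event that the `n`-th cycle covers the time `v`. -/
noncomputable def covers (n : ℤ) (c : ℤ → RenewalCycle 𝒳) (v : ℝ) : ℝ≥0∞ :=
  (Ico (startTime c n) (startTime c (n + 1))).indicator 1 v

theorem measurable_covers {Ω : Type*} [MeasurableSpace Ω] (n : ℤ) {c : Ω → ℤ → RenewalCycle 𝒳}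
    {v : Ω → ℝ} (hc : Measurable c) (hv : Measurable v) :
    Measurable fun ω => covers n (c ω) (v ω) :=
  measurable_indicator_Ico ((measurable_startTime n).comp hc)
    ((measurable_startTime (n + 1)).comp hc) hv

@[simp]
theorem startTime_zero (c : ℤ → RenewalCycle 𝒳) : startTime c 0 = 0 := by simp [startTime]

theorem covers_zero (c : ℤ → RenewalCycle 𝒳) (v : ℝ) :
    covers 0 c v = (Ico 0 (c 0).duration).indicator 1 v := by
  rw [covers, startTime_add_one, startTime_zero, zero_add]

theorem covers_shift (n k : ℤ) (c : ℤ → RenewalCycle 𝒳) (v : ℝ) :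
    covers k (fun i => c (n + i)) v = covers (n + k) c (startTime c n + v) := by
  simp only [covers, startTime_shift, indicator, mem_Ico, ← add_assoc, sub_le_iff_le_add',
    lt_sub_iff_add_lt']
  rfl

theorem palmLaw_apply {B : Set (PointMeasure (Triangle × 𝒳))} (hB : MeasurableSet B) :
    palmLaw P B = (∫⁻ c, ENNReal.ofReal c.duration ∂P)⁻¹ *
      ∫⁻ c, (∫⁻ v, covers 0 c v * B.indicator 1 (shift v (twoSided c)))
        ∂(Measure.infinitePi fun _ : ℤ => P) := by
  have hS : MeasurableSet {q : (ℤ → RenewalCycle 𝒳) × ℝ | 0 ≤ q.2 ∧ q.2 < (q.1 0).duration} :=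
    measurableSet_mem_Ico (by fun_prop) (by fun_prop) (by fun_prop)
  have hB' := measurable_shift_twoSided (𝒳 := 𝒳) hB
  rw [palmLaw, Measure.smul_apply, smul_eq_mul, Measure.map_apply measurable_shift_twoSided hB,
    Measure.restrict_apply hB', ← lintegral_indicator_one (hB'.inter hS),
    lintegral_prod _ (measurable_one.indicator (hB'.inter hS)).aemeasurable]
  congr 1
  refine lintegral_congr fun c => lintegral_congr fun v => ?_
  rw [covers_zero, inter_indicator_one, mul_comm]
  rfl

theorem isProbabilityMeasure_palmLaw (h0 : ∫⁻ c, ENNReal.ofReal c.duration ∂P ≠ 0)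
    (htop : ∫⁻ c, ENNReal.ofReal c.duration ∂P ≠ ∞) : IsProbabilityMeasure (palmLaw P) := by
  constructor
  rw [palmLaw_apply .univ]
  have h : ∀ c : ℤ → RenewalCycle 𝒳, ∫⁻ v, covers 0 c v * (univ : Set (PointMeasure
      (Triangle × 𝒳))).indicator 1 (shift v (twoSided c)) = ENNReal.ofReal (c 0).duration := by
    intro c
    simp_rw [covers_zero, indicator_univ, Pi.one_apply, mul_one]
    rw [lintegral_indicator_one measurableSet_Ico, Real.volume_Ico, sub_zero]
  simp_rw [h]
  rw [lintegral_infinitePi_eval P (0 : ℤ) (g := fun x => ENNReal.ofReal x.duration) (by fun_prop)]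
  exact ENNReal.inv_mul_cancel h0 htop

theorem startTime_neg_natCast (c : ℤ → RenewalCycle 𝒳) (n : ℕ) :
    startTime c (-(n : ℤ)) = -cycleStart (fun k : ℕ => c (-(k : ℤ) - 1)) n := by
  induction n with
  | zero => simp
  | succ n ih =>
    have := startTime_add_one c (-(n : ℤ) - 1)
    rw [sub_add_cancel, ih] at this
    rw [cycleStart_succ, show -((n + 1 : ℕ) : ℤ) = -(n : ℤ) - 1 by push_cast; ring]
    linarith

/-- Both halves of the two-sided sequence are i.i.d., so the starting times tend to infinity in both
directions and the cycles tile the line. -/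
theorem ae_tsum_covers (hpos : ∀ᵐ c ∂P, 0 < c.1) :
    ∀ᵐ c ∂(Measure.infinitePi fun _ : ℤ => P), ∀ v, ∑' n, covers n c v = 1 := by
  have hf : ∀ᵐ c ∂(Measure.infinitePi fun _ : ℤ => P), ∀ u, ∃ n,
      u < cycleStart (fun k : ℕ => c k) n := by
    refine ae_of_ae_map (f := fun (c : ℤ → RenewalCycle 𝒳) (k : ℕ) => c k)
      (p := fun c => ∀ u, ∃ n, u < cycleStart c n) (measurable_reindex _).aemeasurable ?_
    rw [map_comp_infinitePi P (e := fun k : ℕ => (k : ℤ)) Nat.cast_injective]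
    exact ae_exists_lt_cycleStart hpos
  have hb : ∀ᵐ c ∂(Measure.infinitePi fun _ : ℤ => P), ∀ u, ∃ n,
      u < cycleStart (fun k : ℕ => c (-(k : ℤ) - 1)) n := by
    refine ae_of_ae_map (f := fun (c : ℤ → RenewalCycle 𝒳) (k : ℕ) => c (-(k : ℤ) - 1))
      (p := fun c => ∀ u, ∃ n, u < cycleStart c n) (measurable_reindex _).aemeasurable ?_
    rw [map_comp_infinitePi P (e := fun k : ℕ => -(k : ℤ) - 1) (fun a b hab => by simpa using hab)]
    exact ae_exists_lt_cycleStart hpos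
  filter_upwards [hf, hb, ae_infinitePi P hpos] with c hf hb hc v
  refine tsum_indicator_Ico_eq_one (startTime_strictMono hc).monotone ?_
  obtain ⟨N, hN⟩ := hb (-v)
  obtain ⟨M, hM⟩ := hf v
  -- The cycle `-N` starts at or before `v`, so the covering cycle can be found by counting upwards
  -- from it.
  obtain ⟨n, hn⟩ := exists_mem_Ico_nat (S := fun k : ℕ => startTime c (k - (N : ℤ))) (u := v)
    (by simp only [Nat.cast_zero, zero_sub, startTime_neg_natCast]; linarith)
    ⟨M + N, by simpa [startTime_natCast] using hM⟩
  refine ⟨n - (N : ℤ), ?_⟩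
  rw [Order.succ_eq_add_one]
  convert hn using 3
  push_cast
  ring

/-- Mass transport. In `J n`, the time `v` lies in cycle `0` and `v - u` in cycle `-n`. Summation
over `n` gives the Palm law; for the translated law, `v - u` lies in cycle `0` and `v` in cycle `n`,
which is `J n` after relabelling by `n`. Relabelling preserves the i.i.d. law. -/
theorem isStationary_palmLaw (hpos : ∀ᵐ c ∂P, 0 < c.1) : IsStationary (palmLaw P) := by
  intro u
  refine Measure.ext fun B hB => ?_
  rw [Measure.map_apply (measurable_shift u) hB, palmLaw_apply (measurable_shift u hB),
    palmLaw_apply hB]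
  congr 1
  generalize hμ : (Measure.infinitePi fun _ : ℤ => P) = μ
  have hcovers := ae_tsum_covers hpos
  rw [hμ] at hcovers
  obtain ⟨F, hF⟩ : ∃ F : (ℤ → RenewalCycle 𝒳) → ℝ → ℝ≥0∞,
      ∀ c v, F c v = B.indicator 1 (shift v (twoSided c)) := ⟨_, fun _ _ => rfl⟩
  have hFm : Measurable fun q : (ℤ → RenewalCycle 𝒳) × ℝ => F q.1 q.2 := by
    simp_rw [hF]
    exact (measurable_one.indicator hB).comp measurable_shift_twoSided
  have hFn : ∀ n c v, F (fun i => c (n + i)) v = F c (startTime c n + v) := by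
    intro n c v
    simp only [hF, twoSided_shift, shift_shift]
  obtain ⟨J, hJ⟩ : ∃ J : ℤ → (ℤ → RenewalCycle 𝒳) → ℝ≥0∞,
      ∀ n c, J n c = ∫⁻ v, covers 0 c v * covers (-n) c (v - u) * F c v := ⟨_, fun _ _ => rfl⟩
  have hJm : ∀ n, Measurable (J n) := fun n => by
    rw [funext (hJ n)]
    exact Measurable.lintegral_prod_right'
      (f := fun q : (ℤ → RenewalCycle 𝒳) × ℝ => covers 0 q.1 q.2 * covers (-n) q.1 (q.2 - u) *
        F q.1 q.2)
      (((measurable_covers 0 measurable_fst measurable_snd).mul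
        (measurable_covers _ measurable_fst (measurable_snd.sub_const u))).mul hFm)
  have hJn : ∀ n, Measurable fun c : ℤ → RenewalCycle 𝒳 => J n fun i => c (n + i) := fun n =>
    (hJm n).comp (measurable_reindex fun i : ℤ => n + i)
  have hcv : ∀ (n : ℤ) (c : ℤ → RenewalCycle 𝒳), Measurable fun v => covers n c v := fun n c =>
    measurable_covers (Ω := ℝ) (c := fun _ => c) n measurable_const measurable_id
  have hFc : ∀ c, Measurable fun v => F c v := fun c =>
    hFm.comp (measurable_const.prodMk measurable_id)
  have hp : ∀ (k l : ℤ) (c : ℤ → RenewalCycle 𝒳),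
      Measurable fun v => covers k c v * covers l c (v - u) * F c v := fun k l c =>
    ((hcv k c).mul ((hcv l c).comp (measurable_id.sub_const u))).mul (hFc c)
  -- The sum runs over the cycle that contains the translated time; the substitution by `startTime c
  -- n` then takes that cycle as the new origin.
  have hL : ∫⁻ c, (∫⁻ v, covers 0 c v * (shift u ⁻¹' B).indicator 1 (shift v (twoSided c))) ∂μ =
      ∑' n, ∫⁻ c, J n (fun i => c (n + i)) ∂μ := by
    rw [← lintegral_tsum fun n => (hJn n).aemeasurable]
    refine lintegral_congr_ae ?_
    filter_upwards [hcovers] with c hc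
    have e1 : ∀ v, covers 0 c v * (shift u ⁻¹' B).indicator 1 (shift v (twoSided c)) =
        covers 0 c v * F c (v + u) := by
      intro v
      rw [hF, ← shift_shift]
      rfl
    simp_rw [e1]
    rw [← lintegral_sub_right_eq_self _ u]
    simp_rw [sub_add_cancel]
    have e2 : ∀ v, covers 0 c (v - u) * F c v =
        ∑' n, covers n c v * covers 0 c (v - u) * F c v := by
      intro v
      simp_rw [mul_assoc]
      rw [ENNReal.tsum_mul_right, hc v, one_mul]
    simp_rw [e2]
    rw [lintegral_tsum fun n => (hp n 0 c).aemeasurable]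
    refine tsum_congr fun n => ?_
    rw [hJ, ← lintegral_add_left_eq_self _ (startTime c n)]
    refine lintegral_congr fun v => ?_
    simp only [hFn, covers_shift]
    rw [add_zero, add_neg_cancel, add_sub_assoc]
  have hR : ∫⁻ c, (∫⁻ v, covers 0 c v * B.indicator 1 (shift v (twoSided c))) ∂μ =
      ∑' n, ∫⁻ c, J n c ∂μ := by
    rw [← lintegral_tsum fun n => (hJm n).aemeasurable]
    refine lintegral_congr_ae ?_
    filter_upwards [hcovers] with c hc
    simp_rw [hJ]
    rw [← lintegral_tsum fun n => (hp 0 (-n) c).aemeasurable]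
    refine lintegral_congr fun v => ?_
    simp_rw [mul_right_comm _ _ (F c v)]
    rw [ENNReal.tsum_mul_left, ← (Equiv.neg ℤ).tsum_eq]
    simp only [Equiv.neg_apply, neg_neg, hc, mul_one, hF]
  rw [hL, hR]
  refine tsum_congr fun n => ?_
  rw [← lintegral_map (μ := μ) (f := J n) (g := fun c i => c (n + i)) (hJm n) (measurable_reindex _),
    ← hμ, map_comp_infinitePi P (add_right_injective n)]

end Palm

/-! ### Convergence of the future in total variation -/

section Convergence

variable {𝒳 : Type*} [MeasurableSpace 𝒳] [MeasurableSingletonClass 𝒳]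

/-- The probability that the cycle that starts at time `0` covers `v` and the future of the
alternating process after `v` belongs to `A`. -/
noncomputable def residual (P : Measure (RenewalCycle 𝒳)) (A : Set (PointMeasure (Triangle × 𝒳)))
    (v : ℝ) : ℝ≥0∞ :=
  iidLaw P {c | (0 ≤ v ∧ v < (c 0).duration) ∧ restrictTo (Ici 0) (shift v (alternating c)) ∈ A}

variable {P : Measure (RenewalCycle 𝒳)} [IsProbabilityMeasure P]
  {A : Set (PointMeasure (Triangle × 𝒳))}

theorem measurable_future : Measurable fun q : (ℕ → RenewalCycle 𝒳) × ℝ =>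
    restrictTo (Ici 0) (shift q.2 (alternating q.1)) :=
  (measurable_restrictTo (measurableSet_hitting_Ici 0)).comp measurable_shift_alternating

theorem measurableSet_residual (hA : MeasurableSet A) :
    MeasurableSet {q : (ℕ → RenewalCycle 𝒳) × ℝ | (0 ≤ q.2 ∧ q.2 < (q.1 0).duration) ∧
      restrictTo (Ici 0) (shift q.2 (alternating q.1)) ∈ A} :=
  (measurableSet_mem_Ico (by fun_prop) (by fun_prop) (by fun_prop)).inter (measurable_future hA)

theorem measurable_residual (hA : MeasurableSet A) : Measurable (residual P A) :=
  measurable_measure_prodMk_right (measurableSet_residual hA)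

theorem residual_le_survival (v : ℝ) : residual P A v ≤ survival P v := by
  have h : MeasurableSet {x : RenewalCycle 𝒳 | 0 ≤ v ∧ v < x.duration} :=
    measurableSet_mem_Ico (by fun_prop) (by fun_prop) (by fun_prop)
  calc residual P A v ≤ iidLaw P ((fun c => c 0) ⁻¹' {x | 0 ≤ v ∧ v < x.duration}) :=
        measure_mono fun c hc => hc.1
    _ = survival P v := by
        rw [← Measure.map_apply (by fun_prop) h, map_eval_infinitePi, survival]

/-- From a positive time of cycle `0` the future involves only cycles of nonnegative index, so the
two-sided process may be replaced by the one-sided one. The time `v = 0`, where the previous active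
period is still visible, is a null set. -/
theorem map_palmLaw_apply (hpos : ∀ᵐ c ∂P, 0 < c.1) (hA : MeasurableSet A) :
    (palmLaw P).map (restrictTo (Ici 0)) A =
      (∫⁻ c, ENNReal.ofReal c.duration ∂P)⁻¹ * ∫⁻ v, residual P A v := by
  have hR : Measurable (restrictTo (Ici 0) : PointMeasure (Triangle × 𝒳) → _) :=
    measurable_restrictTo (measurableSet_hitting_Ici 0)
  rw [Measure.map_apply hR hA, palmLaw_apply (hR hA)]
  congr 1
  have hm := measurableSet_residual hA
  have e1 : ∫⁻ v, residual P A v = ∫⁻ c, (∫⁻ v,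
      {q : (ℕ → RenewalCycle 𝒳) × ℝ | (0 ≤ q.2 ∧ q.2 < (q.1 0).duration) ∧
        restrictTo (Ici 0) (shift q.2 (alternating q.1)) ∈ A}.indicator 1 (c, v)) ∂iidLaw P := by
    rw [← lintegral_prod _ (measurable_one.indicator hm).aemeasurable, lintegral_indicator_one hm,
      Measure.prod_apply_symm hm]
    rfl
  have hmap : iidLaw P = (Measure.infinitePi fun _ : ℤ => P).map fun c (k : ℕ) => c k :=
    (map_comp_infinitePi P (e := fun k : ℕ => (k : ℤ)) Nat.cast_injective).symm
  rw [e1, hmap, lintegral_map (Measurable.lintegral_prod_right' (measurable_one.indicator hm))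
    (measurable_reindex _)]
  refine lintegral_congr_ae ?_
  filter_upwards [ae_infinitePi P hpos] with c hc
  refine lintegral_congr_ae ?_
  filter_upwards [Measure.ae_ne volume (0 : ℝ)] with v hv
  rw [covers_zero]
  by_cases h1 : v ∈ Ico 0 (c 0).duration
  · have h2 := restrictTo_Ici_shift_twoSided hc (lt_of_le_of_ne h1.1 hv.symm)
    by_cases h3 : restrictTo (Ici 0) (shift v (twoSided c)) ∈ A
    · rw [indicator_of_mem h1, indicator_of_mem (by exact h3),
        indicator_of_mem (by exact ⟨h1, h2 ▸ h3⟩)]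
      simp
    · rw [indicator_of_notMem (s := restrictTo (Ici 0) ⁻¹' A) (by exact h3), mul_zero,
        indicator_of_notMem fun h => h3 (h2 ▸ h.2)]
  · rw [indicator_of_notMem h1, zero_mul, indicator_of_notMem fun h => h1 h.1]

/-- Decomposition by the cycle that covers `u` and regeneration at its start. The hypothesis `hne`
excludes starts exactly at `u`, where the preceding closed active interval would be counted in the
future. -/
theorem measure_future_eq_tsum (hpos : ∀ᵐ c ∂P, 0 < c.1) {u : ℝ} (hu : 0 ≤ u)
    (hne : ∀ n, ∀ᵐ c ∂iidLaw P, cycleStart c n ≠ u) (hA : MeasurableSet A) :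
    iidLaw P {c | restrictTo (Ici 0) (shift u (alternating c)) ∈ A} =
      ∑' n, ∫⁻ c, residual P A (u - cycleStart c n) ∂iidLaw P := by
  have hF : Measurable fun c : ℕ → RenewalCycle 𝒳 => restrictTo (Ici 0) (shift u (alternating c)) :=
    measurable_future.comp (measurable_id.prodMk measurable_const)
  change iidLaw P (_ ⁻¹' A) = _
  rw [← lintegral_indicator_one (hF hA), lintegral_eq_tsum_cycle hpos hu
    (measurable_one.indicator (hF hA))]
  refine tsum_congr fun n => ?_
  rw [lintegral_infinitePi_splice P n (g := fun c =>
    (Ico (cycleStart c n) (cycleStart c (n + 1))).indicator (1 : ℝ → ℝ≥0∞) u *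
      ((fun c => restrictTo (Ici 0) (shift u (alternating c))) ⁻¹' A).indicator 1 c)
    ((measurable_indicator_Ico (by fun_prop) (by fun_prop)
    (by fun_prop)).mul (measurable_one.indicator (hF hA)))]
  refine lintegral_congr_ae ?_
  filter_upwards [ae_pos hpos, hne n] with c hc hcn
  have hm : MeasurableSet {c' : ℕ → RenewalCycle 𝒳 |
      (0 ≤ u - cycleStart c n ∧ u - cycleStart c n < (c' 0).duration) ∧
        restrictTo (Ici 0) (shift (u - cycleStart c n) (alternating c')) ∈ A} :=
    (measurable_id.prodMk measurable_const) (measurableSet_residual hA)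
  rw [residual, ← lintegral_indicator_one hm]
  refine lintegral_congr_ae ?_
  filter_upwards [ae_pos hpos] with c' hc'
  have hgood : ∀ k, 0 < (splice n c c' k).1 := fun k => by
    unfold splice
    split_ifs
    exacts [hc k, hc' _]
  rw [cycleStart_splice_succ, cycleStart_splice]
  by_cases h1 : u ∈ Ico (cycleStart c n) (cycleStart c n + (c' 0).duration)
  · have h1' : 0 ≤ u - cycleStart c n ∧ u - cycleStart c n < (c' 0).duration :=
      ⟨by linarith [h1.1], by linarith [h1.2]⟩
    have h2 := restrictTo_Ici_shift_alternating hgood (v := u) (n := n)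
      (by rw [cycleStart_splice]; exact lt_of_le_of_ne h1.1 hcn)
    simp_rw [cycleStart_splice, splice_add] at h2
    rw [indicator_of_mem h1, Pi.one_apply, one_mul]
    by_cases h3 : restrictTo (Ici 0) (shift u (alternating (splice n c c'))) ∈ A
    · rw [indicator_of_mem (by exact h3), indicator_of_mem (by exact ⟨h1', h2 ▸ h3⟩)]
      simp
    · rw [indicator_of_notMem (by exact h3), indicator_of_notMem fun h => h3 (h2 ▸ h.2)]
  · rw [indicator_of_notMem h1, zero_mul, indicator_of_notMem]
    exact fun h => h1 ⟨by linarith [h.1.1], by linarith [h.1.2]⟩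

namespace HasRenewalDensity

variable {φ : ℝ → ℝ≥0∞} {K : ℝ≥0}

/-- The renewal measure has a density away from its atom at `0`, so the expected number of starts at
`u` is zero. -/
theorem ae_cycleStart_ne (h : HasRenewalDensity P φ K) {u : ℝ} (hu : u ≠ 0) (n : ℕ) :
    ∀ᵐ c ∂iidLaw P, cycleStart c n ≠ u := by
  have hm : Measurable (({u} : Set ℝ).indicator (1 : ℝ → ℝ≥0∞)) :=
    measurable_one.indicator (measurableSet_singleton u)
  have h0 := h.tsum_lintegral_cycleStart hm
  have h1 : ∫⁻ s, ({u} : Set ℝ).indicator 1 s * renewalDensity P φ s = 0 := by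
    rw [lintegral_eq_zero_iff (f := fun s => ({u} : Set ℝ).indicator 1 s * renewalDensity P φ s)
      (hm.mul h.measurable_renewalDensity)]
    filter_upwards [Measure.ae_ne volume u] with s hs
    simp [hs]
  rw [h1, indicator_of_notMem (by simpa using hu.symm), add_zero, ENNReal.tsum_eq_zero] at h0
  have := (lintegral_eq_zero_iff (hm.comp (measurable_cycleStart n))).1 (h0 n)
  filter_upwards [this] with c hc hcu
  simp [hcu] at hc

theorem measure_future (h : HasRenewalDensity P φ K) {u : ℝ} (hu : 0 < u) (hA : MeasurableSet A) :
    iidLaw P {c | restrictTo (Ici 0) (shift u (alternating c)) ∈ A} =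
      residual P A u + ∫⁻ v, residual P A v * renewalDensity P φ (u - v) := by
  rw [measure_future_eq_tsum h.pos hu.le (h.ae_cycleStart_ne hu.ne') hA,
    h.tsum_lintegral_cycleStart (g := fun s => residual P A (u - s))
      ((measurable_residual hA).comp (by fun_prop)), sub_zero]
  congr 1
  rw [← lintegral_sub_left_eq_self _ u]
  simp_rw [sub_sub_cancel]

/-- The law of the future after time `u` converges in total variation to the stationary law. -/
theorem tendsto_tvDist (h : HasRenewalDensity P φ K) :
    Tendsto (fun u : ℝ => tvDist
      ((iidLaw P).map fun c => restrictTo (Ici 0) (shift u (alternating c)))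
      ((palmLaw P).map (restrictTo (Ici 0)))) atTop (𝓝 0) := by
  set κ := ∫⁻ c, ENNReal.ofReal c.duration ∂P with hκ
  set m := renewalDensity P φ with hm_def
  have hm : Measurable m := h.measurable_renewalDensity
  have hκ' : κ⁻¹ ≠ ∞ := ENNReal.inv_ne_top.2 h.mean_ne_zero
  -- Subtraction is truncated, so the maximum is the absolute difference between the renewal density
  -- and its limit.
  let δ : ℝ → ℝ≥0∞ := fun x => max (m x - κ⁻¹) (κ⁻¹ - m x)
  have hδm : Measurable δ := (hm.sub_const _).max (measurable_const.sub hm)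
  have hδ : Tendsto δ atTop (𝓝 0) := by
    have h1 := ENNReal.Tendsto.sub h.tendsto_renewalDensity
      (tendsto_const_nhds (x := κ⁻¹)) (Or.inr hκ')
    have h2 := ENNReal.Tendsto.sub (tendsto_const_nhds (x := κ⁻¹)) h.tendsto_renewalDensity
      (Or.inr hκ')
    rw [tsub_self] at h1 h2
    simpa using h1.max h2
  have hδ_le : ∀ x, δ x ≤ K + κ⁻¹ := fun x => max_le
    (tsub_le_self.trans ((h.renewalDensity_le x).trans le_self_add)) (tsub_le_self.trans le_add_self)
  -- The error bound does not involve the event: `residual` is at most `survival`, which is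
  -- integrable because the mean is finite. This uniformity gives total variation.
  have hD : Tendsto (fun u => survival P u + ∫⁻ v, survival P v * δ (u - v)) atTop (𝓝 0) := by
    rw [← add_zero (0 : ℝ≥0∞)]
    refine tendsto_survival.add ?_
    have := tendsto_lintegral_filter_of_dominated_convergence (μ := (volume : Measure ℝ))
      (F := fun u v => survival P v * δ (u - v)) (f := fun _ => 0) (l := atTop)
      (fun v => survival P v * (K + κ⁻¹))
      (.of_forall fun u => by fun_prop) (.of_forall fun u => ae_of_all _ fun v => by
        gcongr; exact hδ_le _) ?_ (ae_of_all _ fun v => ?_)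
    · simpa using this
    · rw [lintegral_mul_const _ measurable_survival, lintegral_survival]
      exact ENNReal.mul_ne_top h.mean_ne_top (ENNReal.add_ne_top.2 ⟨ENNReal.coe_ne_top, hκ'⟩)
    · have := ENNReal.Tendsto.const_mul (a := survival P v)
        (hδ.comp (tendsto_atTop_add_const_right atTop (-v) tendsto_id))
        (Or.inr ((survival_le_one v).trans_lt ENNReal.one_lt_top).ne)
      simpa [sub_eq_add_neg] using this
  refine tendsto_of_tendsto_of_tendsto_of_le_of_le' tendsto_const_nhds hD
    (.of_forall fun _ => zero_le) ?_
  filter_upwards [eventually_gt_atTop 0] with u hu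
  refine tvDist_le fun A hA => ?_
  have hF : Measurable fun c : ℕ → RenewalCycle 𝒳 => restrictTo (Ici 0) (shift u (alternating c)) :=
    measurable_future.comp (measurable_id.prodMk measurable_const)
  have hr := measurable_residual (P := P) hA
  rw [Measure.map_apply hF hA, map_palmLaw_apply h.pos hA, preimage, h.measure_future hu hA,
    ← lintegral_const_mul _ hr, ← hκ]
  have hbound : ∀ {x y : ℝ≥0∞} (v : ℝ), x ≤ y + δ (u - v) →
      residual P A v * x ≤ y * residual P A v + survival P v * δ (u - v) := by
    intro x y v hxy
    calc residual P A v * x ≤ residual P A v * (y + δ (u - v)) := by gcongr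
      _ = y * residual P A v + residual P A v * δ (u - v) := by ring
      _ ≤ _ := by gcongr; exact residual_le_survival v
  constructor
  · calc _ ≤ survival P u + ∫⁻ v, (κ⁻¹ * residual P A v + survival P v * δ (u - v)) :=
          add_le_add (residual_le_survival u) (lintegral_mono fun v =>
            hbound v (tsub_le_iff_left.1 (le_max_left _ _)))
      _ = survival P u + ((∫⁻ v, κ⁻¹ * residual P A v) + ∫⁻ v, survival P v * δ (u - v)) := by
          rw [lintegral_add_left (hr.const_mul _)]
      _ = _ := by ring
  · calc ∫⁻ v, κ⁻¹ * residual P A v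
        ≤ ∫⁻ v, (residual P A v * m (u - v) + survival P v * δ (u - v)) := by
          refine lintegral_mono fun v => ?_
          rw [mul_comm, mul_comm (residual P A v) (m _)]
          exact hbound v (tsub_le_iff_left.1 (le_max_right _ _))
      _ = (∫⁻ v, residual P A v * m (u - v)) + ∫⁻ v, survival P v * δ (u - v) :=
          lintegral_add_left (hr.mul (hm.comp (by fun_prop))) _
      _ ≤ _ := by
          gcongr
          · exact le_add_self
          · exact le_add_self

end HasRenewalDensity

end Convergence

/-! ### Asymptotic independence of a bounded window and late dormancy -/

section Mixing

variable {𝒳 : Type*} [MeasurableSpace 𝒳]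

/-- The times covered by the first cycle of an i.i.d. sequence of cycles. -/
def firstCycleSet (𝒳 : Type*) [MeasurableSpace 𝒳] : Set ((ℕ → RenewalCycle 𝒳) × ℝ) :=
  {q | 0 ≤ q.2 ∧ q.2 < (q.1 0).duration}

/-- The law of an i.i.d. sequence of cycles, together with Lebesgue measure on the first one. -/
noncomputable def cycleMeasure (P : Measure (RenewalCycle 𝒳)) :
    Measure ((ℕ → RenewalCycle 𝒳) × ℝ) :=
  ((iidLaw P).prod volume).restrict (firstCycleSet 𝒳)

theorem measurableSet_firstCycleSet : MeasurableSet (firstCycleSet 𝒳) :=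
  measurableSet_mem_Ico (by fun_prop) (by fun_prop) (by fun_prop)

variable {P : Measure (RenewalCycle 𝒳)} [IsProbabilityMeasure P]

theorem cycleMeasure_univ :
    cycleMeasure P univ = ∫⁻ c, ENNReal.ofReal c.duration ∂P := by
  rw [cycleMeasure, Measure.restrict_apply_univ, Measure.prod_apply measurableSet_firstCycleSet,
    ← lintegral_infinitePi_eval P (0 : ℕ) (by fun_prop)]
  refine lintegral_congr fun c => ?_
  have : Prod.mk c ⁻¹' firstCycleSet 𝒳 = Ico 0 (c 0).duration := rfl
  rw [this, Real.volume_Ico, sub_zero]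

theorem ae_cycleMeasure {p : (ℕ → RenewalCycle 𝒳) → Prop} (h : ∀ᵐ c ∂iidLaw P, p c) :
    ∀ᵐ q ∂cycleMeasure P, p q.1 :=
  ae_restrict_of_ae (Measure.quasiMeasurePreserving_fst.ae h)

/-- Resampling the cycles after the first `n` ones does not change `cycleMeasure`. -/
theorem lintegral_cycleMeasure_splice {n : ℕ} (hn : 0 < n)
    {f : (ℕ → RenewalCycle 𝒳) × ℝ → ℝ≥0∞} (hf : Measurable f) :
    ∫⁻ q, f q ∂cycleMeasure P =
      ∫⁻ q, ∫⁻ c', f (splice n q.1 c', q.2) ∂iidLaw P ∂cycleMeasure P := by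
  have hg : Measurable fun q : (ℕ → RenewalCycle 𝒳) × ℝ =>
      ∫⁻ c', f (splice n q.1 c', q.2) ∂iidLaw P :=
    Measurable.lintegral_prod_right' (f := fun x : ((ℕ → RenewalCycle 𝒳) × ℝ) ×
      (ℕ → RenewalCycle 𝒳) => f (splice n x.1.1 x.2, x.1.2)) (hf.comp
      (((measurable_splice n).comp ((measurable_fst.comp measurable_fst).prodMk
        measurable_snd)).prodMk (measurable_snd.comp measurable_fst)))
  rw [cycleMeasure, ← lintegral_indicator measurableSet_firstCycleSet,
    ← lintegral_indicator measurableSet_firstCycleSet,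
    lintegral_prod_symm _ (hf.indicator measurableSet_firstCycleSet).aemeasurable,
    lintegral_prod_symm _ (hg.indicator measurableSet_firstCycleSet).aemeasurable]
  refine lintegral_congr fun v => ?_
  rw [lintegral_infinitePi_splice P n (g := fun c => (firstCycleSet 𝒳).indicator f (c, v))
    ((hf.indicator measurableSet_firstCycleSet).comp (measurable_id.prodMk measurable_const))]
  refine lintegral_congr fun c => ?_
  have hmem : ∀ c', (splice n c c', v) ∈ firstCycleSet 𝒳 ↔ (c, v) ∈ firstCycleSet 𝒳 := by
    intro c'
    simp only [firstCycleSet, Set.mem_ofPred_eq, splice_of_lt hn]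
  by_cases h : (c, v) ∈ firstCycleSet 𝒳
  · rw [indicator_of_mem h]
    exact lintegral_congr fun c' => indicator_of_mem ((hmem c').2 h) _
  · rw [indicator_of_notMem h]
    simp_rw [indicator_of_notMem (mt (hmem _).1 h), lintegral_zero]

theorem measurable_alternating_mem_dormantAt :
    MeasurableSet {q : (ℕ → RenewalCycle 𝒳) × ℝ | alternating q.1 ∈ dormantAt 𝒳 q.2} := by
  have : {q : (ℕ → RenewalCycle 𝒳) × ℝ | alternating q.1 ∈ dormantAt 𝒳 q.2} =
      (fun q => shift q.2 (alternating q.1)) ⁻¹' dormantAt 𝒳 0 := by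
    ext q
    rw [mem_preimage, shift_mem_dormantAt, zero_add]
    rfl
  rw [this]
  exact measurable_shift_alternating (measurableSet_dormantAt 0)

/-- The probability to be dormant at time `u`. -/
noncomputable def dormantProb (P : Measure (RenewalCycle 𝒳)) (u : ℝ) : ℝ≥0∞ :=
  iidLaw P {c | alternating c ∈ dormantAt 𝒳 u}

/-- The conditional probability to be dormant at time `r` given the first `n` cycles. -/
noncomputable def condDormantProb (P : Measure (RenewalCycle 𝒳)) (n : ℕ)
    (c : ℕ → RenewalCycle 𝒳) (r : ℝ) : ℝ≥0∞ :=
  iidLaw P {c' | alternating (splice n c c') ∈ dormantAt 𝒳 r}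

theorem measurable_condDormantProb (n : ℕ) (s : ℝ) :
    Measurable fun q : (ℕ → RenewalCycle 𝒳) × ℝ => condDormantProb P n q.1 (q.2 + s) := by
  have hm : Measurable fun x : ((ℕ → RenewalCycle 𝒳) × ℝ) × (ℕ → RenewalCycle 𝒳) =>
      (splice n x.1.1 x.2, x.1.2 + s) :=
    ((measurable_splice n).comp ((measurable_fst.comp measurable_fst).prodMk
      measurable_snd)).prodMk ((measurable_snd.comp measurable_fst).add_const s)
  exact measurable_measure_prodMk_left (ν := iidLaw P) (hm measurable_alternating_mem_dormantAt)

/-- The process regenerates at the start of cycle `n`, so only the time elapsed since then matters.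
-/
theorem condDormantProb_eq (hpos : ∀ᵐ c ∂P, 0 < c.1) {n : ℕ} {c : ℕ → RenewalCycle 𝒳}
    (hc : ∀ k, 0 < (c k).1) {r : ℝ} (hr : cycleStart c n ≤ r) :
    condDormantProb P n c r = dormantProb P (r - cycleStart c n) := by
  refine measure_congr ?_
  filter_upwards [ae_pos hpos] with c' hc'
  have hgood : ∀ k, 0 < (splice n c c' k).1 := fun k => by
    unfold splice
    split_ifs
    exacts [hc k, hc' _]
  have := alternating_mem_dormantAt_tail hgood (u := r) (n := n) (by rwa [cycleStart_splice])
  simp_rw [splice_add, cycleStart_splice] at this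
  exact propext this

/-- The event that the `n`-th cycle starts at most `L` after the marked time. -/
def lateSet (𝒳 : Type*) [MeasurableSpace 𝒳] (L : ℝ) (n : ℕ) :
    Set ((ℕ → RenewalCycle 𝒳) × ℝ) :=
  {q | cycleStart q.1 n ≤ q.2 + L}

theorem measurableSet_lateSet (L : ℝ) (n : ℕ) : MeasurableSet (lateSet 𝒳 L n) :=
  measurableSet_le (by fun_prop) (by fun_prop)

/-- The deviation of the conditional probability to be dormant from its stationary value. -/
noncomputable def dormantDeviation (P : Measure (RenewalCycle 𝒳)) (n : ℕ)
    (c : ℕ → RenewalCycle 𝒳) (r : ℝ) : ℝ≥0∞ :=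
  max (condDormantProb P n c r - palmLaw P (dormantAt 𝒳 0))
    (palmLaw P (dormantAt 𝒳 0) - condDormantProb P n c r)

theorem measurable_dormantDeviation (n : ℕ) (s : ℝ) :
    Measurable fun q : (ℕ → RenewalCycle 𝒳) × ℝ => dormantDeviation P n q.1 (q.2 + s) := by
  have h1 := measurable_condDormantProb (P := P) n s
  simp only [dormantDeviation]
  exact Measurable.max (h1.sub_const _) (measurable_const.sub h1)

variable [MeasurableSingletonClass 𝒳]

theorem lintegral_residual {A : Set (PointMeasure (Triangle × 𝒳))} (hA : MeasurableSet A) :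
    ∫⁻ v, residual P A v =
      cycleMeasure P {q | restrictTo (Ici 0) (shift q.2 (alternating q.1)) ∈ A} := by
  have h : {q : (ℕ → RenewalCycle 𝒳) × ℝ | restrictTo (Ici 0) (shift q.2 (alternating q.1)) ∈ A} ∩
      firstCycleSet 𝒳 = {q | (0 ≤ q.2 ∧ q.2 < (q.1 0).duration) ∧
      restrictTo (Ici 0) (shift q.2 (alternating q.1)) ∈ A} := by
    rw [inter_comm]
    rfl
  rw [cycleMeasure, Measure.restrict_apply
    (show MeasurableSet {q : (ℕ → RenewalCycle 𝒳) × ℝ |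
      restrictTo (Ici 0) (shift q.2 (alternating q.1)) ∈ A} from measurable_future hA), h,
    Measure.prod_apply_symm (measurableSet_residual hA)]
  rfl

namespace HasRenewalDensity

variable {φ : ℝ → ℝ≥0∞} {K : ℝ≥0}

/-- The law of the future of the stationary process in terms of `cycleMeasure`, for events that
are not affected by the restriction to `[0, ∞)`. -/
theorem palmLaw_eq_cycleMeasure (h : HasRenewalDensity P φ K)
    {A : Set (PointMeasure (Triangle × 𝒳))} (hA : MeasurableSet A)
    (hA' : ∀ ζ, restrictTo (Ici 0) ζ ∈ A ↔ ζ ∈ A) :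
    palmLaw P A = (∫⁻ c, ENNReal.ofReal c.duration ∂P)⁻¹ *
      cycleMeasure P {q | shift q.2 (alternating q.1) ∈ A} := by
  have h1 := map_palmLaw_apply h.pos hA
  rw [Measure.map_apply (measurable_restrictTo (measurableSet_hitting_Ici 0)) hA,
    lintegral_residual hA] at h1
  simp_rw [hA'] at h1
  rw [← h1]
  congr 1
  ext ζ
  exact (hA' ζ).symm

theorem restrictTo_Ici_mem_dormantAt {s : ℝ} (hs : 0 ≤ s) (ζ : PointMeasure (Triangle × 𝒳)) :
    restrictTo (Ici 0) ζ ∈ dormantAt 𝒳 s ↔ ζ ∈ dormantAt 𝒳 s :=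
  restrictTo_mem_dormantAt hs ζ

/-- Dormancy at the present is an event of the future on `[0, ∞)`, so this is the total variation
limit evaluated on one event. -/
theorem tendsto_dormantProb (h : HasRenewalDensity P φ K) :
    Tendsto (dormantProb P) atTop (𝓝 (palmLaw P (dormantAt 𝒳 0))) := by
  have hR : Measurable (restrictTo (Ici 0) : PointMeasure (Triangle × 𝒳) → _) :=
    measurable_restrictTo (measurableSet_hitting_Ici 0)
  have hD := measurableSet_dormantAt (𝒳 := 𝒳) 0
  have h1 : ∀ u : ℝ, ((iidLaw P).map fun c => restrictTo (Ici 0) (shift u (alternating c)))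
      (dormantAt 𝒳 0) = dormantProb P u := by
    intro u
    have hF : Measurable fun c : ℕ → RenewalCycle 𝒳 =>
        restrictTo (Ici 0) (shift u (alternating c)) :=
      measurable_future.comp (measurable_id.prodMk measurable_const)
    rw [Measure.map_apply hF hD, dormantProb]
    congr 1
    ext c
    change restrictTo (Ici 0) (shift u (alternating c)) ∈ dormantAt 𝒳 0 ↔ _
    rw [restrictTo_mem_dormantAt (by simp), shift_mem_dormantAt, zero_add]
    rfl
  have h2 : (palmLaw P).map (restrictTo (Ici 0)) (dormantAt 𝒳 0) = palmLaw P (dormantAt 𝒳 0) := by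
    rw [Measure.map_apply hR hD]
    congr 1
    ext ζ
    exact restrictTo_mem_dormantAt (by simp) ζ
  have := h.tendsto_tvDist
  have hprob : IsProbabilityMeasure (palmLaw P) :=
    isProbabilityMeasure_palmLaw h.mean_ne_zero h.mean_ne_top
  have hup := (tendsto_const_nhds (x := palmLaw P (dormantAt 𝒳 0))
    (f := (atTop : Filter ℝ))).add this
  have hlow := ENNReal.Tendsto.sub (tendsto_const_nhds (x := palmLaw P (dormantAt 𝒳 0))
    (f := (atTop : Filter ℝ))) this (Or.inl (measure_ne_top _ _))
  rw [add_zero] at hup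
  rw [tsub_zero] at hlow
  refine tendsto_of_tendsto_of_tendsto_of_le_of_le hlow hup (fun u => ?_) fun u => ?_
  · rw [← h1 u, ← h2]
    exact tsub_le_iff_right.2 (le_add_tvDist' hD)
  · rw [← h1 u, ← h2]
    exact le_add_tvDist hD

/-- The initial dormant period of cycle `0` has positive length, and all its times contribute to the
Palm integral. -/
theorem palmLaw_dormantAt_ne_zero (h : HasRenewalDensity P φ K) :
    palmLaw P (dormantAt 𝒳 0) ≠ 0 := by
  have hD := measurableSet_dormantAt (𝒳 := 𝒳) 0
  rw [h.palmLaw_eq_cycleMeasure hD (restrictTo_Ici_mem_dormantAt le_rfl)]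
  refine mul_ne_zero (ENNReal.inv_ne_zero.2 h.mean_ne_top) fun h0 => ?_
  rw [cycleMeasure, Measure.restrict_apply (show MeasurableSet {q : (ℕ → RenewalCycle 𝒳) × ℝ |
    shift q.2 (alternating q.1) ∈ dormantAt 𝒳 0} from measurable_shift_alternating hD)] at h0
  obtain ⟨c, hc0, hc⟩ := ((Measure.measure_ae_null_of_prod_null h0).and (ae_pos h.pos)).exists
  have hsub : Ico 0 (c 0).1 ⊆ Prod.mk c ⁻¹' ({q : (ℕ → RenewalCycle 𝒳) × ℝ |
      shift q.2 (alternating q.1) ∈ dormantAt 𝒳 0} ∩ firstCycleSet 𝒳) := by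
    intro v hv
    have hT : (c 0).1 < (c 0).duration := lt_add_of_pos_right _ (c 0).2.1.2
    refine ⟨?_, hv.1, hv.2.trans hT⟩
    change shift v (alternating c) ∈ dormantAt 𝒳 0
    rw [shift_mem_dormantAt, zero_add, alternating_mem_dormantAt_iff hc (n := 0)
      (by simpa using hv.1) (by rw [cycleStart_succ]; simpa using hv.2.trans hT)]
    simpa using hv.2
  have := measure_mono_null hsub hc0
  rw [Real.volume_Ico, sub_zero, ENNReal.ofReal_eq_zero] at this
  exact absurd (hc 0) (not_lt.2 this)

theorem isFiniteMeasure_cycleMeasure (h : HasRenewalDensity P φ K) :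
    IsFiniteMeasure (cycleMeasure P) :=
  ⟨by rw [cycleMeasure_univ]; exact h.mean_ne_top.lt_top⟩

/-- For almost every path the starts tend to infinity; dominated convergence applies because
`cycleMeasure P` has the finite mean as its total mass. -/
theorem tendsto_lateSet (h : HasRenewalDensity P φ K) (L : ℝ) :
    Tendsto (fun n => cycleMeasure P (lateSet 𝒳 L n)) atTop (𝓝 0) := by
  have := h.isFiniteMeasure_cycleMeasure
  simp_rw [← fun n => lintegral_indicator_one (μ := cycleMeasure P) (measurableSet_lateSet L n)]
  rw [← lintegral_zero (μ := cycleMeasure P)]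
  refine tendsto_lintegral_of_dominated_convergence (fun _ => 1)
    (fun n => measurable_one.indicator (measurableSet_lateSet L n))
    (fun n => ae_of_all _ fun q => indicator_le_self' (fun _ _ => zero_le) q)
    (by simp) ?_
  filter_upwards [ae_cycleMeasure (ae_pos h.pos),
    ae_cycleMeasure (ae_exists_lt_cycleStart h.pos)] with q hq hq'
  obtain ⟨N, hN⟩ := hq' (q.2 + L)
  refine tendsto_const_nhds.congr' ?_
  filter_upwards [eventually_ge_atTop N] with n hn
  refine (indicator_of_notMem (fun hmem => ?_) _).symm
  exact absurd (hN.trans_le ((cycleStart_mono hq).monotone hn)) (not_lt.2 hmem)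

theorem tendsto_dormantDeviation (h : HasRenewalDensity P φ K) (n : ℕ) :
    Tendsto (fun s => ∫⁻ q, dormantDeviation P n q.1 (q.2 + s) ∂cycleMeasure P) atTop (𝓝 0) := by
  have := h.isFiniteMeasure_cycleMeasure
  have hprob : IsProbabilityMeasure (palmLaw P) :=
    isProbabilityMeasure_palmLaw h.mean_ne_zero h.mean_ne_top
  have hp_top : palmLaw P (dormantAt 𝒳 0) ≠ ∞ := measure_ne_top _ _
  rw [← lintegral_zero (μ := cycleMeasure P)]
  refine tendsto_lintegral_filter_of_dominated_convergence (fun _ => 1)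
    (.of_forall fun s => measurable_dormantDeviation n s)
    (.of_forall fun s => ae_of_all _ fun q => max_le (tsub_le_self.trans prob_le_one)
      (tsub_le_self.trans prob_le_one)) (by simp) ?_
  filter_upwards [ae_cycleMeasure (ae_pos h.pos)] with q hq
  have h1 : Tendsto (fun s => condDormantProb P n q.1 (q.2 + s)) atTop
      (𝓝 (palmLaw P (dormantAt 𝒳 0))) := by
    have h2 := h.tendsto_dormantProb.comp (tendsto_atTop_add_const_right atTop
      (-cycleStart q.1 n) (tendsto_atTop_add_const_left atTop q.2 tendsto_id))
    refine h2.congr' ?_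
    filter_upwards [eventually_ge_atTop (cycleStart q.1 n - q.2)] with s hs
    rw [condDormantProb_eq h.pos hq (by linarith)]
    rfl
  have h3 := ENNReal.Tendsto.sub h1 (tendsto_const_nhds (x := palmLaw P (dormantAt 𝒳 0)))
    (Or.inr hp_top)
  have h4 := ENNReal.Tendsto.sub (tendsto_const_nhds (x := palmLaw P (dormantAt 𝒳 0))) h1
    (Or.inr hp_top)
  rw [tsub_self] at h3 h4
  simpa [dormantDeviation] using h3.max h4

/-- Under the stationary law, the event to be dormant at time `s` is asymptotically independent of
the restriction of the process to a bounded interval. -/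
theorem exists_mixing (h : HasRenewalDensity P φ K) {L : ℝ} (hL : 0 ≤ L) :
    ∃ ε : ℝ → ℝ≥0∞, Tendsto ε atTop (𝓝 0) ∧ ∀ s, 0 ≤ s → ∀ A, MeasurableSet A →
      palmLaw P (restrictTo (Icc 0 L) ⁻¹' A ∩ dormantAt 𝒳 s) ≤
        palmLaw P (dormantAt 𝒳 0) * palmLaw P (restrictTo (Icc 0 L) ⁻¹' A) + ε s ∧
      palmLaw P (dormantAt 𝒳 0) * palmLaw P (restrictTo (Icc 0 L) ⁻¹' A) ≤
        palmLaw P (restrictTo (Icc 0 L) ⁻¹' A ∩ dormantAt 𝒳 s) + ε s := by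
  set κ := ∫⁻ c, ENNReal.ofReal c.duration ∂P with hκ
  have hprob : IsProbabilityMeasure (palmLaw P) :=
    isProbabilityMeasure_palmLaw h.mean_ne_zero h.mean_ne_top
  set p := palmLaw P (dormantAt 𝒳 0) with hp
  have hp1 : p ≤ 1 := prob_le_one
  have hp_top : p ≠ ∞ := measure_ne_top _ _
  have hκ' : κ⁻¹ ≠ ∞ := ENNReal.inv_ne_top.2 h.mean_ne_zero
  set Λ := cycleMeasure P with hΛ
  have hΛfin : IsFiniteMeasure Λ := ⟨by rw [hΛ, cycleMeasure_univ]; exact h.mean_ne_top.lt_top⟩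
  have hR : Measurable (restrictTo (Icc 0 L) : PointMeasure (Triangle × 𝒳) → _) :=
    measurable_restrictTo (measurableSet_hitting_Icc hL)
  have hlate : ∀ n, MeasurableSet (lateSet 𝒳 L n) := measurableSet_lateSet L
  have he : Tendsto (fun n => Λ (lateSet 𝒳 L n)) atTop (𝓝 0) := h.tendsto_lateSet L
  have hδm : ∀ n s, Measurable fun q : (ℕ → RenewalCycle 𝒳) × ℝ =>
    dormantDeviation P n q.1 (q.2 + s) := measurable_dormantDeviation
  have hδ : ∀ n, Tendsto (fun s => ∫⁻ q, dormantDeviation P n q.1 (q.2 + s) ∂Λ) atTop (𝓝 0) :=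
    h.tendsto_dormantDeviation
  -- A large `n` makes the late set small, and for that `n` a large `s` makes the deviation small;
  -- the infimum avoids choosing `n` as a function of `s`. The index is positive because resampling
  -- must keep the first cycle, which carries the marked time.
  refine ⟨fun s => κ⁻¹ * ⨅ n : {n : ℕ // 0 < n}, (2 * Λ (lateSet 𝒳 L n) + ∫⁻ q, dormantDeviation P n q.1 (q.2 + s) ∂Λ),
    ?_, fun s hs A hA => ?_⟩
  · have : Tendsto (fun s => ⨅ n : {n : ℕ // 0 < n}, (2 * Λ (lateSet 𝒳 L n) +
        ∫⁻ q, dormantDeviation P n q.1 (q.2 + s) ∂Λ)) atTop (𝓝 0) := by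
      rw [ENNReal.tendsto_nhds_zero]
      intro η hη
      have h1 : Tendsto (fun n => 2 * Λ (lateSet 𝒳 L n)) atTop (𝓝 0) := by
        simpa using ENNReal.Tendsto.const_mul (a := 2) he (Or.inr (by simp))
      have hη2 : 0 < η / 2 := ENNReal.half_pos hη.ne'
      obtain ⟨n, hn, hn0⟩ := (((ENNReal.tendsto_nhds_zero.1 h1) _ hη2).and
        (eventually_gt_atTop 0)).exists
      filter_upwards [(ENNReal.tendsto_nhds_zero.1 (hδ n)) _ hη2] with s hs
      refine (iInf_le _ ⟨n, hn0⟩).trans ?_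
      calc _ ≤ η / 2 + η / 2 := add_le_add hn hs
        _ = η := ENNReal.add_halves η
    simpa using ENNReal.Tendsto.const_mul (a := κ⁻¹) this (Or.inr hκ')
  have hRA : ∀ ζ, restrictTo (Ici 0) ζ ∈ restrictTo (Icc 0 L) ⁻¹' A ↔
      ζ ∈ restrictTo (Icc 0 L) ⁻¹' A := fun ζ => by
    rw [mem_preimage, mem_preimage, restrictTo_restrictTo (measurableSet_hitting_Icc hL)
      Icc_subset_Ici_self]
  rw [h.palmLaw_eq_cycleMeasure (hR hA) hRA, h.palmLaw_eq_cycleMeasure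
    ((hR hA).inter (measurableSet_dormantAt s))
    (fun ζ => and_congr (hRA ζ) (restrictTo_Ici_mem_dormantAt hs ζ)), ← hκ, ← hΛ,
    mul_left_comm p, ← mul_add, ← mul_add]
  set Y : Set ((ℕ → RenewalCycle 𝒳) × ℝ) :=
    {q | shift q.2 (alternating q.1) ∈ restrictTo (Icc 0 L) ⁻¹' A} with hY
  set D : Set ((ℕ → RenewalCycle 𝒳) × ℝ) := {q | alternating q.1 ∈ dormantAt 𝒳 (q.2 + s)} with hD
  let Yn : ℕ → Set ((ℕ → RenewalCycle 𝒳) × ℝ) := fun n =>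
    {q | shift q.2 (firstCycles n q.1) ∈ restrictTo (Icc 0 L) ⁻¹' A}
  have hYm : MeasurableSet Y := measurable_shift_alternating (hR hA)
  have hYnm : ∀ n, MeasurableSet (Yn n) := fun n => measurable_shift_firstCycles n (hR hA)
  have hDm : MeasurableSet D := (measurable_fst.prodMk (measurable_snd.add_const s))
    measurable_alternating_mem_dormantAt
  have hX : {q : (ℕ → RenewalCycle 𝒳) × ℝ | shift q.2 (alternating q.1) ∈
      restrictTo (Icc 0 L) ⁻¹' A ∩ dormantAt 𝒳 s} = Y ∩ D := by
    ext q
    change _ ∧ _ ↔ _ ∧ _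
    rw [shift_mem_dormantAt, add_comm s]
    rfl
  rw [hX]
  -- If cycle `n` starts after the window, the window sees only the first `n` cycles.
  have hYYn : ∀ n, ∀ᵐ q ∂Λ, q ∉ lateSet 𝒳 L n → (q ∈ Y ↔ q ∈ Yn n) := by
    intro n
    filter_upwards [ae_cycleMeasure (ae_pos h.pos)] with q hq hql
    have hlt : q.2 + L < cycleStart q.1 n + (q.1 n).1 := (not_le.1 hql).trans
      (lt_add_of_pos_right _ (hq n))
    change restrictTo _ _ ∈ A ↔ restrictTo _ _ ∈ A
    rw [restrictTo_Icc_shift_alternating hq hL hlt]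
  have hle : ∀ (n : ℕ) {U V : Set ((ℕ → RenewalCycle 𝒳) × ℝ)},
      (∀ᵐ q ∂Λ, q ∉ lateSet 𝒳 L n → q ∈ U → q ∈ V) → Λ U ≤ Λ V + Λ (lateSet 𝒳 L n) := by
    intro n U V hUV
    refine (measure_mono_ae ?_).trans (measure_union_le V (lateSet 𝒳 L n))
    filter_upwards [hUV] with q hq hqU
    by_cases hl : q ∈ lateSet 𝒳 L n
    · exact Or.inr hl
    · exact Or.inl (hq hl hqU)
  -- Resampling the later cycles leaves `Yn n` unchanged and turns the indicator of dormancy into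
  -- its conditional probability.
  have hcond : ∀ n, 0 < n → Λ (Yn n ∩ D) =
      ∫⁻ q, (Yn n).indicator 1 q * condDormantProb P n q.1 (q.2 + s) ∂Λ := by
    intro n hn
    rw [← lintegral_indicator_one ((hYnm n).inter hDm), hΛ, lintegral_cycleMeasure_splice hn
      (measurable_one.indicator ((hYnm n).inter hDm))]
    refine lintegral_congr fun q => ?_
    have hm : MeasurableSet {c' | alternating (splice n q.1 c') ∈ dormantAt 𝒳 (q.2 + s)} :=
      (((measurable_splice n).comp (measurable_const.prodMk measurable_id)).prodMk
        measurable_const) measurable_alternating_mem_dormantAt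
    rw [condDormantProb, ← lintegral_indicator_one hm,
      ← lintegral_const_mul _ (measurable_one.indicator hm)]
    refine lintegral_congr fun c' => ?_
    rw [inter_indicator_one]
    have e : firstCycles n (splice n q.1 c') = firstCycles n q.1 :=
      firstCycles_congr fun k hk => splice_of_lt hk _ _
    have hmem : (splice n q.1 c', q.2) ∈ Yn n ↔ q ∈ Yn n := by
      change shift q.2 (firstCycles n (splice n q.1 c')) ∈ restrictTo (Icc 0 L) ⁻¹' A ↔ _
      rw [e]
      rfl
    have h1 : (Yn n).indicator (1 : (ℕ → RenewalCycle 𝒳) × ℝ → ℝ≥0∞) (splice n q.1 c', q.2) =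
        (Yn n).indicator 1 q := indicator_eq_indicator hmem rfl
    rw [Pi.mul_apply, h1]
    rfl
  have hYn_mul : ∀ n, p * Λ (Yn n) = ∫⁻ q, (Yn n).indicator 1 q * p ∂Λ := by
    intro n
    rw [lintegral_mul_const _ (measurable_one.indicator (hYnm n)),
      lintegral_indicator_one (hYnm n), mul_comm]
  have hind : ∀ (n : ℕ) (q : (ℕ → RenewalCycle 𝒳) × ℝ) {x y d : ℝ≥0∞}, x ≤ y + d →
      (Yn n).indicator 1 q * x ≤ (Yn n).indicator 1 q * y + d := by
    intro n q x y d hxy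
    by_cases hq : q ∈ Yn n
    · simpa [hq] using hxy
    · simp [hq]
  have h1 : ∀ n, 0 < n → Λ (Yn n ∩ D) ≤ p * Λ (Yn n) + ∫⁻ q, dormantDeviation P n q.1 (q.2 + s) ∂Λ := by
    intro n hn
    rw [hcond n hn, hYn_mul, ← lintegral_add_right _ (hδm n s)]
    exact lintegral_mono fun q => hind n q (tsub_le_iff_left.1 (le_max_left _ _))
  have h2 : ∀ n, 0 < n → p * Λ (Yn n) ≤ Λ (Yn n ∩ D) + ∫⁻ q, dormantDeviation P n q.1 (q.2 + s) ∂Λ := by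
    intro n hn
    rw [hcond n hn, hYn_mul, ← lintegral_add_right _ (hδm n s)]
    exact lintegral_mono fun q => hind n q (tsub_le_iff_left.1 (le_max_right _ _))
  constructor
  · refine mul_le_mul_right ?_ _
    rw [ENNReal.add_iInf]
    refine le_iInf fun n => ?_
    calc Λ (Y ∩ D) ≤ Λ (Yn n ∩ D) + Λ (lateSet 𝒳 L n) := hle n (by
          filter_upwards [hYYn n] with q hq hl hqU
          exact ⟨(hq hl).1 hqU.1, hqU.2⟩)
      _ ≤ p * Λ (Yn n) + ∫⁻ q, dormantDeviation P n q.1 (q.2 + s) ∂Λ + Λ (lateSet 𝒳 L n) := by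
          gcongr; exact h1 n n.2
      _ ≤ p * (Λ Y + Λ (lateSet 𝒳 L n)) + ∫⁻ q, dormantDeviation P n q.1 (q.2 + s) ∂Λ + Λ (lateSet 𝒳 L n) := by
          gcongr
          exact hle n (by filter_upwards [hYYn n] with q hq hl hqU using (hq hl).2 hqU)
      _ = p * Λ Y + (p * Λ (lateSet 𝒳 L n) + Λ (lateSet 𝒳 L n) + ∫⁻ q, dormantDeviation P n q.1 (q.2 + s) ∂Λ) := by ring
      -- Each of the two exchanges of `Y` and `Yn n` costs one late set, one of them with the factor
      -- `p ≤ 1`; hence the `2` in the error term.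
      _ ≤ p * Λ Y + (1 * Λ (lateSet 𝒳 L n) + Λ (lateSet 𝒳 L n) + ∫⁻ q, dormantDeviation P n q.1 (q.2 + s) ∂Λ) := by gcongr
      _ = _ := by ring
  · refine mul_le_mul_right ?_ _
    rw [ENNReal.add_iInf]
    refine le_iInf fun n => ?_
    calc p * Λ Y ≤ p * (Λ (Yn n) + Λ (lateSet 𝒳 L n)) := by
          gcongr
          exact hle n (by filter_upwards [hYYn n] with q hq hl hqU using (hq hl).1 hqU)
      _ = p * Λ (Yn n) + p * Λ (lateSet 𝒳 L n) := mul_add _ _ _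
      _ ≤ (Λ (Yn n ∩ D) + ∫⁻ q, dormantDeviation P n q.1 (q.2 + s) ∂Λ) + 1 * Λ (lateSet 𝒳 L n) := by
          gcongr; exact h2 n n.2
      _ ≤ (Λ (Y ∩ D) + Λ (lateSet 𝒳 L n) + ∫⁻ q, dormantDeviation P n q.1 (q.2 + s) ∂Λ) + 1 * Λ (lateSet 𝒳 L n) := by
          gcongr
          exact hle n (by
            filter_upwards [hYYn n] with q hq hl hqU
            exact ⟨(hq hl).2 hqU.1, hqU.2⟩)
      _ = _ := by ring

end HasRenewalDensity

end Mixing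

/-! ### The exponential law and its hazard rate -/

section Exponential

variable {α : ℝ}

theorem expMeasure_eq_withDensity (α : ℝ) :
    expMeasure α = volume.withDensity (exponentialPDF α) := rfl

@[fun_prop]
theorem measurable_exponentialPDF (α : ℝ) : Measurable (exponentialPDF α) :=
  (measurable_exponentialPDFReal α).ennreal_ofReal

theorem expMeasure_Ioi (hα : 0 < α) {x : ℝ} (hx : 0 ≤ x) :
    expMeasure α (Ioi x) = ENNReal.ofReal (Real.exp (-(α * x))) := by
  have := isProbabilityMeasure_expMeasure hα
  have h1 : expMeasure α (Iic x) = ENNReal.ofReal (1 - Real.exp (-(α * x))) := by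
    rw [← ofReal_cdf, cdf_expMeasure_eq hα, if_pos hx]
  have h2 : Real.exp (-(α * x)) ≤ 1 := Real.exp_le_one_iff.2 (by nlinarith)
  rw [← compl_Iic, prob_compl_eq_one_sub measurableSet_Iic, h1, ← ENNReal.ofReal_one,
    ← ENNReal.ofReal_sub _ (by linarith)]
  congr 1
  ring

theorem ae_pos_expMeasure (α : ℝ) : ∀ᵐ x ∂expMeasure α, 0 < x := by
  rw [expMeasure_eq_withDensity, ae_withDensity_iff (measurable_exponentialPDF α)]
  filter_upwards [Measure.ae_ne volume (0 : ℝ)] with x hx h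
  by_contra hx'
  exact h (exponentialPDF_of_neg (lt_of_le_of_ne (not_lt.1 hx') hx))

/-- The hazard rate is constant: on `[0, ∞)` the density is `α` times the tail. The bound survives
averaging over the active length, which supplies the domination required of a renewal density. -/
theorem exponentialPDF_le (hα : 0 < α) (x : ℝ) :
    exponentialPDF α x ≤ ENNReal.ofReal α * (if 0 ≤ x then expMeasure α (Ioi x) else 0) := by
  split_ifs with hx
  · rw [exponentialPDF_of_nonneg hx, expMeasure_Ioi hα hx, ENNReal.ofReal_mul hα.le]
  · rw [exponentialPDF_of_neg (not_le.1 hx)]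
    exact zero_le

end Exponential

/-! ### Cycle lengths have a renewal density -/

section CycleLaw

variable {𝒳 : Type*} [MeasurableSpace 𝒳] {α : ℝ} {Ξ : Measure (Ioi (0 : ℝ) × 𝒳)}

theorem isProbabilityMeasure_cycleLaw (hα : 0 < α) [IsProbabilityMeasure Ξ] :
    IsProbabilityMeasure (cycleLaw α Ξ) := by
  have := isProbabilityMeasure_expMeasure hα
  unfold cycleLaw
  infer_instance

theorem lintegral_cycleLaw (hα : 0 < α) [IsProbabilityMeasure Ξ] {g : RenewalCycle 𝒳 → ℝ≥0∞}
    (hg : Measurable g) :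
    ∫⁻ c, g c ∂cycleLaw α Ξ = ∫⁻ y, ∫⁻ d, g (d, y) ∂expMeasure α ∂Ξ := by
  have := isProbabilityMeasure_expMeasure hα
  exact lintegral_prod_symm _ hg.aemeasurable

theorem measure_cycleLaw (hα : 0 < α) [IsProbabilityMeasure Ξ] {B : Set (RenewalCycle 𝒳)}
    (hB : MeasurableSet B) :
    cycleLaw α Ξ B = ∫⁻ y, expMeasure α {d | (d, y) ∈ B} ∂Ξ := by
  have := isProbabilityMeasure_expMeasure hα
  exact Measure.prod_apply_symm hB

theorem ae_pos_cycleLaw (hα : 0 < α) [IsProbabilityMeasure Ξ] :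
    ∀ᵐ c ∂cycleLaw α Ξ, 0 < c.1 := by
  have := isProbabilityMeasure_expMeasure hα
  exact Measure.quasiMeasurePreserving_fst.ae (ae_pos_expMeasure α)

theorem hasRenewalDensity_cycleLaw (hα : 0 < α) [IsProbabilityMeasure Ξ]
    (hmean : ∫⁻ c, ENNReal.ofReal c.duration ∂cycleLaw α Ξ ≠ ∞) :
    HasRenewalDensity (cycleLaw α Ξ)
      (fun t => ∫⁻ y, exponentialPDF α (t - (y.1 : ℝ)) ∂Ξ) α.toNNReal where
  pos := ae_pos_cycleLaw hα
  measurable := Measurable.lintegral_prod_right'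
    (f := fun q : ℝ × (Ioi (0 : ℝ) × 𝒳) => exponentialPDF α (q.1 - (q.2.1 : ℝ))) (by fun_prop)
  map_eq := by
    have hm : Measurable fun q : ℝ × (Ioi (0 : ℝ) × 𝒳) =>
      exponentialPDF α (q.1 - (q.2.1 : ℝ)) := by fun_prop
    refine Measure.ext_of_lintegral _ fun g hg => ?_
    rw [lintegral_map hg measurable_duration, lintegral_cycleLaw hα (by fun_prop),
      lintegral_withDensity_eq_lintegral_mul _ (Measurable.lintegral_prod_right' hm) hg]
    simp_rw [Pi.mul_apply]
    calc _ = ∫⁻ y, (∫⁻ t, exponentialPDF α (t - (y.1 : ℝ)) * g t) ∂Ξ := by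
          refine lintegral_congr fun y => ?_
          rw [expMeasure_eq_withDensity, lintegral_withDensity_eq_lintegral_mul _
            (measurable_exponentialPDF α) (by unfold RenewalCycle.duration; fun_prop),
            ← lintegral_add_right_eq_self
              (fun t => exponentialPDF α (t - (y.1 : ℝ)) * g t) (y.1 : ℝ)]
          simp only [add_sub_cancel_right, Pi.mul_apply, RenewalCycle.duration]
      _ = _ := by
          rw [lintegral_lintegral_swap (by fun_prop)]
          exact lintegral_congr fun t => lintegral_mul_const _ (by fun_prop)
  -- For an active length `y ≤ x`, the tail of the dormant length beyond `x - y` is part of the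
  -- event that the cycle outlasts `x`; for `y > x` the density vanishes.
  le_survival x := by
    have hB : MeasurableSet {c : RenewalCycle 𝒳 | 0 ≤ x ∧ x < c.duration} :=
      measurableSet_mem_Ico (by fun_prop) (by fun_prop) (by fun_prop)
    have := isProbabilityMeasure_cycleLaw (Ξ := Ξ) hα
    have hm : Measurable fun y : Ioi (0 : ℝ) × 𝒳 =>
        expMeasure α {d | (d, y) ∈ {c : RenewalCycle 𝒳 | 0 ≤ x ∧ x < c.duration}} :=
      have := isProbabilityMeasure_expMeasure hα
      measurable_measure_prodMk_right hB
    rw [survival, measure_cycleLaw hα hB, ← lintegral_const_mul _ hm]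
    refine lintegral_mono fun y => (exponentialPDF_le hα _).trans ?_
    change ENNReal.ofReal α * _ ≤ ENNReal.ofReal α * _
    gcongr
    split_ifs with h
    · have hy : (0 : ℝ) < y.1 := y.1.2
      refine measure_mono fun d hd => ⟨by linarith, ?_⟩
      have hd' : x - (y.1 : ℝ) < d := hd
      change x < d + (y.1 : ℝ)
      linarith
    · exact zero_le
  -- Active lengths up to some integer `n` have positive mass, and each of them contributes a
  -- positive exponential density at every `t > n`.
  ne_zero := by
    have hex : ∃ n : ℕ, Ξ {y | (y.1 : ℝ) ≤ n} ≠ 0 := by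
      by_contra hcon
      push Not at hcon
      have h0 : Ξ (⋃ n : ℕ, {y : Ioi (0 : ℝ) × 𝒳 | (y.1 : ℝ) ≤ n}) = 0 :=
        measure_iUnion_null hcon
      have hu : ⋃ n : ℕ, {y : Ioi (0 : ℝ) × 𝒳 | (y.1 : ℝ) ≤ n} = univ :=
        eq_univ_of_forall fun y => mem_iUnion.2 (exists_nat_ge (y.1 : ℝ))
      rw [hu, measure_univ] at h0
      exact one_ne_zero h0
    obtain ⟨n, hn⟩ := hex
    refine ⟨n, fun t ht h0 => hn ?_⟩
    rw [lintegral_eq_zero_iff (by fun_prop)] at h0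
    refine measure_mono_null (fun y hy => ?_) (show Ξ {y | ¬ _} = 0 from h0)
    have hy' : (y.1 : ℝ) ≤ n := hy
    simp only [Pi.zero_apply, Set.mem_ofPred_eq]
    exact (ENNReal.ofReal_pos.2 (exponentialPDFReal_pos hα (by linarith))).ne'
  mean_ne_top := hmean

end CycleLaw

/-! ### Tilting the law of a cycle -/

section Tilting

variable {𝒳 : Type*} [MeasurableSpace 𝒳] {α lam : ℝ} {Ξ : Measure (Ioi (0 : ℝ) × 𝒳)}
  {E : 𝒳 → EReal}

/-- The density `e^{-λ T - E(χ)}` of the tilted law of a cycle. -/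
noncomputable def cycleWeight (lam : ℝ) (E : 𝒳 → EReal) (c : RenewalCycle 𝒳) : ℝ≥0∞ :=
  EReal.exp (((-(lam * c.duration) : ℝ) : EReal) - E c.2.2)

/-- The density of the tilted law of the active period and its state. -/
noncomputable def activeWeight (lam : ℝ) (E : 𝒳 → EReal) (y : Ioi (0 : ℝ) × 𝒳) : ℝ≥0∞ :=
  EReal.exp (((-(lam * (y.1 : ℝ)) : ℝ) : EReal) - E y.2)

theorem measurable_activeWeight (hE : Measurable E) (lam : ℝ) :
    Measurable (activeWeight lam E) := by
  unfold activeWeight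
  simp_rw [sub_eq_add_neg]
  fun_prop

theorem measurable_cycleWeight (hE : Measurable E) (lam : ℝ) :
    Measurable (cycleWeight lam E) := by
  unfold cycleWeight
  simp_rw [sub_eq_add_neg]
  fun_prop

theorem cycleWeight_eq (lam : ℝ) (E : 𝒳 → EReal) (c : RenewalCycle 𝒳) :
    cycleWeight lam E c = ENNReal.ofReal (Real.exp (-(lam * c.1))) * activeWeight lam E c.2 := by
  rw [cycleWeight, activeWeight, sub_eq_add_neg, sub_eq_add_neg, EReal.exp_add, EReal.exp_add,
    EReal.exp_coe, EReal.exp_coe, ← mul_assoc, ← ENNReal.ofReal_mul (Real.exp_nonneg _),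
    ← Real.exp_add, RenewalCycle.duration]
  congr 4
  ring

theorem cycleWeight_mul_exp (lam : ℝ) (E : 𝒳 → EReal) (c : RenewalCycle 𝒳) :
    cycleWeight lam E c * ENNReal.ofReal (Real.exp (lam * c.duration)) = EReal.exp (-E c.2.2) := by
  rw [cycleWeight, sub_eq_add_neg, EReal.exp_add, EReal.exp_coe, mul_right_comm,
    ← ENNReal.ofReal_mul (Real.exp_nonneg _), ← Real.exp_add]
  simp

theorem lintegral_cycleWeight (hα : 0 < α) [IsProbabilityMeasure Ξ] (hE : Measurable E) :
    ∫⁻ c, cycleWeight lam E c ∂cycleLaw α Ξ =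
      (∫⁻ d, ENNReal.ofReal (Real.exp (-(lam * d))) ∂expMeasure α) *
        ∫⁻ y, activeWeight lam E y ∂Ξ := by
  have := isProbabilityMeasure_expMeasure hα
  simp_rw [cycleWeight_eq]
  exact lintegral_prod_mul (f := fun d => ENNReal.ofReal (Real.exp (-(lam * d))))
    (g := activeWeight lam E) (by fun_prop) (measurable_activeWeight hE lam).aemeasurable

/-- If `α + lam ≤ 0`, the tilted exponential density is at least `α` on `[0, ∞)`, so the dormant
factor of the integral is infinite. Its product with the active factor is then `0` or `∞`, never
`1`. -/
theorem rate_pos (hα : 0 < α) [IsProbabilityMeasure Ξ] (hE : Measurable E)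
    (hlam : ∫⁻ c, cycleWeight lam E c ∂cycleLaw α Ξ = 1) : 0 < α + lam := by
  by_contra hneg
  push Not at hneg
  rw [lintegral_cycleWeight hα hE] at hlam
  have htop : ∫⁻ d, ENNReal.ofReal (Real.exp (-(lam * d))) ∂expMeasure α = ∞ := by
    rw [expMeasure_eq_withDensity, lintegral_withDensity_eq_lintegral_mul _
      (measurable_exponentialPDF α) (by fun_prop), ← top_le_iff]
    calc ∞ = ENNReal.ofReal α * volume (Ici (0 : ℝ)) := by
          rw [Real.volume_Ici, ENNReal.mul_top (by simpa using hα)]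
      _ = ∫⁻ d in Ici (0 : ℝ), ENNReal.ofReal α := by simp
      _ ≤ ∫⁻ d in Ici (0 : ℝ), (exponentialPDF α *
          fun d => ENNReal.ofReal (Real.exp (-(lam * d)))) d := by
          refine setLIntegral_mono' measurableSet_Ici fun d hd => ?_
          have hd0 : 0 ≤ d := hd
          rw [Pi.mul_apply, exponentialPDF_of_nonneg hd0,
            ← ENNReal.ofReal_mul (by positivity), mul_assoc, ← Real.exp_add]
          refine ENNReal.ofReal_le_ofReal (le_mul_of_one_le_right hα.le (Real.one_le_exp ?_))
          nlinarith
      _ ≤ _ := setLIntegral_le_lintegral _ _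
  rw [htop] at hlam
  by_cases h0 : ∫⁻ y, activeWeight lam E y ∂Ξ = 0
  · simp [h0] at hlam
  · simp [ENNReal.top_mul h0] at hlam

theorem withDensity_expMeasure (hα : 0 < α) (hr : 0 < α + lam) :
    (expMeasure α).withDensity (fun d => ENNReal.ofReal (Real.exp (-(lam * d)))) =
      ENNReal.ofReal (α / (α + lam)) • expMeasure (α + lam) := by
  rw [expMeasure_eq_withDensity, expMeasure_eq_withDensity, ← withDensity_mul _
    (measurable_exponentialPDF α) (by fun_prop), ← withDensity_smul _
    (measurable_exponentialPDF _)]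
  congr 1
  funext d
  rw [Pi.mul_apply, Pi.smul_apply, smul_eq_mul]
  rcases lt_or_ge d 0 with hd | hd
  · rw [exponentialPDF_of_neg hd, exponentialPDF_of_neg hd, zero_mul, mul_zero]
  · rw [exponentialPDF_of_nonneg hd, exponentialPDF_of_nonneg hd,
      ← ENNReal.ofReal_mul (by positivity), ← ENNReal.ofReal_mul (by positivity), mul_assoc,
      ← Real.exp_add, ← mul_assoc, div_mul_cancel₀ _ hr.ne']
    congr 3
    ring

theorem tiltedLaw_eq (α lam : ℝ) (Ξ : Measure (Ioi (0 : ℝ) × 𝒳)) (E : 𝒳 → EReal) :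
    tiltedLaw α lam Ξ E =
      ENNReal.ofReal (α / (α + lam)) • Ξ.withDensity (activeWeight lam E) := rfl

/-- The weight is a product of a function of the dormant length and one of the active period. The
first factor turns `Exp(α)` into `α / (α + lam)` times `Exp(α + lam)`, and this constant is the one
built into `tiltedLaw`. -/
theorem cycleLaw_tiltedLaw (hα : 0 < α) (hr : 0 < α + lam) [IsProbabilityMeasure Ξ]
    (hE : Measurable E) :
    cycleLaw (α + lam) (tiltedLaw α lam Ξ E) =
      (cycleLaw α Ξ).withDensity (cycleWeight lam E) := by
  have := isProbabilityMeasure_expMeasure hα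
  have := isProbabilityMeasure_expMeasure hr
  have h1 : (cycleLaw α Ξ).withDensity (cycleWeight lam E) =
      ((expMeasure α).withDensity fun d => ENNReal.ofReal (Real.exp (-(lam * d)))).prod
        (Ξ.withDensity (activeWeight lam E)) := by
    rw [prod_withDensity (by fun_prop) (measurable_activeWeight hE lam), cycleLaw]
    congr 1
    funext c
    exact cycleWeight_eq lam E c
  rw [h1, withDensity_expMeasure hα hr, Measure.prod_smul_left, cycleLaw, tiltedLaw_eq,
    Measure.prod_smul_right]

theorem isProbabilityMeasure_tiltedLaw (hα : 0 < α) [IsProbabilityMeasure Ξ] (hE : Measurable E)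
    (hlam : ∫⁻ c, cycleWeight lam E c ∂cycleLaw α Ξ = 1) :
    IsProbabilityMeasure (tiltedLaw α lam Ξ E) := by
  have hr := rate_pos hα hE hlam
  have := isProbabilityMeasure_expMeasure hr
  constructor
  rw [lintegral_cycleWeight hα hE] at hlam
  have h1 : ∫⁻ d, ENNReal.ofReal (Real.exp (-(lam * d))) ∂expMeasure α =
      ENNReal.ofReal (α / (α + lam)) := by
    have := congrArg (fun m : Measure ℝ => m univ) (withDensity_expMeasure (lam := lam) hα hr)
    simpa using this
  rw [tiltedLaw_eq, Measure.smul_apply, withDensity_apply _ .univ, Measure.restrict_univ,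
    smul_eq_mul, ← h1, hlam]

end Tilting

/-! ### Change of measure on finitely many cycles -/

section FirstCycles

/-- A change of the law of the first `n` members of an i.i.d. sequence. -/
theorem lintegral_infinitePi_withDensity {C : Type*} [MeasurableSpace C] {P P' : Measure C}
    [IsProbabilityMeasure P] [IsProbabilityMeasure P'] {w : C → ℝ≥0∞} (hw : Measurable w)
    (hP' : P' = P.withDensity w) (n : ℕ) {G : (ℕ → C) → ℝ≥0∞} (hG : Measurable G)
    (hn : ∀ c c' : ℕ → C, (∀ k < n, c k = c' k) → G c = G c') :
    ∫⁻ c, G c ∂(Measure.infinitePi fun _ : ℕ => P') =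
      ∫⁻ c, (∏ k ∈ Finset.range n, w (c k)) * G c ∂(Measure.infinitePi fun _ : ℕ => P) := by
  induction n generalizing G with
  | zero =>
    obtain ⟨x⟩ : Nonempty C := P.nonempty_of_neZero
    have h : ∀ c, G c = G fun _ => x := fun c => hn _ _ (by simp)
    simp_rw [h]
    simp
  | succ n ih =>
    have hm : Measurable fun q : C × (ℕ → C) => splice 1 (fun _ : ℕ => q.1) q.2 :=
      (measurable_splice 1).comp (f := fun q : C × (ℕ → C) => ((fun _ : ℕ => q.1), q.2))
        (by fun_prop)
    have hGm : ∀ x, Measurable fun c' => G (splice 1 (fun _ => x) c') := fun x =>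
      hG.comp (hm.comp (measurable_const.prodMk measurable_id))
    rw [lintegral_infinitePi_cons P' hG, lintegral_infinitePi_cons P
      (g := fun c => (∏ k ∈ Finset.range (n + 1), w (c k)) * G c) (by fun_prop)]
    -- With the first member fixed at `x`, the integrand depends on only `n` further members, so the
    -- induction hypothesis applies.
    have e : ∀ x, ∫⁻ c', G (splice 1 (fun _ => x) c') ∂(Measure.infinitePi fun _ : ℕ => P') =
        ∫⁻ c', (∏ k ∈ Finset.range n, w (c' k)) * G (splice 1 (fun _ => x) c')
          ∂(Measure.infinitePi fun _ : ℕ => P) := fun x => by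
      refine ih (hGm x) fun c c' h => hn _ _ fun k hk => ?_
      rcases Nat.eq_zero_or_pos k with rfl | hk0
      · simp [splice]
      · obtain ⟨j, rfl⟩ := Nat.exists_eq_add_of_le hk0
        rw [splice_add, splice_add]
        exact h j (by omega)
    simp_rw [e]
    have hI : Measurable fun x => ∫⁻ c', (∏ k ∈ Finset.range n, w (c' k)) *
        G (splice 1 (fun _ => x) c') ∂(Measure.infinitePi fun _ : ℕ => P) :=
      Measurable.lintegral_prod_right' (f := fun q : C × (ℕ → C) =>
        (∏ k ∈ Finset.range n, w (q.2 k)) * G (splice 1 (fun _ => q.1) q.2))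
        (by fun_prop)
    conv_lhs => rw [hP']
    rw [lintegral_withDensity_eq_lintegral_mul _ hw hI]
    refine lintegral_congr fun x => ?_
    rw [Pi.mul_apply, ← lintegral_const_mul _ (by have := hGm x; fun_prop)]
    refine lintegral_congr fun c' => ?_
    have h1 : ∀ k, splice 1 (fun _ => x) c' (k + 1) = c' k := fun k => by
      rw [add_comm, splice_add]
    rw [Finset.prod_range_succ']
    simp_rw [h1]
    rw [splice_of_lt one_pos, mul_comm (∏ k ∈ _, _) (w x), mul_assoc]

variable {𝒳 : Type*} [MeasurableSpace 𝒳] {α : ℝ} {Ξ : Measure (Ioi (0 : ℝ) × 𝒳)}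

/-- The dormant length of cycle `n` is independent of the first `n` cycles; integrating it out
leaves the exponential tail at the time elapsed since `S_n`. -/
theorem lintegral_dormant_cycle (hα : 0 < α) [IsProbabilityMeasure Ξ] (n : ℕ) (u : ℝ)
    {G : (ℕ → RenewalCycle 𝒳) → ℝ≥0∞} (hG : Measurable G)
    (hn : ∀ c c' : ℕ → RenewalCycle 𝒳, (∀ k < n, c k = c' k) → G c = G c') :
    ∫⁻ c, (Ico (cycleStart c n) (cycleStart c n + (c n).1)).indicator 1 u * G c
        ∂iidLaw (cycleLaw α Ξ) =
      ∫⁻ c, (if cycleStart c n ≤ u then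
        ENNReal.ofReal (Real.exp (-(α * (u - cycleStart c n)))) else 0) * G c
        ∂iidLaw (cycleLaw α Ξ) := by
  have := isProbabilityMeasure_cycleLaw (Ξ := Ξ) hα
  have := isProbabilityMeasure_expMeasure hα
  have hm : Measurable fun c : ℕ → RenewalCycle 𝒳 =>
      (Ico (cycleStart c n) (cycleStart c n + (c n).1)).indicator (1 : ℝ → ℝ≥0∞) u * G c :=
    (measurable_indicator_Ico (by fun_prop) (by fun_prop) (by fun_prop)).mul hG
  rw [lintegral_infinitePi_splice _ n hm]
  refine lintegral_congr fun c => ?_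
  have e1 : ∀ c', cycleStart (splice n c c') n = cycleStart c n := fun c' =>
    cycleStart_congr fun k hk => splice_of_lt hk _ _
  have e2 : ∀ c', G (splice n c c') = G c := fun c' => hn _ _ fun k hk => splice_of_lt hk _ _
  have e3 : ∀ c', splice n c c' n = c' 0 := fun c' => by simpa using splice_add n 0 c c'
  simp_rw [e1, e2, e3]
  have hi : Measurable fun x : RenewalCycle 𝒳 =>
      (Ico (cycleStart c n) (cycleStart c n + x.1)).indicator (1 : ℝ → ℝ≥0∞) u :=
    measurable_indicator_Ico (by fun_prop) (by fun_prop) (by fun_prop)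
  have hi0 : Measurable fun c' : ℕ → RenewalCycle 𝒳 =>
      (Ico (cycleStart c n) (cycleStart c n + (c' 0).1)).indicator (1 : ℝ → ℝ≥0∞) u :=
    hi.comp (measurable_pi_apply 0)
  rw [lintegral_mul_const _ hi0, lintegral_infinitePi_eval _ 0 hi]
  congr 1
  split_ifs with h
  · have : ∀ x : RenewalCycle 𝒳,
        (Ico (cycleStart c n) (cycleStart c n + x.1)).indicator (1 : ℝ → ℝ≥0∞) u =
          (Ioi (u - cycleStart c n)).indicator (1 : ℝ → ℝ≥0∞) x.1 := fun x => by
      simp only [indicator, mem_Ico, mem_Ioi, h, true_and, sub_lt_iff_lt_add', Pi.one_apply]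
    simp_rw [this]
    rw [cycleLaw, lintegral_prod _ (by
      exact ((measurable_one.indicator measurableSet_Ioi).comp measurable_fst).aemeasurable)]
    simp only [lintegral_const, measure_univ, mul_one]
    rw [lintegral_indicator_one measurableSet_Ioi, expMeasure_Ioi hα (sub_nonneg.2 h)]
  · have : ∀ x : RenewalCycle 𝒳,
        (Ico (cycleStart c n) (cycleStart c n + x.1)).indicator (1 : ℝ → ℝ≥0∞) u = 0 := fun x =>
      indicator_of_notMem (fun hx => h hx.1) _
    simp [this]

end FirstCycles

/-! ### The energy of the first cycles -/

section Energy

variable {𝒳 : Type*} [MeasurableSpace 𝒳] {E : 𝒳 → EReal}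

theorem measurable_hamiltonian (hE : Measurable E) : Measurable (hamiltonian E) := by
  have h : ∀ f : Triangle × 𝒳 → ℝ≥0∞, Measurable f →
      Measurable fun ζ : PointMeasure (Triangle × 𝒳) => ∫⁻ q, f q ∂ζ.1 := fun f hf =>
    (Measure.measurable_lintegral hf).comp measurable_subtype_coe
  unfold hamiltonian
  simp_rw [sub_eq_add_neg]
  have h1 := h (fun q => (E q.2).toENNReal) (by fun_prop)
  have h2 := h (fun q => (-E q.2).toENNReal) (by fun_prop)
  fun_prop

/-- No factor `exp (f i)` is infinite, so inverses distribute over the product even when some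
factors are zero, that is, `f i = ⊥`. -/
theorem exp_neg_sum {ι : Type*} (s : Finset ι) {f : ι → EReal} (hf : ∀ i, f i ≠ ⊤) :
    EReal.exp (-∑ i ∈ s, f i) = ∏ i ∈ s, EReal.exp (-f i) := by
  classical
  have h : ∀ s : Finset ι, EReal.exp (∑ i ∈ s, f i) = ∏ i ∈ s, EReal.exp (f i) := fun s => by
    induction s using Finset.induction_on with
    | empty => simp
    | insert i s hi ih => rw [Finset.sum_insert hi, Finset.prod_insert hi, EReal.exp_add, ih]
  simp_rw [EReal.exp_neg]
  rw [h, ENNReal.prod_inv_distrib]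
  intro i _ j _ _
  exact Or.inr (by simpa using hf j)

/-- The factors `exp(-λT)` in the weights are compensated by `exp(λ S_n)`, which later combines with
the tail of the unfinished dormant period. -/
theorem exp_neg_hamiltonian_firstCycles (hE : Measurable E) (hE_top : ∀ x, E x ≠ ⊤) (lam u : ℝ)
    (n : ℕ) (c : ℕ → RenewalCycle 𝒳) :
    EReal.exp (-hamiltonian E (shift u (firstCycles n c))) =
      (∏ k ∈ Finset.range n, cycleWeight lam E (c k)) *
        ENNReal.ofReal (Real.exp (lam * cycleStart c n)) := by
  rw [firstCycles, shift_ofPoints, hamiltonian_ofPoints hE hE_top, exp_neg_sum _ fun _ => hE_top _]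
  have h : ENNReal.ofReal (Real.exp (lam * cycleStart c n)) =
      ∏ k ∈ Finset.range n, ENNReal.ofReal (Real.exp (lam * (c k).duration)) := by
    rw [cycleStart, Finset.mul_sum, Real.exp_sum,
      ENNReal.ofReal_prod_of_nonneg fun _ _ => Real.exp_nonneg _]
  rw [h, ← Finset.prod_mul_distrib, ← Fin.prod_univ_eq_prod_range
    (fun k => cycleWeight lam E (c k) * ENNReal.ofReal (Real.exp (lam * (c k).duration)))]
  refine Finset.prod_congr rfl fun k _ => ?_
  rw [cycleWeight_mul_exp]
  rfl

/-- On the event that the `n`-th cycle is dormant at time `2t`, the restriction of the process to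
`[0, 2t]` consists of the first `n` cycles. -/
theorem restrictTo_shift_alternating_of_dormant [MeasurableSingletonClass 𝒳] {t : ℝ} (ht : 0 < t)
    {n : ℕ} {c : ℕ → RenewalCycle 𝒳} (hc : ∀ k, 0 < (c k).1) (h1 : cycleStart c n ≤ 2 * t)
    (h2 : 2 * t < cycleStart c n + (c n).1) :
    restrictTo (Icc (-t) t) (shift t (alternating c)) = shift t (firstCycles n c) := by
  rw [restrictTo_Icc_shift_alternating hc (by linarith) (n := n) (by linarith)]
  refine Subtype.ext ?_
  refine Measure.restrict_eq_self_of_ae_mem ?_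
  rw [firstCycles, shift_ofPoints]
  simp_rw [shiftPoint_interval]
  refine (ofPoints_apply_eq_zero _ (measurableSet_hitting_Icc (by linarith)).compl).2 fun k => ?_
  rw [notMem_compl_iff, hitting_Icc (by linarith)]
  have h3 : cycleStart c (k + 1) ≤ cycleStart c n := (cycleStart_mono hc).monotone k.2
  have h4 : 0 ≤ cycleStart c k := by
    simpa using (cycleStart_mono hc).monotone (Nat.zero_le (k : ℕ))
  rw [cycleStart_succ] at h3
  have h5 : (c k).duration = (c k).1 + ((c k).2.1 : ℝ) := rfl
  have h6 : (0 : ℝ) < (c k).2.1 := (c k).2.1.2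
  have h7 := hc k
  refine ⟨?_, ?_⟩
  · rw [interval_fst]
    linarith
  · rw [interval_snd]
    linarith

end Energy

/-! ### The Gibbs measure as a conditioned tilted process -/

section Gibbs

variable {𝒳 : Type*} [MeasurableSpace 𝒳] [MeasurableSingletonClass 𝒳] {α lam : ℝ}
  {Ξ : Measure (Ioi (0 : ℝ) × 𝒳)} {E : 𝒳 → EReal}

theorem measurable_restrictTo_shift (t : ℝ) (ht : 0 < t) :
    Measurable fun ζ : PointMeasure (Triangle × 𝒳) => restrictTo (Icc (-t) t) (shift t ζ) :=
  (measurable_restrictTo (measurableSet_hitting_Icc (by linarith))).comp (measurable_shift t)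

/-- The sum is over the number `n` of cycles completed by time `2t`. On the corresponding event the
window contains exactly these cycles, and the current dormant period is integrated out. -/
theorem setLIntegral_dormantAt (hα : 0 < α) [IsProbabilityMeasure Ξ] {t : ℝ} (ht : 0 < t)
    {Ψ : PointMeasure (Triangle × 𝒳) → ℝ≥0∞} (hΨ : Measurable Ψ) :
    ∫⁻ c in alternating ⁻¹' dormantAt 𝒳 (2 * t), Ψ (restrictTo (Icc (-t) t) (shift t (alternating c)))
        ∂iidLaw (cycleLaw α Ξ) =
      ∑' n, ∫⁻ c, (if cycleStart c n ≤ 2 * t then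
        ENNReal.ofReal (Real.exp (-(α * (2 * t - cycleStart c n)))) else 0) *
          Ψ (shift t (firstCycles n c)) ∂iidLaw (cycleLaw α Ξ) := by
  have := isProbabilityMeasure_cycleLaw (Ξ := Ξ) hα
  have hD : MeasurableSet (alternating ⁻¹' dormantAt 𝒳 (2 * t)) :=
    measurable_alternating (measurableSet_dormantAt _)
  have hm : Measurable fun c : ℕ → RenewalCycle 𝒳 =>
      Ψ (restrictTo (Icc (-t) t) (shift t (alternating c))) :=
    hΨ.comp ((measurable_restrictTo_shift t ht).comp measurable_alternating)
  rw [← lintegral_indicator hD,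
    lintegral_eq_tsum_cycle (ae_pos_cycleLaw hα) (u := 2 * t) (by linarith) (hm.indicator hD)]
  refine tsum_congr fun n => ?_
  have hf : Measurable fun c : ℕ → RenewalCycle 𝒳 => shift t (firstCycles n c) :=
    (measurable_shift_firstCycles n).comp (measurable_id.prodMk measurable_const)
  rw [← lintegral_dormant_cycle hα n (2 * t) (G := fun c => Ψ (shift t (firstCycles n c)))
    (hΨ.comp hf) fun c c' h => by rw [firstCycles_congr h]]
  refine lintegral_congr_ae ?_
  filter_upwards [ae_pos (ae_pos_cycleLaw hα)] with c hc
  have hd : (c n).duration = (c n).1 + ((c n).2.1 : ℝ) := rfl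
  have ha : (0 : ℝ) < (c n).2.1 := (c n).2.1.2
  by_cases h : 2 * t ∈ Ico (cycleStart c n) (cycleStart c (n + 1))
  · by_cases h' : 2 * t < cycleStart c n + (c n).1
    · have hmem : c ∈ alternating ⁻¹' dormantAt 𝒳 (2 * t) :=
        (alternating_mem_dormantAt_iff hc h.1 h.2).2 h'
      rw [indicator_of_mem h, indicator_of_mem hmem, indicator_of_mem (show _ ∈ Ico _ _ from ⟨h.1, h'⟩),
        restrictTo_shift_alternating_of_dormant ht hc h.1 h']
    · have hmem : c ∉ alternating ⁻¹' dormantAt 𝒳 (2 * t) := fun hx =>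
        h' ((alternating_mem_dormantAt_iff hc h.1 h.2).1 hx)
      rw [indicator_of_notMem hmem,
        indicator_of_notMem (show _ ∉ Ico _ _ from fun hx => h' hx.2), mul_zero, zero_mul]
  · rw [indicator_of_notMem h, indicator_of_notMem (show _ ∉ Ico _ _ from fun hx => h
      ⟨hx.1, hx.2.trans (by rw [cycleStart_succ, hd]; linarith)⟩), zero_mul, zero_mul]

/-- The series for the two parameter sets agree term by term after the change of measure, up to a
factor that depends neither on `n` nor on the path. -/
theorem setLIntegral_dormantAt_exp_hamiltonian (hα : 0 < α) (hr : 0 < α + lam)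
    [IsProbabilityMeasure Ξ] [IsProbabilityMeasure (tiltedLaw α lam Ξ E)]
    (hE : Measurable E) (hE_top : ∀ x, E x ≠ ⊤) {t : ℝ} (ht : 0 < t)
    {Ψ : PointMeasure (Triangle × 𝒳) → ℝ≥0∞} (hΨ : Measurable Ψ) :
    ∫⁻ c in alternating ⁻¹' dormantAt 𝒳 (2 * t),
        (EReal.exp (-hamiltonian E (restrictTo (Icc (-t) t) (shift t (alternating c)))) *
          Ψ (restrictTo (Icc (-t) t) (shift t (alternating c)))) ∂iidLaw (cycleLaw α Ξ) =
      ENNReal.ofReal (Real.exp (lam * (2 * t))) *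
        ∫⁻ c in alternating ⁻¹' dormantAt 𝒳 (2 * t),
          Ψ (restrictTo (Icc (-t) t) (shift t (alternating c)))
            ∂iidLaw (cycleLaw (α + lam) (tiltedLaw α lam Ξ E)) := by
  have := isProbabilityMeasure_cycleLaw (Ξ := Ξ) hα
  have := isProbabilityMeasure_cycleLaw (Ξ := tiltedLaw α lam Ξ E) hr
  have hH := measurable_hamiltonian hE
  rw [setLIntegral_dormantAt hr ht hΨ, setLIntegral_dormantAt hα ht
    (Ψ := fun ζ => EReal.exp (-hamiltonian E ζ) * Ψ ζ) (by fun_prop), ← ENNReal.tsum_mul_left]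
  refine tsum_congr fun n => ?_
  have hf : Measurable fun c : ℕ → RenewalCycle 𝒳 => shift t (firstCycles n c) :=
    (measurable_shift_firstCycles n).comp (measurable_id.prodMk measurable_const)
  have hw : Measurable fun c : ℕ → RenewalCycle 𝒳 => (if cycleStart c n ≤ 2 * t then
      ENNReal.ofReal (Real.exp (-((α + lam) * (2 * t - cycleStart c n)))) else 0) *
        Ψ (shift t (firstCycles n c)) :=
    (Measurable.ite (measurableSet_le (measurable_cycleStart n) measurable_const) (by fun_prop)
      measurable_const).mul (hΨ.comp hf)
  have hw' : Measurable fun c : ℕ → RenewalCycle 𝒳 =>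
      ∏ k ∈ Finset.range n, cycleWeight lam E (c k) := by
    have := measurable_cycleWeight hE lam
    fun_prop
  have hw'' : Measurable fun c : ℕ → RenewalCycle 𝒳 =>
      (∏ k ∈ Finset.range n, cycleWeight lam E (c k)) * ((if cycleStart c n ≤ 2 * t then
        ENNReal.ofReal (Real.exp (-((α + lam) * (2 * t - cycleStart c n)))) else 0) *
          Ψ (shift t (firstCycles n c))) := hw'.mul hw
  rw [lintegral_infinitePi_withDensity (measurable_cycleWeight hE lam)
    (cycleLaw_tiltedLaw hα hr hE) n hw fun c c' h => by
      rw [cycleStart_congr h, firstCycles_congr h],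
    ← lintegral_const_mul _ hw'']
  refine lintegral_congr fun c => ?_
  rw [exp_neg_hamiltonian_firstCycles hE hE_top lam]
  split_ifs with h
  · have e : ENNReal.ofReal (Real.exp (-(α * (2 * t - cycleStart c n)))) *
        ENNReal.ofReal (Real.exp (lam * cycleStart c n)) =
        ENNReal.ofReal (Real.exp (lam * (2 * t))) *
          ENNReal.ofReal (Real.exp (-((α + lam) * (2 * t - cycleStart c n)))) := by
      rw [← ENNReal.ofReal_mul (Real.exp_nonneg _), ← ENNReal.ofReal_mul (Real.exp_nonneg _),
        ← Real.exp_add, ← Real.exp_add]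
      congr 2
      ring
    calc _ = (ENNReal.ofReal (Real.exp (-(α * (2 * t - cycleStart c n)))) *
          ENNReal.ofReal (Real.exp (lam * cycleStart c n))) *
          ((∏ k ∈ Finset.range n, cycleWeight lam E (c k)) * Ψ (shift t (firstCycles n c))) := by
          ring
      _ = _ := by
          rw [e]
          ring
  · simp

/-- Already the term `n = 0` is positive: the first dormant period may outlast `2t`. -/
theorem dormantProb_ne_zero (hα : 0 < α) [IsProbabilityMeasure Ξ] {t : ℝ} (ht : 0 < t) :
    dormantProb (cycleLaw α Ξ) (2 * t) ≠ 0 := by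
  have := isProbabilityMeasure_cycleLaw (Ξ := Ξ) hα
  have h := setLIntegral_dormantAt (Ξ := Ξ) hα ht (Ψ := fun _ => 1) measurable_const
  rw [setLIntegral_one] at h
  change iidLaw (cycleLaw α Ξ) (alternating ⁻¹' dormantAt 𝒳 (2 * t)) ≠ 0
  rw [h]
  intro h0
  have h1 := ENNReal.tsum_eq_zero.1 h0 0
  simp only [cycleStart_zero, mul_one, lintegral_const, measure_univ] at h1
  rw [if_pos (by linarith)] at h1
  exact (ENNReal.ofReal_pos.2 (Real.exp_pos _)).ne' h1

theorem lintegral_referenceLaw {t : ℝ} (ht : 0 < t)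
    {Ψ : PointMeasure (Triangle × 𝒳) → ℝ≥0∞} (hΨ : Measurable Ψ) :
    ∫⁻ ζ, Ψ ζ ∂referenceLaw α Ξ t = (dormantProb (cycleLaw α Ξ) (2 * t))⁻¹ *
      ∫⁻ c in alternating ⁻¹' dormantAt 𝒳 (2 * t),
        Ψ (restrictTo (Icc (-t) t) (shift t (alternating c))) ∂iidLaw (cycleLaw α Ξ) := by
  have hD := measurableSet_dormantAt (𝒳 := 𝒳) (2 * t)
  rw [referenceLaw, lintegral_map hΨ (measurable_restrictTo_shift t ht), ProbabilityTheory.cond,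
    lintegral_smul_measure, alternatingLaw, Measure.restrict_map measurable_alternating hD,
    lintegral_map (f := fun ζ => Ψ (restrictTo (Icc (-t) t) (shift t ζ)))
      (hΨ.comp (measurable_restrictTo_shift t ht)) measurable_alternating,
    Measure.map_apply measurable_alternating hD]
  rfl

theorem isProbabilityMeasure_referenceLaw (hα : 0 < α) [IsProbabilityMeasure Ξ] {t : ℝ}
    (ht : 0 < t) : IsProbabilityMeasure (referenceLaw α Ξ t) := by
  have := isProbabilityMeasure_cycleLaw (Ξ := Ξ) hα
  constructor
  have h := lintegral_referenceLaw (α := α) (Ξ := Ξ) ht (Ψ := fun _ => 1) measurable_const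
  rw [lintegral_one, setLIntegral_one] at h
  rw [h]
  exact ENNReal.inv_mul_cancel (dormantProb_ne_zero hα ht) (measure_ne_top _ _)

/-- The Gibbs measure is the law of the process with tilted cycles, given that it is dormant. -/
theorem gibbsLaw_eq_referenceLaw (hα : 0 < α) (hr : 0 < α + lam)
    [IsProbabilityMeasure Ξ] [IsProbabilityMeasure (tiltedLaw α lam Ξ E)]
    (hE : Measurable E) (hE_top : ∀ x, E x ≠ ⊤) {t : ℝ} (ht : 0 < t) :
    gibbsLaw α Ξ E t = referenceLaw (α + lam) (tiltedLaw α lam Ξ E) t := by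
  have := isProbabilityMeasure_cycleLaw (Ξ := Ξ) hα
  have := isProbabilityMeasure_cycleLaw (Ξ := tiltedLaw α lam Ξ E) hr
  have := isProbabilityMeasure_referenceLaw (Ξ := tiltedLaw α lam Ξ E) hr ht
  have hH := measurable_hamiltonian hE
  -- Proportionality with a finite positive constant is enough: the choice `Ψ = 1` identifies `K`
  -- with the partition function, which is thereby finite and nonzero.
  obtain ⟨K, hK0, hKt, hK⟩ : ∃ K : ℝ≥0∞, K ≠ 0 ∧ K ≠ ∞ ∧
      ∀ Ψ : PointMeasure (Triangle × 𝒳) → ℝ≥0∞, Measurable Ψ →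
        ∫⁻ ζ, EReal.exp (-hamiltonian E ζ) * Ψ ζ ∂referenceLaw α Ξ t =
          K * ∫⁻ ζ, Ψ ζ ∂referenceLaw (α + lam) (tiltedLaw α lam Ξ E) t := by
    have p0 := dormantProb_ne_zero (Ξ := Ξ) hα ht
    have q0 := dormantProb_ne_zero (Ξ := tiltedLaw α lam Ξ E) hr ht
    have pt : dormantProb (cycleLaw α Ξ) (2 * t) ≠ ∞ := measure_ne_top _ _
    have qt : dormantProb (cycleLaw (α + lam) (tiltedLaw α lam Ξ E)) (2 * t) ≠ ∞ :=
      measure_ne_top _ _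
    refine ⟨(dormantProb (cycleLaw α Ξ) (2 * t))⁻¹ * ENNReal.ofReal (Real.exp (lam * (2 * t))) *
      dormantProb (cycleLaw (α + lam) (tiltedLaw α lam Ξ E)) (2 * t), ?_, ?_, fun Ψ hΨ => ?_⟩
    · exact mul_ne_zero (mul_ne_zero (ENNReal.inv_ne_zero.2 pt)
        (ENNReal.ofReal_pos.2 (Real.exp_pos _)).ne') q0
    · exact ENNReal.mul_ne_top (ENNReal.mul_ne_top (ENNReal.inv_ne_top.2 p0)
        ENNReal.ofReal_ne_top) qt
    · rw [lintegral_referenceLaw ht (Ψ := fun ζ => EReal.exp (-hamiltonian E ζ) * Ψ ζ)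
        (by fun_prop), lintegral_referenceLaw ht hΨ,
        setLIntegral_dormantAt_exp_hamiltonian hα hr hE hE_top ht hΨ, mul_assoc,
        mul_assoc, ← mul_assoc (dormantProb _ _) (dormantProb _ _)⁻¹,
        ENNReal.mul_inv_cancel q0 qt, one_mul]
  have hZ : partitionFunction α Ξ E t = K := by
    have := hK (fun _ => 1) measurable_const
    simpa [partitionFunction] using this
  refine Measure.ext fun A hA => ?_
  have h1 := hK (A.indicator 1) (measurable_one.indicator hA)
  rw [lintegral_indicator_one hA] at h1
  rw [gibbsLaw, hZ, Measure.smul_apply, withDensity_apply _ hA, ← lintegral_indicator hA,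
    smul_eq_mul]
  have h2 : ∀ ζ, A.indicator (fun ζ => EReal.exp (-hamiltonian E ζ)) ζ =
      EReal.exp (-hamiltonian E ζ) * A.indicator 1 ζ := fun ζ => by
    by_cases h : ζ ∈ A <;> simp [h]
  simp_rw [h2]
  rw [h1, ← mul_assoc, ENNReal.inv_mul_cancel hK0 hKt, one_mul]

end Gibbs

/-! ### Local convergence of the conditioned process -/

section LocalConvergence

variable {𝒳 : Type*} [MeasurableSpace 𝒳] [MeasurableSingletonClass 𝒳] {α : ℝ}
  {Ξ : Measure (Ioi (0 : ℝ) × 𝒳)} {φ : ℝ → ℝ≥0∞} {K : ℝ≥0}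

theorem restrictTo_shift_neg {a b : ℝ} (hab : a ≤ b) (ζ : PointMeasure (Triangle × 𝒳)) :
    restrictTo (Icc a b) (shift (-a) ζ) = shift (-a) (restrictTo (Icc 0 (b - a)) ζ) := by
  rw [restrictTo_Icc_shift hab, add_neg_cancel, ← sub_eq_add_neg]

theorem referenceLaw_apply {t : ℝ} (ht : 0 < t) {B : Set (PointMeasure (Triangle × 𝒳))}
    (hB : MeasurableSet B) :
    referenceLaw α Ξ t B = (dormantProb (cycleLaw α Ξ) (2 * t))⁻¹ *
      iidLaw (cycleLaw α Ξ) (alternating ⁻¹' (dormantAt 𝒳 (2 * t) ∩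
        (fun ζ => restrictTo (Icc (-t) t) (shift t ζ)) ⁻¹' B)) := by
  have hD := measurableSet_dormantAt (𝒳 := 𝒳) (2 * t)
  have hG := measurable_restrictTo_shift (𝒳 := 𝒳) t ht
  have hp : dormantProb (cycleLaw α Ξ) (2 * t) = alternatingLaw α Ξ (dormantAt 𝒳 (2 * t)) := by
    rw [alternatingLaw, Measure.map_apply measurable_alternating hD, dormantProb]
    rfl
  rw [referenceLaw, Measure.map_apply hG hB, ProbabilityTheory.cond_apply hD, hp, alternatingLaw,
    Measure.map_apply measurable_alternating (hD.inter (hG hB))]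

/-- Everything is read from the future after time `t + a`: the window `[a, b]` becomes `[0, b - a]`
and the conditioning time `2t` becomes `t - a`. -/
theorem mem_dormantAt_and_restrictTo_mem_iff {a b t : ℝ} (hab : a ≤ b) (ha : -t ≤ a) (ha' : a ≤ t)
    (hb : b ≤ t) (A : Set (PointMeasure (Triangle × 𝒳))) (ζ : PointMeasure (Triangle × 𝒳)) :
    ζ ∈ dormantAt 𝒳 (2 * t) ∧ restrictTo (Icc a b) (restrictTo (Icc (-t) t) (shift t ζ)) ∈ A ↔
      shift (-a) (restrictTo (Icc 0 (b - a)) (restrictTo (Ici 0) (shift (t + a) ζ))) ∈ A ∧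
        restrictTo (Ici 0) (shift (t + a) ζ) ∈ dormantAt 𝒳 (t - a) := by
  rw [restrictTo_restrictTo (measurableSet_hitting_Icc hab) (Icc_subset_Icc ha hb),
    restrictTo_restrictTo (measurableSet_hitting_Icc (sub_nonneg.2 hab)) Icc_subset_Ici_self,
    ← restrictTo_shift_neg hab, shift_shift, add_neg_cancel_right,
    restrictTo_mem_dormantAt (show t - a ∈ Ici (0 : ℝ) from sub_nonneg.2 ha'), shift_mem_dormantAt,
    show t - a + (t + a) = 2 * t by ring, and_comm]

theorem referenceLaw_map_restrictTo {a b t : ℝ}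
    (hab : a ≤ b) (ht : 0 < t) (ha : -t ≤ a) (ha' : a ≤ t) (hb : b ≤ t)
    {A : Set (PointMeasure (Triangle × 𝒳))} (hA : MeasurableSet A) :
    (referenceLaw α Ξ t).map (restrictTo (Icc a b)) A =
      (dormantProb (cycleLaw α Ξ) (2 * t))⁻¹ *
        ((iidLaw (cycleLaw α Ξ)).map fun c => restrictTo (Ici 0) (shift (t + a) (alternating c)))
          (restrictTo (Icc 0 (b - a)) ⁻¹' (shift (-a) ⁻¹' A) ∩ dormantAt 𝒳 (t - a)) := by
  have hR : Measurable (restrictTo (Icc a b) : PointMeasure (Triangle × 𝒳) → _) :=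
    measurable_restrictTo (measurableSet_hitting_Icc hab)
  have hR' : Measurable (restrictTo (Icc 0 (b - a)) : PointMeasure (Triangle × 𝒳) → _) :=
    measurable_restrictTo (measurableSet_hitting_Icc (sub_nonneg.2 hab))
  have hF : Measurable fun c : ℕ → RenewalCycle 𝒳 =>
      restrictTo (Ici 0) (shift (t + a) (alternating c)) :=
    measurable_future.comp (measurable_id.prodMk measurable_const)
  rw [Measure.map_apply hR hA, referenceLaw_apply ht (hR hA), Measure.map_apply hF
    ((hR' (measurable_shift _ hA)).inter (measurableSet_dormantAt _))]
  congr 2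
  ext c
  simp only [mem_preimage, mem_inter_iff]
  exact mem_dormantAt_and_restrictTo_mem_iff hab ha ha' hb A (alternating c)

/-- The arithmetic of removing the conditioning: `x` is close to `y`, `y` to `q z` and `q` to `r`,
so `x / r` is close to `z`. The two truncated differences together are `|q - r|`. -/
theorem inv_mul_approx {x y z q r ε τ : ℝ≥0∞} (hr0 : r ≠ 0) (hrt : r ≠ ∞) (hz : z ≤ 1)
    (m1 : x ≤ y + τ) (m2 : y ≤ x + τ) (m3 : y ≤ q * z + ε) (m4 : q * z ≤ y + ε) :
    r⁻¹ * x ≤ z + r⁻¹ * (ε + τ + ((q - r) + (r - q))) ∧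
      z ≤ r⁻¹ * x + r⁻¹ * (ε + τ + ((q - r) + (r - q))) := by
  have hinv : z = r⁻¹ * (r * z) := by rw [← mul_assoc, ENNReal.inv_mul_cancel hr0 hrt, one_mul]
  have key : ∀ u v : ℝ≥0∞, u * z ≤ v * z + (u - v) := fun u v => calc
    u * z ≤ (v + (u - v)) * z := by gcongr; exact le_add_tsub
    _ = v * z + (u - v) * z := add_mul _ _ _
    _ ≤ v * z + (u - v) := by gcongr; exact mul_le_of_le_one_right zero_le hz
  constructor
  · nth_rewrite 1 [hinv]
    rw [← mul_add]
    gcongr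
    calc x ≤ q * z + ε + τ := m1.trans (by gcongr)
      _ ≤ r * z + (q - r) + ε + τ := by gcongr; exact key q r
      _ ≤ r * z + (q - r) + ε + τ + (r - q) := le_self_add
      _ = _ := by ring
  · nth_rewrite 1 [hinv]
    rw [← mul_add]
    gcongr
    calc r * z ≤ x + τ + ε + (r - q) := (key r q).trans (by gcongr; exact m4.trans (by gcongr))
      _ ≤ x + τ + ε + (r - q) + (q - r) := le_self_add
      _ = _ := by ring

/-- The joint probability of a window event and of dormancy at `2t` is compared with its stationary
value by `tendsto_tvDist`, then factorized by `exists_mixing`. Division by the probability of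
dormancy, whose limit is positive, leaves the stationary probability of the window event. -/
theorem HasRenewalDensity.tendstoLocallyTV (hα : 0 < α) [IsProbabilityMeasure Ξ]
    (h : HasRenewalDensity (cycleLaw α Ξ) φ K) :
    TendstoLocallyTV (referenceLaw α Ξ) (palmLaw (cycleLaw α Ξ)) := by
  have := isProbabilityMeasure_cycleLaw (Ξ := Ξ) hα
  have hpalm : IsProbabilityMeasure (palmLaw (cycleLaw α Ξ)) :=
    isProbabilityMeasure_palmLaw h.mean_ne_zero h.mean_ne_top
  intro a b hab
  obtain ⟨ε, hε, hmix⟩ := h.exists_mixing (sub_nonneg.2 hab.le)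
  have hτ := h.tendsto_tvDist
  have hp := h.tendsto_dormantProb
  have hq0 := h.palmLaw_dormantAt_ne_zero
  have hqt : palmLaw (cycleLaw α Ξ) (dormantAt 𝒳 0) ≠ ∞ := measure_ne_top _ _
  have hR : Measurable (restrictTo (Icc a b) : PointMeasure (Triangle × 𝒳) → _) :=
    measurable_restrictTo (measurableSet_hitting_Icc hab.le)
  have hR' : Measurable (restrictTo (Icc 0 (b - a)) : PointMeasure (Triangle × 𝒳) → _) :=
    measurable_restrictTo (measurableSet_hitting_Icc (sub_nonneg.2 hab.le))
  have hR0 : Measurable (restrictTo (Ici 0) : PointMeasure (Triangle × 𝒳) → _) :=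
    measurable_restrictTo (measurableSet_hitting_Ici 0)
  set τ : ℝ → ℝ≥0∞ := fun u => tvDist
    ((iidLaw (cycleLaw α Ξ)).map fun c => restrictTo (Ici 0) (shift u (alternating c)))
    ((palmLaw (cycleLaw α Ξ)).map (restrictTo (Ici 0))) with hτ_def
  set q := palmLaw (cycleLaw α Ξ) (dormantAt 𝒳 0) with hq
  set p := dormantProb (cycleLaw α Ξ) with hp_def
  have hlim : Tendsto (fun t : ℝ => (p (2 * t))⁻¹ *
      (ε (t - a) + τ (t + a) + ((q - p (2 * t)) + (p (2 * t) - q)))) atTop (𝓝 0) := by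
    have h2 : Tendsto (fun t : ℝ => 2 * t) atTop atTop := tendsto_id.const_mul_atTop two_pos
    have hp2 := hp.comp h2
    have h3 : Tendsto (fun t : ℝ => ε (t - a)) atTop (𝓝 0) :=
      hε.comp (tendsto_atTop_add_const_right _ (-a) tendsto_id)
    have h4 : Tendsto (fun t : ℝ => τ (t + a)) atTop (𝓝 0) :=
      hτ.comp (tendsto_atTop_add_const_right _ a tendsto_id)
    have h5 : Tendsto (fun t : ℝ => q - p (2 * t)) atTop (𝓝 0) := by
      simpa using ENNReal.Tendsto.sub (tendsto_const_nhds (x := q)) hp2 (Or.inl hqt)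
    have h6 : Tendsto (fun t : ℝ => p (2 * t) - q) atTop (𝓝 0) := by
      simpa using ENNReal.Tendsto.sub hp2 (tendsto_const_nhds (x := q)) (Or.inl hqt)
    have h7 : Tendsto (fun t : ℝ => ε (t - a) + τ (t + a) + ((q - p (2 * t)) + (p (2 * t) - q)))
        atTop (𝓝 0) := by
      simpa using (h3.add h4).add (h5.add h6)
    have h8 : Tendsto (fun t : ℝ => (p (2 * t))⁻¹) atTop (𝓝 q⁻¹) := tendsto_inv_iff.2 hp2
    simpa using ENNReal.Tendsto.mul h8 (Or.inr ENNReal.zero_ne_top) h7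
      (Or.inr (ENNReal.inv_ne_top.2 hq0))
  refine tendsto_of_tendsto_of_tendsto_of_le_of_le' tendsto_const_nhds hlim
    (Eventually.of_forall fun _ => zero_le) ?_
  filter_upwards [eventually_ge_atTop (-a), eventually_ge_atTop a, eventually_ge_atTop b,
    eventually_gt_atTop 0] with t h1 h2 h3 h4
  refine tvDist_le fun A hA => ?_
  rw [referenceLaw_map_restrictTo hab.le h4 (by linarith) h2 h3 hA, Measure.map_apply hR hA]
  have hA' : MeasurableSet (restrictTo (Icc 0 (b - a)) ⁻¹' (shift (-a) ⁻¹' A) ∩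
      dormantAt 𝒳 (t - a)) :=
    (hR' (measurable_shift _ hA)).inter (measurableSet_dormantAt _)
  have m1 := le_add_tvDist (μ := (iidLaw (cycleLaw α Ξ)).map fun c =>
    restrictTo (Ici 0) (shift (t + a) (alternating c)))
    (ν := (palmLaw (cycleLaw α Ξ)).map (restrictTo (Ici 0))) hA'
  have m2 := le_add_tvDist' (μ := (iidLaw (cycleLaw α Ξ)).map fun c =>
    restrictTo (Ici 0) (shift (t + a) (alternating c)))
    (ν := (palmLaw (cycleLaw α Ξ)).map (restrictTo (Ici 0))) hA'
  obtain ⟨m3, m4⟩ := hmix (t - a) (sub_nonneg.2 h2) (shift (-a) ⁻¹' A) (measurable_shift _ hA)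
  have e1 : (palmLaw (cycleLaw α Ξ)).map (restrictTo (Ici 0))
      (restrictTo (Icc 0 (b - a)) ⁻¹' (shift (-a) ⁻¹' A) ∩ dormantAt 𝒳 (t - a)) =
      palmLaw (cycleLaw α Ξ)
        (restrictTo (Icc 0 (b - a)) ⁻¹' (shift (-a) ⁻¹' A) ∩ dormantAt 𝒳 (t - a)) := by
    rw [Measure.map_apply hR0 hA']
    congr 1
    ext ζ
    change shift (-a) (restrictTo (Icc 0 (b - a)) (restrictTo (Ici 0) ζ)) ∈ A ∧
      restrictTo (Ici 0) ζ ∈ dormantAt 𝒳 (t - a) ↔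
      shift (-a) (restrictTo (Icc 0 (b - a)) ζ) ∈ A ∧ ζ ∈ dormantAt 𝒳 (t - a)
    rw [restrictTo_restrictTo (measurableSet_hitting_Icc (sub_nonneg.2 hab.le))
      Icc_subset_Ici_self,
      restrictTo_mem_dormantAt (show t - a ∈ Ici (0 : ℝ) from sub_nonneg.2 h2)]
  -- Stationarity moves the window from `[0, b - a]` back to `[a, b]`.
  have e2 : palmLaw (cycleLaw α Ξ) (restrictTo (Icc 0 (b - a)) ⁻¹' (shift (-a) ⁻¹' A)) =
      palmLaw (cycleLaw α Ξ) (restrictTo (Icc a b) ⁻¹' A) := by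
    conv_rhs => rw [← isStationary_palmLaw h.pos (-a)]
    rw [Measure.map_apply (measurable_shift _) (hR hA)]
    congr 1
    ext ζ
    change shift (-a) (restrictTo (Icc 0 (b - a)) ζ) ∈ A ↔
      restrictTo (Icc a b) (shift (-a) ζ) ∈ A
    rw [restrictTo_shift_neg hab.le]
  rw [e1] at m1 m2
  rw [e2] at m3 m4
  have hz : palmLaw (cycleLaw α Ξ) (restrictTo (Icc a b) ⁻¹' A) ≤ 1 := prob_le_one
  have hp0 : p (2 * t) ≠ 0 := dormantProb_ne_zero hα h4
  have hpt : p (2 * t) ≠ ∞ := measure_ne_top _ _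
  exact inv_mul_approx hp0 hpt hz m1 m2 m3 m4

theorem HasRenewalDensity.isStationaryVersion (hα : 0 < α) [IsProbabilityMeasure Ξ]
    (h : HasRenewalDensity (cycleLaw α Ξ) φ K) :
    IsStationaryVersion α Ξ (stationaryLaw α Ξ) := by
  have := isProbabilityMeasure_cycleLaw (Ξ := Ξ) hα
  rw [stationaryLaw_eq]
  refine ⟨isProbabilityMeasure_palmLaw h.mean_ne_zero h.mean_ne_top, isStationary_palmLaw h.pos, ?_⟩
  have e : ∀ t : ℝ, (alternatingLaw α Ξ).map (fun ζ => restrictTo (Ici 0) (shift t ζ)) =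
      (iidLaw (cycleLaw α Ξ)).map fun c => restrictTo (Ici 0) (shift t (alternating c)) :=
    fun t => Measure.map_map ((measurable_restrictTo (measurableSet_hitting_Ici 0)).comp
      (measurable_shift t)) measurable_alternating
  simp_rw [e]
  exact h.tendsto_tvDist

end LocalConvergence

/-! ### Mean durations after tilting -/

section Moments

variable {𝒳 : Type*} [MeasurableSpace 𝒳] {α lam : ℝ} {Ξ : Measure (Ioi (0 : ℝ) × 𝒳)}
  {E : 𝒳 → EReal}

theorem lintegral_duration_tiltedLaw (hα : 0 < α) (hr : 0 < α + lam) [IsProbabilityMeasure Ξ]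
    (hE : Measurable E) :
    ∫⁻ c, ENNReal.ofReal c.duration ∂cycleLaw (α + lam) (tiltedLaw α lam Ξ E) =
      ∫⁻ c, ENNReal.ofReal c.duration * cycleWeight lam E c ∂cycleLaw α Ξ := by
  rw [cycleLaw_tiltedLaw hα hr hE, lintegral_withDensity_eq_lintegral_mul _
    (measurable_cycleWeight hE lam) (by fun_prop)]
  exact lintegral_congr fun c => mul_comm _ _

theorem integrable_fst_of_lintegral_duration (hα : 0 < α) [IsProbabilityMeasure Ξ]
    (h : ∫⁻ c, ENNReal.ofReal c.duration ∂cycleLaw α Ξ ≠ ∞) :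
    Integrable (fun y : Ioi (0 : ℝ) × 𝒳 => (y.1 : ℝ)) Ξ := by
  have := isProbabilityMeasure_expMeasure hα
  refine ⟨by fun_prop, ?_⟩
  rw [hasFiniteIntegral_iff_ofReal (Eventually.of_forall fun y => y.1.2.le)]
  have e : ∫⁻ y, ENNReal.ofReal (y.1 : ℝ) ∂Ξ =
      ∫⁻ c, ENNReal.ofReal (c.2.1 : ℝ) ∂cycleLaw α Ξ := by
    rw [lintegral_cycleLaw hα (g := fun c => ENNReal.ofReal (c.2.1 : ℝ)) (by fun_prop)]
    simp
  rw [e]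
  refine lt_of_le_of_lt (lintegral_mono_ae ?_) h.lt_top
  filter_upwards [ae_pos_cycleLaw hα] with c hc
  exact ENNReal.ofReal_le_ofReal (le_add_of_nonneg_left hc.le)

end Moments

end MarkedPartition

/-! ### Main theorem -/

theorem mainTheorem7 {𝒳 : Type*} [TopologicalSpace 𝒳] [PolishSpace 𝒳] [MeasurableSpace 𝒳]
    [BorelSpace 𝒳] (α : ℝ) (hα : 0 < α)
    (Ξ : Measure (Ioi (0 : ℝ) × 𝒳)) [IsProbabilityMeasure Ξ]
    (hΞ : Integrable (fun y : Ioi (0 : ℝ) × 𝒳 => (y.1 : ℝ)) Ξ)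
    (E : 𝒳 → EReal) (hE : Measurable E) (hE_top : ∀ x, E x ≠ ⊤)
    (lam : ℝ)
    (hlam : ∫⁻ c : RenewalCycle 𝒳,
      EReal.exp (((-(lam * c.duration) : ℝ) : EReal) - E c.2.2) ∂cycleLaw α Ξ = 1)
    (hlam' : ∫⁻ c : RenewalCycle 𝒳, ENNReal.ofReal c.duration *
      EReal.exp (((-(lam * c.duration) : ℝ) : EReal) - E c.2.2) ∂cycleLaw α Ξ < ∞) :
    0 < α + lam ∧
    IsProbabilityMeasure (tiltedLaw α lam Ξ E) ∧
    Integrable (fun y : Ioi (0 : ℝ) × 𝒳 => (y.1 : ℝ)) (tiltedLaw α lam Ξ E) ∧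
    (∀ t : ℝ, 0 < t → IsProbabilityMeasure (gibbsLaw α Ξ E t)) ∧
    IsStationaryVersion (α + lam) (tiltedLaw α lam Ξ E)
      (stationaryLaw (α + lam) (tiltedLaw α lam Ξ E)) ∧
    TendstoLocallyTV (gibbsLaw α Ξ E) (stationaryLaw (α + lam) (tiltedLaw α lam Ξ E)) := by
  have hr : 0 < α + lam := rate_pos hα hE hlam
  have hprob : IsProbabilityMeasure (tiltedLaw α lam Ξ E) := isProbabilityMeasure_tiltedLaw hα hE hlam
  -- The second condition on `lam` says precisely that a tilted cycle has finite mean duration.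
  have hmean : ∫⁻ c, ENNReal.ofReal c.duration ∂cycleLaw (α + lam) (tiltedLaw α lam Ξ E) ≠ ∞ := by
    rw [lintegral_duration_tiltedLaw hα hr hE]
    exact hlam'.ne
  have hden := hasRenewalDensity_cycleLaw hr hmean
  have hgibbs : ∀ t : ℝ, 0 < t →
      gibbsLaw α Ξ E t = referenceLaw (α + lam) (tiltedLaw α lam Ξ E) t := fun t ht =>
    gibbsLaw_eq_referenceLaw hα hr hE hE_top ht
  refine ⟨hr, hprob, integrable_fst_of_lintegral_duration hr hmean, fun t ht => ?_,
    hden.isStationaryVersion hr, fun a b hab => ?_⟩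
  · rw [hgibbs t ht]
    exact isProbabilityMeasure_referenceLaw hr ht
  · refine (hden.tendstoLocallyTV hr a b hab).congr' ?_
    filter_upwards [eventually_gt_atTop 0] with t ht
    rw [hgibbs t ht, stationaryLaw_eq]
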